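/- Let $n,p,K\ge 1$ be integers and let $P_X$ be a probability distribution on $\mathbb{R}^K$ with finite fourth-order moments. Let $\mathcal{S}_K^{+}$ (resp. $\mathcal{S}_K^{++}$) be the cone of symmetric positive semidefinite (resp. the open cone of symmetric positive definite) real $K\times K$ matrices, and let $\mathcal{I}=\{i\in\{1,\dots,n\}^p : i_1\le i_2\le\dots\le i_p\}$. For $t\in[0,1]$ and $R\in\mathcal{S}_K^{+}$ consider the observations $$Y_i^{(t)}=\sqrt{\tfrac{(1-t)(p-1)!}{n^{p-1}}}\sum_{k=1}^K\prod_{a=1}^p X_{i_a k}+Z_i\quad(i\in\mathcal{I}),\qquad \widetilde Y_j^{(t,R)}=\sqrt{R}\,X_j+\widetilde Z_j\quad(1\le j\le n),$$ where $X_1,\dots,X_n$ are i.i.d. with law $P_X$ (the rows of an $n\times K$ matrix $\mathbf{X}$), the $Z_i$ are i.i.d. $\mathcal{N}(0,1)$, the $\widetilde Z_j$ are i.i.d. $\mathcal{N}(0,I_K)$, and all of these are independent. Let $$\mathcal{H}_{t,R}(\mathbf{x};\mathbf{Y},\widetilde{\mathbf{Y}})=\sum_{i\in\mathcal{I}}\Big[\tfrac{(1-t)(p-1)!}{2n^{p-1}}\Big(\sum_{k=1}^K\prod_{a=1}^p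 x_{i_a k}\Big)^2-\sqrt{\tfrac{(1-t)(p-1)!}{n^{p-1}}}\,Y_i\sum_{k=1}^K\prod_{a=1}^p x_{i_a k}\Big]+\sum_{j=1}^n\Big[\tfrac12 x_j^{T}Rx_j-\widetilde Y_j^{T}\sqrt{R}\,x_j\Big],$$ let $\langle\cdot\rangle_{t,R}$ denote the expectation over $\mathbf{x}\in\mathbb{R}^{n\times K}$ with respect to the posterior distribution proportional to $e^{-\mathcal{H}_{t,R}(\mathbf{x};\mathbf{Y}^{(t)},\widetilde{\mathbf{Y}}^{(t,R)})}\prod_{j}dP_X(x_j)$, and let $\mathbf{Q}=\frac1n\mathbf{x}^{T}\mathbf{X}$ be the overlap matrix. Write $A^{\circ m}$ for the entrywise $m$-th power of a matrix $A$. 1. For every $\epsilon\in\mathcal{S}_K^{+}$ there is a unique function $R(\cdot,\epsilon):[0,1]\to\mathcal{S}_K^{+}$ such that $$R(0,\epsilon)=\epsilon,\qquad \frac{d}{dt}R(t,\epsilon)=\big(\mathbb{E}\langle\mathbf{Q}\rangle_{t,R(t,\epsilon)}\big)^{\circ(p-1)}\quad\text{for all }t\in[0,1],$$ and this solution is continuously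 differentiable and bounded on $[0,1]$. 2. If $p$ is even then, for every $t\in[0,1]$, the map $\epsilon\mapsto R(t,\epsilon)$ is a $\mathcal{C}^1$-diffeomorphism from $\mathcal{S}_K^{++}$ onto its image (an open subset of the $K(K+1)/2$-dimensional space of symmetric matrices), and its Jacobian determinant satisfies $\det J_{R(t,\cdot)}(\epsilon)\ge 1$ for every $\epsilon\in\mathcal{S}_K^{++}$. -/

import Mathlib

open MeasureTheory ProbabilityTheory Set
open scoped Matrix

/- Matrices carry the Frobenius norm. -/
attribute [local instance] Matrix.frobeniusNormedAddCommGroup Matrix.frobeniusNormedSpace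

noncomputable section

namespace TensorInterp

/-- The index set of the observed tensor entries: `i = (i_1, ..., i_p)` in `[n]^p` with
`i_1 ≤ i_2 ≤ ... ≤ i_p`. -/
abbrev TensorIndex (p n : ℕ) : Type := {i : Fin p → Fin n // Monotone i}

/-- Configurations: `n` row vectors of length `K`, that is, real `n × K` arrays. -/
abbrev Config (n K : ℕ) : Type := Fin n → Fin K → ℝ

/-- The `K (K + 1) / 2`-dimensional real vector space of symmetric `K × K` matrices. -/
def SymMat (K : ℕ) : Submodule ℝ (Matrix (Fin K) (Fin K) ℝ) where
  carrier := {A | A.IsSymm}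
  add_mem' := fun hA hB => Matrix.IsSymm.add hA hB
  zero_mem' := Matrix.isSymm_zero
  smul_mem' := fun c _ hA => Matrix.IsSymm.smul hA c

/-- The closed cone of symmetric positive semidefinite `K × K` matrices. -/
def psdCone (K : ℕ) : Set (SymMat K) := {A | (A : Matrix (Fin K) (Fin K) ℝ).PosSemidef}

/-- The open cone of symmetric positive definite `K × K` matrices. -/
def pdCone (K : ℕ) : Set (SymMat K) := {A | (A : Matrix (Fin K) (Fin K) ℝ).PosDef}

open scoped MatrixOrder in
/-- The positive semidefinite square root of a positive semidefinite matrix. -/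
def matSqrt {K : ℕ} (R : Matrix (Fin K) (Fin K) ℝ) : Matrix (Fin K) (Fin K) ℝ := CFC.sqrt R

/-- `∑_k ∏_a x_{i_a k}`, the entry of index `i` of the tensor `∑_k x_{·k}^{⊗ p}`. -/
def tensorEntry {p n K : ℕ} (x : Config n K) (i : TensorIndex p n) : ℝ :=
  ∑ k, ∏ a, x (i.1 a) k

/-- The signal amplitude `√((1 - t) (p - 1)! / n^(p - 1))` of the tensor channel at time `t`. -/
def amplitude (p n : ℕ) (t : ℝ) : ℝ :=
  Real.sqrt ((1 - t) * ((p - 1).factorial : ℝ) / (n : ℝ) ^ (p - 1))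

/-- Sample space of the signal `X`, the tensor noise `Z` and the side noise `Z̃`. -/
abbrev Sample (p n K : ℕ) : Type := Config n K × (TensorIndex p n → ℝ) × Config n K

/-- Joint law of signal and noise: the rows of `X` are i.i.d. with law `PX`, all entries of `Z`
and `Z̃` are standard normal, and everything is independent. -/
def sampleLaw (p n : ℕ) {K : ℕ} (PX : Measure (Fin K → ℝ)) : Measure (Sample p n K) :=
  (Measure.pi fun _ : Fin n => PX).prod
    ((Measure.pi fun _ : TensorIndex p n => gaussianReal 0 1).prod
      (Measure.pi fun _ : Fin n => Measure.pi fun _ : Fin K => gaussianReal 0 1))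

/-- The tensor observations `Y_i = √((1 - t) (p - 1)! / n^(p - 1)) ∑_k ∏_a X_{i_a k} + Z_i`. -/
def obsTensor {p n K : ℕ} (t : ℝ) (ω : Sample p n K) : TensorIndex p n → ℝ :=
  fun i => amplitude p n t * tensorEntry ω.1 i + ω.2.1 i

/-- The side observations `Ỹ_j = √R X_j + Z̃_j`. -/
def obsSide {p n K : ℕ} (R : Matrix (Fin K) (Fin K) ℝ) (ω : Sample p n K) : Config n K :=
  fun j => matSqrt R *ᵥ ω.1 j + ω.2.2 j

/-- The Hamiltonian `H_{t,R}(x; Y, Ỹ)`. -/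
def hamiltonian {p n K : ℕ} (t : ℝ) (R : Matrix (Fin K) (Fin K) ℝ)
    (Y : TensorIndex p n → ℝ) (Y' : Config n K) (x : Config n K) : ℝ :=
  (∑ i : TensorIndex p n,
      ((1 - t) * ((p - 1).factorial : ℝ) / (2 * (n : ℝ) ^ (p - 1)) * tensorEntry x i ^ 2
        - amplitude p n t * Y i * tensorEntry x i))
    + ∑ j, (1 / 2 * (x j ⬝ᵥ R *ᵥ x j) - Y' j ⬝ᵥ matSqrt R *ᵥ x j)

/-- The normalisation `Z_{t,R}(Y, Ỹ) = ∫ exp (-H_{t,R}(x; Y, Ỹ)) ∏_j dPX(x_j)`. -/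
def partitionFn {p n K : ℕ} (PX : Measure (Fin K → ℝ)) (t : ℝ) (R : Matrix (Fin K) (Fin K) ℝ)
    (Y : TensorIndex p n → ℝ) (Y' : Config n K) : ℝ :=
  ∫ x, Real.exp (-hamiltonian t R Y Y' x) ∂(Measure.pi fun _ : Fin n => PX)

/-- The Gibbs bracket `⟨g(x)⟩_{t,R}`, the posterior mean of `g` given the observations `Y`, `Ỹ`. -/
def gibbs {p n K : ℕ} (PX : Measure (Fin K → ℝ)) (t : ℝ) (R : Matrix (Fin K) (Fin K) ℝ)
    (Y : TensorIndex p n → ℝ) (Y' : Config n K) (g : Config n K → ℝ) : ℝ :=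
  ∫ x, g x * (Real.exp (-hamiltonian t R Y Y' x) / partitionFn PX t R Y Y')
    ∂(Measure.pi fun _ : Fin n => PX)

/-- The overlap matrix `Q = (1 / n) xᵀ X`. -/
def overlap {n K : ℕ} (x X : Config n K) : Matrix (Fin K) (Fin K) ℝ :=
  Matrix.of fun l l' => 1 / (n : ℝ) * ∑ j, x j l * X j l'

/-- The `K × K` matrix `E⟨Q⟩_{t,R}`. -/
def meanOverlap (p n : ℕ) {K : ℕ} (PX : Measure (Fin K → ℝ)) (t : ℝ)
    (R : Matrix (Fin K) (Fin K) ℝ) : Matrix (Fin K) (Fin K) ℝ :=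
  Matrix.of fun l l' => ∫ ω : Sample p n K,
    gibbs PX t R (obsTensor t ω) (obsSide R ω) (fun x => overlap x ω.1 l l')
      ∂(sampleLaw p n PX)

/-- The `m`-th Hadamard (entrywise) power of a matrix. -/
def hadamardPow {K : ℕ} (A : Matrix (Fin K) (Fin K) ℝ) (m : ℕ) : Matrix (Fin K) (Fin K) ℝ :=
  A.map (· ^ m)

/-- `R : [0,1] → S_K^+` solves `R'(t) = (E⟨Q⟩_{t,R(t)})^{∘(p-1)}` on `[0,1]`, `R(0) = ε`
(with one-sided derivatives at the end points; the values of `R` off `[0,1]` play no role). -/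
structure IsInterpPath (p n : ℕ) {K : ℕ} (PX : Measure (Fin K → ℝ)) (ε : SymMat K)
    (R : ℝ → SymMat K) : Prop where
  mem_psdCone : ∀ t ∈ Icc (0 : ℝ) 1, R t ∈ psdCone K
  init : R 0 = ε
  ode : ∀ t ∈ Icc (0 : ℝ) 1,
    HasDerivWithinAt (fun s => (R s : Matrix (Fin K) (Fin K) ℝ))
      (hadamardPow (meanOverlap p n PX t (R t)) (p - 1)) (Icc 0 1) t

/-- `f` restricts to a `C¹`-diffeomorphism from the open set `S` onto the open set `f '' S`. -/
def IsC1DiffeoOnImage {E : Type*} [NormedAddCommGroup E] [NormedSpace ℝ E]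
    (f : E → E) (S : Set E) : Prop :=
  ∃ e : OpenPartialHomeomorph E E, e.source = S ∧ e.target = f '' S ∧ EqOn e f S ∧
    ContDiffOn ℝ 1 e e.source ∧ ContDiffOn ℝ 1 e.symm e.target

end TensorInterp

end

/-! Take pure Gaussian noise as reference measure. Then `exp (-H)` is a product of two
Cameron–Martin densities: it is the density of the observations given `x`, and the partition
function `Z` is the density of the data. Hence the mean of a product of two posterior means is an
integral over pure noise of `wInt f * wInt g / Z`, and Bayes optimality replaces the signal in
`E⟨Q⟩` by a second posterior mean (`meanOverlap_eq_posteriorOverlap`). In this form the overlap is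
symmetric, positive semidefinite and bounded by second moments, and its Hadamard powers are positive
semidefinite by Schur's product theorem.

For the derivative in `R`, Gaussian covariances add: raising `R` by `s² S` has the law of an extra
independent observation of `s √S x_j`. Expanding posterior means in `s`, the lower-order part
integrates to the value at `s = 0` by a martingale property, and the coefficient of `s²` is a mean
product of posterior covariances (`IsWeight.tendsto_tilted_sub_div_sq`). Neither the matrix square
root nor a Gaussian integration by parts has to be differentiated. The expansion needs bounded
signals, so the prior is first cut to a box; the cut is removed after integrating along positive
semidefinite increments (`posteriorOverlap_add_sub`). Fourth moments dominate the products of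
covariances, so the overlap is Lipschitz on the closed cone and continuously differentiable on the
open one (`abs_sub_le_mul_norm`, `hasFDerivAt_of_integral`).

Existence and uniqueness: composed with a Lipschitz retraction onto the cone, the field is bounded
and globally Lipschitz on all symmetric matrices, and Picard–Lindelöf applies on `[0,1]`. Velocities
are positive semidefinite, so a path that starts in the cone remains there and solves the original
equation.

Diffeomorphism: the derivative of the flow solves the variational equation, and by Liouville its
determinant is at least one as soon as the divergence is nonnegative. The divergence is the sum over
`(l, l')` of `(p-1) Q_{ll'}^{p-2}`, with `Q` the mean overlap, times the derivative of `Q_{ll'}`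
along the symmetrised matrix unit. The power is nonnegative for even `p`; the derivative is
nonnegative because posterior covariances form a Gram matrix, which exhibits it as a mean of sums of
squares (`overlapDeriv_add_nonneg`). The inverse function theorem and backward uniqueness conclude.
-/

/-! ### Global ODEs, differentiability of flows, Liouville's inequality. -/

section GlobalODE

open Filter Topology Metric
open scoped NNReal

variable {E : Type*} [NormedAddCommGroup E] [NormedSpace ℝ E]

theorem hasDerivWithinAt_Ici_of_Icc {f : ℝ → E} {f' : E} {a b t : ℝ} (ht : t ∈ Ico a b)
    (h : HasDerivWithinAt f f' (Icc a b) t) : HasDerivWithinAt f f' (Ici t) t :=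
  h.mono_of_mem_nhdsWithin (Icc_mem_nhdsGE_of_mem ht)

theorem continuousOn_of_hasDerivWithinAt_Icc {f f' : ℝ → E} {a b : ℝ}
    (h : ∀ t ∈ Icc a b, HasDerivWithinAt f (f' t) (Icc a b) t) : ContinuousOn f (Icc a b) :=
  fun t ht => (h t ht).continuousWithinAt

/-- A bounded, uniformly Lipschitz vector field has global solutions. -/
theorem exists_solution_of_lipschitz_of_bounded [CompleteSpace E] {f : ℝ → E → E} {K L : ℝ≥0}
    (hLip : ∀ t ∈ Icc (0 : ℝ) 1, LipschitzWith K (f t))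
    (hcont : ∀ x, ContinuousOn (fun t => f t x) (Icc 0 1))
    (hbound : ∀ t ∈ Icc (0 : ℝ) 1, ∀ x, ‖f t x‖ ≤ L) (x₀ : E) :
    ∃ α : ℝ → E, α 0 = x₀ ∧
      ∀ t ∈ Icc (0 : ℝ) 1, HasDerivWithinAt α (f t (α t)) (Icc 0 1) t := by
  -- The ball has radius `L`: at speed at most `L` a trajectory cannot leave it within unit time, so
  -- one application covers `[0,1]`.
  have h : IsPicardLindelof f (tmin := 0) (tmax := 1) ⟨0, by simp⟩ x₀ L 0 L K :=
    { lipschitzOnWith := fun t ht => (hLip t ht).lipschitzOnWith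
      continuousOn := fun x _ => hcont x
      norm_le := fun t ht x _ => hbound t ht x
      mul_max_le := by simp }
  exact h.exists_eq_forall_mem_Icc_hasDerivWithinAt₀

/-- Radial truncation onto the ball of radius `r`. -/
noncomputable def radialClamp (r : ℝ) (x : E) : E := (r / max r ‖x‖) • x

theorem radialClamp_of_norm_le {r : ℝ} (hr : 0 < r) {x : E} (hx : ‖x‖ ≤ r) :
    radialClamp r x = x := by
  rw [radialClamp, max_eq_left hx, div_self hr.ne', one_smul]

theorem norm_radialClamp_le {r : ℝ} (hr : 0 < r) (x : E) : ‖radialClamp r x‖ ≤ r := by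
  have hm : 0 < max r ‖x‖ := lt_max_of_lt_left hr
  rw [radialClamp, norm_smul, Real.norm_of_nonneg (by positivity), div_mul_eq_mul_div,
    div_le_iff₀ hm]
  gcongr
  exact le_max_right _ _

theorem norm_radialClamp_le_norm {r : ℝ} (hr : 0 < r) (x : E) : ‖radialClamp r x‖ ≤ ‖x‖ := by
  have hm : 0 < max r ‖x‖ := lt_max_of_lt_left hr
  rw [radialClamp, norm_smul, Real.norm_of_nonneg (by positivity)]
  exact mul_le_of_le_one_left (norm_nonneg _) ((div_le_one hm).2 (le_max_left _ _))

/-- With `c(x) = r / max r ‖x‖`, the difference is `c(x) (x - y) + (c(x) - c(y)) y`, and each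
summand has norm at most `‖x - y‖`. The constant 2 serves every normed space. -/
theorem lipschitzWith_radialClamp {r : ℝ} (hr : 0 < r) :
    LipschitzWith 2 (radialClamp r : E → E) := by
  refine LipschitzWith.of_dist_le_mul fun x y => ?_
  rw [dist_eq_norm, dist_eq_norm]
  have hx : 0 < max r ‖x‖ := lt_max_of_lt_left hr
  have hy : 0 < max r ‖y‖ := lt_max_of_lt_left hr
  have hcx : r / max r ‖x‖ ≤ 1 := (div_le_one hx).2 (le_max_left _ _)
  have e : radialClamp r x - radialClamp r y
      = (r / max r ‖x‖) • (x - y) + (r / max r ‖x‖ - r / max r ‖y‖) • y := by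
    simp only [radialClamp]; module
  have h1 : |max r ‖y‖ - max r ‖x‖| ≤ ‖x - y‖ := by
    have := abs_max_sub_max_le_abs ‖y‖ ‖x‖ r
    rw [max_comm r, max_comm r]
    refine this.trans ?_
    rw [norm_sub_rev]
    exact abs_norm_sub_norm_le y x
  have h2 : r / max r ‖x‖ - r / max r ‖y‖
      = (r / max r ‖x‖) * ((max r ‖y‖ - max r ‖x‖) / max r ‖y‖) := by
    field_simp
  have h3 : ‖(r / max r ‖x‖ - r / max r ‖y‖) • y‖ ≤ ‖x - y‖ := by
    rw [norm_smul, h2, norm_mul, Real.norm_of_nonneg (by positivity), Real.norm_eq_abs, abs_div,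
      abs_of_pos hy]
    calc r / max r ‖x‖ * (|max r ‖y‖ - max r ‖x‖| / max r ‖y‖) * ‖y‖
        = (r / max r ‖x‖) * (|max r ‖y‖ - max r ‖x‖| * (‖y‖ / max r ‖y‖)) := by ring
      _ ≤ 1 * (‖x - y‖ * 1) := by
          gcongr
          exact (div_le_one hy).2 (le_max_right _ _)
      _ = ‖x - y‖ := by ring
  have h4 : ‖(r / max r ‖x‖) • (x - y)‖ ≤ ‖x - y‖ := by
    rw [norm_smul, Real.norm_of_nonneg (by positivity)]
    exact mul_le_of_le_one_left (norm_nonneg _) hcx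
  calc ‖radialClamp r x - radialClamp r y‖ ≤ ‖x - y‖ + ‖x - y‖ := by
        rw [e]; exact (norm_add_le _ _).trans (add_le_add h4 h3)
    _ = ((2 : ℝ≥0) : ℝ) * ‖x - y‖ := by push_cast; ring

/-- Linear equations with continuous coefficients have global solutions. -/
theorem exists_solution_linear [CompleteSpace E] {A : ℝ → E →L[ℝ] E}
    (hA : ContinuousOn A (Icc 0 1)) (x₀ : E) :
    ∃ α : ℝ → E, α 0 = x₀ ∧ ∀ t ∈ Icc (0 : ℝ) 1, HasDerivWithinAt α (A t (α t)) (Icc 0 1) t := by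
  obtain ⟨C, hC⟩ := isCompact_Icc.exists_bound_of_continuousOn hA
  have hC0 : 0 ≤ C := (norm_nonneg _).trans (hC 0 (by simp))
  -- This radius exceeds the Gronwall bound for a linear equation of norm at most `C` on unit time,
  -- so the truncated equation never meets its truncation.
  set r : ℝ := ‖x₀‖ * Real.exp C + 1
  have hr : 0 < r := by positivity
  have hle : ∀ t ∈ Icc (0 : ℝ) 1, ∀ y : E, ‖A t y‖ ≤ C * ‖y‖ := fun t ht y =>
    (A t).le_of_opNorm_le (hC t ht) y
  obtain ⟨α, h0, hα⟩ := exists_solution_of_lipschitz_of_bounded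
    (f := fun t x => A t (radialClamp r x)) (K := C.toNNReal * 2) (L := (C * r).toNNReal)
    (fun t ht => by
      refine LipschitzWith.comp ?_ (lipschitzWith_radialClamp hr)
      refine (A t).lipschitz.weaken ?_
      rw [← NNReal.coe_le_coe, Real.coe_toNNReal _ hC0]
      exact hC t ht)
    (fun x => hA.clm_apply continuousOn_const)
    (fun t ht x => by
      rw [Real.coe_toNNReal _ (by positivity)]
      exact (hle t ht _).trans (by gcongr; exact norm_radialClamp_le hr x)) x₀
  refine ⟨α, h0, fun t ht => ?_⟩
  have hb : ∀ t ∈ Icc (0 : ℝ) 1, ‖α t‖ ≤ gronwallBound ‖x₀‖ C 0 (t - 0) := by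
    refine norm_le_gronwallBound_of_norm_deriv_right_le (continuousOn_of_hasDerivWithinAt_Icc hα)
      (fun t ht => hasDerivWithinAt_Ici_of_Icc ht (hα t (Ico_subset_Icc_self ht))) (by rw [h0]) ?_
    intro t ht
    rw [add_zero]
    exact (hle t (Ico_subset_Icc_self ht) _).trans (by gcongr; exact norm_radialClamp_le_norm hr _)
  have hbt : ‖α t‖ ≤ r := by
    refine (hb t ht).trans ?_
    rw [gronwallBound_ε0, sub_zero]
    have : Real.exp (C * t) ≤ Real.exp C :=
      Real.exp_le_exp.2 (mul_le_of_le_one_right hC0 ht.2)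
    have := mul_le_mul_of_nonneg_left this (norm_nonneg x₀)
    simp only [r]; linarith
  simpa only [radialClamp_of_norm_le hr hbt] using hα t ht

/-- Uniform continuity of the Jacobian along a compact curve. -/
theorem exists_radius_norm_jacobian_sub_le {E F : Type*} [NormedAddCommGroup E]
    [NormedAddCommGroup F] {f' : ℝ → E → F}
    {Ω : Set E} (hΩ : IsOpen Ω) (hf' : ContinuousOn (Function.uncurry f') (Icc (0 : ℝ) 1 ×ˢ Ω))
    {γ : ℝ → E} (hγ : ContinuousOn γ (Icc 0 1)) (hγΩ : ∀ t ∈ Icc (0 : ℝ) 1, γ t ∈ Ω)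
    {η : ℝ} (hη : 0 < η) :
    ∃ r > 0, ∀ t ∈ Icc (0 : ℝ) 1, ∀ y ∈ ball (γ t) r, y ∈ Ω ∧ ‖f' t y - f' t (γ t)‖ ≤ η := by
  have hg : Continuous fun t : Icc (0 : ℝ) 1 => γ t := hγ.domRestrict
  -- Tube lemma: joint continuity at each `(0, t)` and compactness of the interval give one
  -- neighbourhood of displacements valid for all times.
  have key : ∀ᶠ h : E in 𝓝 0, ∀ t ∈ (univ : Set (Icc (0 : ℝ) 1)),
      γ t + h ∈ Ω ∧ ‖f' t (γ t + h) - f' t (γ t)‖ < η := by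
    refine isCompact_univ.eventually_forall_of_forall_eventually fun t _ => ?_
    have hc : Continuous fun z : E × Icc (0 : ℝ) 1 => γ z.2 + z.1 :=
      (hg.comp continuous_snd).add continuous_fst
    have hmem : ∀ᶠ z : E × Icc (0 : ℝ) 1 in 𝓝 (0, t), γ z.2 + z.1 ∈ Ω :=
      hc.continuousAt.eventually (hΩ.mem_nhds (by simpa using hγΩ t t.2))
    have h1 : Tendsto (fun z : E × Icc (0 : ℝ) 1 => f' z.2 (γ z.2 + z.1)) (𝓝 (0, t))
        (𝓝 (f' t (γ t))) := by
      have := hf' (t, γ t) ⟨t.2, hγΩ t t.2⟩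
      refine this.tendsto.comp (f := fun z : E × Icc (0 : ℝ) 1 => ((z.2 : ℝ), γ z.2 + z.1)) ?_
      refine tendsto_nhdsWithin_iff.2 ⟨?_, hmem.mono fun z hz => ⟨z.2.2, hz⟩⟩
      refine ((continuous_subtype_val.comp continuous_snd).prodMk hc).tendsto' _ _ ?_
      simp
    have h2 : Tendsto (fun z : E × Icc (0 : ℝ) 1 => f' z.2 (γ z.2)) (𝓝 (0, t))
        (𝓝 (f' t (γ t))) := by
      have := hf' (t, γ t) ⟨t.2, hγΩ t t.2⟩
      refine this.tendsto.comp (f := fun z : E × Icc (0 : ℝ) 1 => ((z.2 : ℝ), γ z.2)) ?_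
      refine tendsto_nhdsWithin_iff.2 ⟨?_, Eventually.of_forall fun z => ⟨z.2.2, hγΩ _ z.2.2⟩⟩
      exact ((continuous_subtype_val.comp continuous_snd).prodMk
        (hg.comp continuous_snd)).tendsto' _ _ (by simp)
    have h3 := (h1.sub h2).norm
    rw [sub_self, norm_zero] at h3
    filter_upwards [hmem, h3.eventually (gt_mem_nhds hη)] with z hz1 hz2 using ⟨hz1, hz2⟩
  obtain ⟨r, hr, h⟩ := Metric.eventually_nhds_iff.1 key
  refine ⟨r, hr, fun t ht y hy => ?_⟩
  have := h (y := y - γ t) (by simpa [dist_eq_norm] using hy) ⟨t, ht⟩ (mem_univ _)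
  simp only [add_sub_cancel] at this
  exact ⟨this.1, this.2.le⟩

/-- The flow of a `C¹` vector field is strictly differentiable in the initial condition, and its
derivative solves the variational equation. -/
theorem exists_hasStrictFDerivAt_flow [CompleteSpace E] {f : ℝ → E → E} {f' : ℝ → E → E →L[ℝ] E}
    {K : ℝ≥0} (hLip : ∀ t ∈ Icc (0 : ℝ) 1, LipschitzWith K (f t)) {Ω : Set E} (hΩ : IsOpen Ω)
    (hd : ∀ t ∈ Icc (0 : ℝ) 1, ∀ x ∈ Ω, HasFDerivAt (f t) (f' t x) x)
    (hf' : ContinuousOn (Function.uncurry f') (Icc (0 : ℝ) 1 ×ˢ Ω))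
    {φ : ℝ → E → E} (h0 : ∀ x ∈ Ω, φ 0 x = x)
    (hφ : ∀ x ∈ Ω, ∀ t ∈ Icc (0 : ℝ) 1,
      HasDerivWithinAt (fun s => φ s x) (f t (φ t x)) (Icc 0 1) t)
    (hmem : ∀ x ∈ Ω, ∀ t ∈ Icc (0 : ℝ) 1, φ t x ∈ Ω) {x : E} (hx : x ∈ Ω) :
    ∃ V : ℝ → E →L[ℝ] E, V 0 = ContinuousLinearMap.id ℝ E ∧
      (∀ t ∈ Icc (0 : ℝ) 1, HasDerivWithinAt V ((f' t (φ t x)).comp (V t)) (Icc 0 1) t) ∧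
      ∀ t ∈ Icc (0 : ℝ) 1, HasStrictFDerivAt (φ t) (V t) x := by
  have hφc : ∀ x ∈ Ω, ContinuousOn (fun s => φ s x) (Icc 0 1) := fun x hx =>
    continuousOn_of_hasDerivWithinAt_Icc (hφ x hx)
  have hAc : ContinuousOn (fun t => f' t (φ t x)) (Icc 0 1) :=
    hf'.comp (f := fun t : ℝ => (t, φ t x)) (continuousOn_id.prodMk (hφc x hx))
      (fun t ht => ⟨ht, hmem x hx t ht⟩)
  obtain ⟨V, hV0, hV⟩ := exists_solution_linear
    (A := fun t => ContinuousLinearMap.compL ℝ E E E (f' t (φ t x)))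
    ((ContinuousLinearMap.compL ℝ E E E).continuous.comp_continuousOn hAc)
    (ContinuousLinearMap.id ℝ E)
  simp only [ContinuousLinearMap.compL_apply] at hV
  refine ⟨V, hV0, hV, ?_⟩
  -- Gronwall: trajectories separate by at most the factor `exp K`, uniformly in time.
  have hdist : ∀ y ∈ Ω, ∀ z ∈ Ω, ∀ t ∈ Icc (0 : ℝ) 1,
      ‖φ t y - φ t z‖ ≤ Real.exp K * ‖y - z‖ := by
    intro y hy z hz t ht
    have := dist_le_of_trajectories_ODE_of_mem (v := f) (s := fun _ => univ)
      (fun t ht => (hLip t (Ico_subset_Icc_self ht)).lipschitzOnWith) (hφc y hy)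
      (fun t ht => hasDerivWithinAt_Ici_of_Icc ht (hφ y hy t (Ico_subset_Icc_self ht)))
      (fun _ _ => mem_univ _) (hφc z hz)
      (fun t ht => hasDerivWithinAt_Ici_of_Icc ht (hφ z hz t (Ico_subset_Icc_self ht)))
      (fun _ _ => mem_univ _) le_rfl t ht
    rw [dist_eq_norm, dist_eq_norm, h0 y hy, h0 z hz, sub_zero] at this
    rw [mul_comm]
    refine this.trans ?_
    gcongr
    exact mul_le_of_le_one_right K.2 ht.2
  obtain ⟨C, hC⟩ := isCompact_Icc.exists_bound_of_continuousOn hAc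
  have hC0 : 0 ≤ C := (norm_nonneg _).trans (hC 0 (by simp))
  intro t ht
  refine HasStrictFDerivAt.of_isLittleO ?_
  rw [Asymptotics.isLittleO_iff]
  intro c hc
  -- The Gronwall bound at time one for a forcing of size `exp K`. The rate is `C + 1` rather than
  -- `C` so that it is nonzero and the closed formula applies; dividing by `B + 1` below avoids a
  -- zero denominator.
  set B : ℝ := gronwallBound 0 (C + 1) (Real.exp K) 1 with hB
  have hB0 : 0 ≤ B := by
    have := gronwallBound_mono (K := C + 1) le_rfl (Real.exp_pos K).le (by positivity)
      zero_le_one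
    rwa [gronwallBound_x0] at this
  obtain ⟨r, hr, hrad⟩ := exists_radius_norm_jacobian_sub_le hΩ hf' (hφc x hx) (hmem x hx)
    (η := c / (B + 1)) (by positivity)
  have hnear : ∀ᶠ y in 𝓝 x, y ∈ Ω ∧ ∀ s ∈ Icc (0 : ℝ) 1, φ s y ∈ ball (φ s x) r := by
    have h1 : ∀ᶠ y in 𝓝 x, Real.exp K * ‖y - x‖ < r := by
      have : Tendsto (fun y => Real.exp K * ‖y - x‖) (𝓝 x) (𝓝 0) :=
        (by fun_prop : Continuous fun y => Real.exp K * ‖y - x‖).tendsto' _ _ (by simp)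
      exact this.eventually (gt_mem_nhds hr)
    filter_upwards [h1, hΩ.mem_nhds hx] with y hy hyΩ
    refine ⟨hyΩ, fun s hs => ?_⟩
    rw [mem_ball, dist_eq_norm]
    exact (hdist y hyΩ x hx s hs).trans_lt hy
  have hnear2 : ∀ᶠ q : E × E in 𝓝 (x, x), (q.1 ∈ Ω ∧ ∀ s ∈ Icc (0 : ℝ) 1, φ s q.1 ∈ ball (φ s x) r)
      ∧ (q.2 ∈ Ω ∧ ∀ s ∈ Icc (0 : ℝ) 1, φ s q.2 ∈ ball (φ s x) r) := by
    rw [nhds_prod_eq]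
    exact hnear.prod_mk hnear
  filter_upwards [hnear2] with ⟨y, z⟩ ⟨⟨hy, hyr⟩, ⟨hz, hzr⟩⟩
  have hη : 0 ≤ c / (B + 1) * (Real.exp K * ‖y - z‖) := by positivity
  have hδ := norm_le_gronwallBound_of_norm_deriv_right_le
    (f := fun s => φ s y - φ s z - V s (y - z))
    (f' := fun s => f s (φ s y) - f s (φ s z) - f' s (φ s x) (V s (y - z)))
    (δ := 0) (K := C + 1) (ε := c / (B + 1) * (Real.exp K * ‖y - z‖)) (a := 0) (b := 1)
    (((hφc y hy).sub (hφc z hz)).sub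
      ((continuousOn_of_hasDerivWithinAt_Icc hV).clm_apply continuousOn_const))
    (fun s hs => by
      have hs' := Ico_subset_Icc_self hs
      refine hasDerivWithinAt_Ici_of_Icc hs (((hφ y hy s hs').sub (hφ z hz s hs')).sub ?_)
      simpa using (hV s hs').clm_apply (hasDerivWithinAt_const _ _ (y - z)))
    (by simp [h0 y hy, h0 z hz, hV0])
    (fun s hs => by
      have hs' := Ico_subset_Icc_self hs
      have hmv : ‖f s (φ s y) - f s (φ s z) - f' s (φ s x) (φ s y - φ s z)‖
          ≤ c / (B + 1) * ‖φ s y - φ s z‖ :=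
        (convex_ball (φ s x) r).norm_image_sub_le_of_norm_hasFDerivWithin_le'
          (fun w hw => (hd s hs' w (hrad s hs' w hw).1).hasFDerivWithinAt)
          (fun w hw => (hrad s hs' w hw).2) (hzr s hs') (hyr s hs')
      -- The defect of `φ y - φ z - V (y - z)` splits into a mean value error, small because the
      -- Jacobian is nearly constant along the tube, and a linear term in the defect itself, which
      -- Gronwall absorbs.
      have e : f s (φ s y) - f s (φ s z) - f' s (φ s x) (V s (y - z))
          = (f s (φ s y) - f s (φ s z) - f' s (φ s x) (φ s y - φ s z))
            + f' s (φ s x) (φ s y - φ s z - V s (y - z)) := by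
        simp only [map_sub]; abel
      rw [e]
      have h1 := (f' s (φ s x)).le_of_opNorm_le (hC s hs') (φ s y - φ s z - V s (y - z))
      have h2 : c / (B + 1) * ‖φ s y - φ s z‖ ≤ c / (B + 1) * (Real.exp K * ‖y - z‖) := by
        gcongr; exact hdist y hy z hz s hs'
      have h3 := norm_nonneg (φ s y - φ s z - V s (y - z))
      refine (norm_add_le _ _).trans ?_
      linarith)
    t ht
  have hscale : ∀ m : ℝ, gronwallBound 0 (C + 1) (m * Real.exp K) 1 = m * B := by
    intro m
    rw [hB, gronwallBound_of_K_ne_0 (by positivity), gronwallBound_of_K_ne_0 (by positivity)]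
    ring
  have hmono : gronwallBound 0 (C + 1) (c / (B + 1) * (Real.exp K * ‖y - z‖)) (t - 0)
      ≤ (c / (B + 1) * ‖y - z‖) * B := by
    rw [← hscale]
    refine (gronwallBound_mono (K := C + 1) le_rfl hη (by positivity)
      (by simpa using ht.2 : t - 0 ≤ 1)).trans (le_of_eq ?_)
    congr 1; ring
  refine (hδ.trans hmono).trans ?_
  have : B / (B + 1) ≤ 1 := (div_le_one (by positivity)).2 (by linarith)
  calc c / (B + 1) * ‖y - z‖ * B = (c * ‖y - z‖) * (B / (B + 1)) := by ring
    _ ≤ (c * ‖y - z‖) * 1 := by gcongr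
    _ = c * ‖y - z‖ := mul_one _

/-- A function that is strictly differentiable on an open set is `C¹` there. -/
theorem contDiffOn_one_of_hasStrictFDerivAt {F : Type*} [NormedAddCommGroup F] [NormedSpace ℝ F]
    {f : E → F} {f' : E → E →L[ℝ] F} {S : Set E} (hS : IsOpen S)
    (h : ∀ x ∈ S, HasStrictFDerivAt f (f' x) x) : ContDiffOn ℝ 1 f S := by
  have hc : ContinuousOn f' S := by
    intro x hx
    refine ContinuousAt.continuousWithinAt ?_
    rw [Metric.continuousAt_iff']
    intro ε hε
    obtain ⟨c, hc0, hcε⟩ := exists_between hε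
    have h1 := (Asymptotics.isLittleO_iff.1 (h x hx).isLittleO) hc0
    rw [nhds_prod_eq] at h1
    obtain ⟨U, hU, hUs⟩ := (Filter.eventually_prod_self_iff
      (r := fun z w => ‖f z - f w - f' x (z - w)‖ ≤ c * ‖z - w‖) |>.1 h1)
    filter_upwards [eventually_mem_nhds_iff.2 hU, hS.mem_nhds hx] with y hyU hyS
    rw [dist_eq_norm]
    refine lt_of_le_of_lt ?_ hcε
    -- Strict differentiability makes `f - f' x` Lipschitz with constant `c` near `x`, so its
    -- derivative `f' y - f' x` at nearby `y` has norm at most `c`.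
    have hd : HasFDerivAt (fun z => f z - f' x z) (f' y - f' x) y :=
      (h y hyS).hasFDerivAt.sub (f' x).hasFDerivAt
    refine hd.le_of_lip' hc0.le ?_
    filter_upwards [hyU] with z hz
    have := hUs z hz y (mem_of_mem_nhds hyU)
    simp only [map_sub] at this
    convert this using 2
    abel
  rw [← zero_add (1 : WithTop ℕ∞), contDiffOn_succ_iff_fderiv_of_isOpen hS, contDiffOn_zero]
  refine ⟨fun x hx => (h x hx).hasFDerivAt.differentiableAt.differentiableWithinAt,
    fun h => absurd h (by simp), ?_⟩
  exact hc.congr fun x hx => (h x hx).hasFDerivAt.fderiv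

/-- Liouville's inequality: a linear flow with nonnegative trace has determinant at least one. -/
theorem one_le_det_of_trace_nonneg [FiniteDimensional ℝ E] {A V : ℝ → E →L[ℝ] E}
    (hV0 : V 0 = ContinuousLinearMap.id ℝ E)
    (hV : ∀ t ∈ Icc (0 : ℝ) 1, HasDerivWithinAt V ((A t).comp (V t)) (Icc 0 1) t)
    (hA : ∀ t ∈ Icc (0 : ℝ) 1, 0 ≤ LinearMap.trace ℝ E (A t).toLinearMap) {t : ℝ}
    (ht : t ∈ Icc (0 : ℝ) 1) : 1 ≤ (V t).det := by
  classical
  set b := Module.finBasis ℝ E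
  let m : (E →L[ℝ] E) → Matrix (Fin (Module.finrank ℝ E)) (Fin (Module.finrank ℝ E)) ℝ :=
    fun f => LinearMap.toMatrix b b f.toLinearMap
  let mL : (E →L[ℝ] E) →L[ℝ] (Fin (Module.finrank ℝ E) → Fin (Module.finrank ℝ E) → ℝ) :=
    LinearMap.toContinuousLinearMap (F' := Fin (Module.finrank ℝ E) → Fin (Module.finrank ℝ E) → ℝ)
      ((LinearMap.toMatrix b b).toLinearMap ∘ₗ ContinuousLinearMap.coeLM ℝ)
  have hm : ∀ f g : E →L[ℝ] E, m (f.comp g) = m f * m g := fun f g =>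
    LinearMap.toMatrix_comp b b b f.toLinearMap g.toLinearMap
  have hdet : ∀ f : E →L[ℝ] E, f.det = (m f).det := fun f =>
    (LinearMap.det_toMatrix b f.toLinearMap).symm
  have htr : ∀ f : E →L[ℝ] E, LinearMap.trace ℝ E f.toLinearMap = (m f).trace := fun f =>
    LinearMap.trace_eq_matrix_trace ℝ b f.toLinearMap
  let D : ContinuousMultilinearMap ℝ
      (fun _ : Fin (Module.finrank ℝ E) => Fin (Module.finrank ℝ E) → ℝ) ℝ :=
    ⟨(Matrix.detRowAlternating (R := ℝ) (n := Fin (Module.finrank ℝ E))).toMultilinearMap,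
      (continuous_id.matrix_det :
        Continuous fun M : Matrix (Fin (Module.finrank ℝ E)) (Fin (Module.finrank ℝ E)) ℝ =>
          M.det)⟩
  have hD : ∀ M : Matrix (Fin (Module.finrank ℝ E)) (Fin (Module.finrank ℝ E)) ℝ,
      D M = M.det := fun M => rfl
  have hderiv : ∀ s ∈ Icc (0 : ℝ) 1, HasDerivWithinAt (fun t => (V t).det)
      ((m (A s)).trace * (V s).det) (Icc 0 1) s := by
    intro s hs
    have h1 : HasDerivWithinAt (fun t i => m (V t) i) (fun i => (m (A s) * m (V s)) i)
        (Icc 0 1) s := by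
      have := (mL.hasFDerivAt (x := V s)).comp_hasDerivWithinAt s (hV s hs)
      rw [show mL ((A s).comp (V s)) = m (A s) * m (V s) from hm _ _] at this
      exact this
    have h2 := (D.hasFDerivAt (fun i => m (V s) i)).comp_hasDerivWithinAt s h1
    simp only [hdet]
    refine HasDerivWithinAt.congr_deriv (f := fun t => (m (V t)).det) h2 ?_
    symm
    rw [ContinuousMultilinearMap.linearDeriv_apply, Matrix.trace, Finset.sum_mul]
    refine Finset.sum_congr rfl fun i _ => ?_
    -- Row `i` of `A V` is a combination of the rows of `V`. Put in place of row `i` of `V`, only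
    -- its diagonal term `A i i` survives in the determinant; summing over `i` gives `tr A * det V`.
    have h3 : D (Function.update (fun i => m (V s) i) i ((m (A s) * m (V s)) i))
        = (Matrix.updateRow (m (V s)) i (∑ j, m (A s) i j • m (V s) j)).det := by
      rw [← hD]
      congr 2
      ext k
      simp [Matrix.mul_apply, Finset.sum_apply]
    rw [h3, Matrix.det_updateRow_sum]
    simp
  -- The square has derivative `2 tr(A) det²`, whose sign is known without knowing the sign of the
  -- determinant.
  have hsq : MonotoneOn (fun t => (V t).det ^ 2) (Icc 0 1) := by
    refine monotoneOn_of_hasDerivWithinAt_nonneg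
      (f' := fun s => 2 * (V s).det * ((m (A s)).trace * (V s).det)) (convex_Icc 0 1)
      (fun s hs => ((hderiv s hs).continuousWithinAt.pow 2)) (fun s hs => ?_) (fun s hs => ?_)
    · have hs' := interior_subset hs
      simpa using ((hderiv s hs').mono interior_subset).fun_pow 2
    · have := hA s (interior_subset hs)
      rw [htr] at this
      have h2 := mul_nonneg this (sq_nonneg (V s).det)
      nlinarith
  have hone : (V 0).det = 1 := by rw [hV0]; exact LinearMap.det_id
  have hge : ∀ s ∈ Icc (0 : ℝ) 1, 1 ≤ (V s).det ^ 2 := fun s hs => by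
    have := hsq (by simp : (0 : ℝ) ∈ Icc (0 : ℝ) 1) hs hs.1
    simpa [hone] using this
  by_contra hlt
  have hneg : (V t).det ≤ 0 := by
    by_contra hpos
    have := hge t ht
    nlinarith
  -- The determinant starts at 1; a nonpositive value would force a zero in between, which `det² ≥
  -- 1` excludes.
  have hcont : ContinuousOn (fun t => (V t).det) (Icc 0 t) := fun s hs =>
    ((hderiv s ⟨hs.1, hs.2.trans ht.2⟩).continuousWithinAt).mono (Icc_subset_Icc_right ht.2)
  obtain ⟨s, hs, hs0⟩ := intermediate_value_Icc' ht.1 hcont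
    (⟨hneg, by rw [hone]; exact zero_le_one⟩ : (0 : ℝ) ∈ Icc ((V t).det) ((V 0).det))
  have := hge s ⟨hs.1, hs.2.trans ht.2⟩
  simp only at hs0
  rw [hs0] at this
  norm_num at this

/-- An injective map that is strictly differentiable with invertible derivative on an open set is a
`C¹` diffeomorphism onto its image. -/
theorem isC1DiffeoOnImage_of_hasStrictFDerivAt [FiniteDimensional ℝ E] {f : E → E}
    {f' : E → E →L[ℝ] E} {S : Set E} (hS : IsOpen S)
    (h : ∀ x ∈ S, HasStrictFDerivAt f (f' x) x) (hdet : ∀ x ∈ S, (f' x).det ≠ 0)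
    (hinj : InjOn f S) : TensorInterp.IsC1DiffeoOnImage f S := by
  have := FiniteDimensional.complete ℝ E
  -- The identity is a default value at points with singular derivative; there are none in `S`.
  let g : E → E ≃L[ℝ] E := fun x =>
    if hx : (f' x).det ≠ 0 then (f' x).toContinuousLinearEquivOfDetNeZero hx
    else ContinuousLinearEquiv.refl ℝ E
  have hg : ∀ x ∈ S, HasStrictFDerivAt f (g x : E →L[ℝ] E) x := by
    intro x hx
    have : (g x : E →L[ℝ] E) = f' x := by
      simp only [g, dif_pos (hdet x hx)]
      exact ContinuousLinearMap.coe_toContinuousLinearEquivOfDetNeZero _ _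
    rw [this]
    exact h x hx
  have hC1 : ContDiffOn ℝ 1 f S := contDiffOn_one_of_hasStrictFDerivAt hS h
  have hopen : IsOpenMap (S.domRestrict f) := by
    rw [isOpenMap_iff_nhds_le]
    rintro ⟨x, hx⟩
    have h1 := (hg x hx).map_nhds_eq_of_equiv
    have h2 : 𝓝 (⟨x, hx⟩ : S) = comap Subtype.val (𝓝 x) := nhds_subtype_eq_comap
    have h3 : map (S.domRestrict f) (𝓝 ⟨x, hx⟩) = map f (map Subtype.val (𝓝 (⟨x, hx⟩ : S))) := by
      rw [Filter.map_map]; rfl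
    rw [h3, map_nhds_subtype_coe_eq_nhds hx (hS.mem_nhds hx), h1]
    exact le_rfl
  let e : OpenPartialHomeomorph E E :=
    OpenPartialHomeomorph.ofContinuousOpenRestrict (hinj.toPartialEquiv f S) hC1.continuousOn
      hopen hS
  refine ⟨e, rfl, rfl, fun _ _ => rfl, hC1, ?_⟩
  intro y hy
  have hx : e.symm y ∈ S := e.map_target hy
  refine (OpenPartialHomeomorph.contDiffAt_symm e hy (f₀' := g (e.symm y))
    (hg _ hx).hasFDerivAt (hC1.contDiffAt (hS.mem_nhds hx))).contDiffWithinAt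

end GlobalODE

noncomputable section

/-! ### Dominated convergence with a varying bound. -/

section Pratt

open Filter Topology

/-- Pratt's lemma: dominated convergence with a varying dominating function. -/
theorem tendsto_integral_of_tendsto_of_abs_le {Ω A : Type*} {mΩ : MeasurableSpace Ω}
    {ν : Measure Ω} {l : Filter A} [l.IsCountablyGenerated] {f g : A → Ω → ℝ} {f₀ g₀ : Ω → ℝ}
    (hfm : ∀ a, AEStronglyMeasurable (f a) ν)
    (hg : ∀ a, Integrable (g a) ν) (hg₀ : Integrable g₀ ν)
    (hfg : ∀ a, ∀ᵐ ω ∂ν, |f a ω| ≤ g a ω) (hfg₀ : ∀ᵐ ω ∂ν, |f₀ ω| ≤ g₀ ω)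
    (hf : ∀ᵐ ω ∂ν, Tendsto (fun a => f a ω) l (𝓝 (f₀ ω)))
    (hgl : ∀ᵐ ω ∂ν, Tendsto (fun a => g a ω) l (𝓝 (g₀ ω)))
    (hgi : Tendsto (fun a => ∫ ω, g a ω ∂ν) l (𝓝 (∫ ω, g₀ ω ∂ν))) :
    Tendsto (fun a => ∫ ω, f a ω ∂ν) l (𝓝 (∫ ω, f₀ ω ∂ν)) := by
  -- Clipping `f a` to `[-g₀, g₀]` gives an integrand with a fixed dominating function.
  set k : A → Ω → ℝ := fun a ω => max (-g₀ ω) (min (g₀ ω) (f a ω))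
  have hkm : ∀ a, AEStronglyMeasurable (k a) ν := fun a =>
    hg₀.aestronglyMeasurable.neg.sup (hg₀.aestronglyMeasurable.inf (hfm a))
  have hg₀0 : ∀ᵐ ω ∂ν, 0 ≤ g₀ ω := hfg₀.mono fun ω h => (abs_nonneg _).trans h
  have hkb : ∀ a, ∀ᵐ ω ∂ν, ‖k a ω‖ ≤ g₀ ω := fun a => by
    filter_upwards [hg₀0] with ω h
    rw [Real.norm_eq_abs, abs_le]
    exact ⟨le_max_left _ _, max_le (by linarith) (min_le_left _ _)⟩
  have hklim : Tendsto (fun a => ∫ ω, k a ω ∂ν) l (𝓝 (∫ ω, f₀ ω ∂ν)) := by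
    refine tendsto_integral_filter_of_dominated_convergence g₀ (.of_forall hkm) (.of_forall hkb)
      hg₀ ?_
    filter_upwards [hf, hfg₀] with ω h h0
    have := (tendsto_const_nhds (x := -g₀ ω)).max ((tendsto_const_nhds (x := g₀ ω)).min h)
    rwa [min_eq_right (abs_le.1 h0).2, max_eq_right (abs_le.1 h0).1] at this
  have hmin : Tendsto (fun a => ∫ ω, min (g a ω) (g₀ ω) ∂ν) l (𝓝 (∫ ω, g₀ ω ∂ν)) := by
    refine tendsto_integral_filter_of_dominated_convergence g₀
      (.of_forall fun a => (hg a).aestronglyMeasurable.inf hg₀.aestronglyMeasurable)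
      (.of_forall fun a => ?_) hg₀ ?_
    · filter_upwards [hg₀0, hfg a] with ω h h'
      rw [Real.norm_of_nonneg (le_min ((abs_nonneg _).trans h') h)]
      exact min_le_right _ _
    · filter_upwards [hgl] with ω h
      simpa using h.min (tendsto_const_nhds (x := g₀ ω))
  have hfi : ∀ a, Integrable (f a) ν := fun a => (hg a).mono' (hfm a) (hfg a)
  have hki : ∀ a, Integrable (k a) ν := fun a => hg₀.mono' (hkm a) (hkb a)
  have hmi : ∀ a, Integrable (fun ω => min (g a ω) (g₀ ω)) ν := fun a => (hg a).inf hg₀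
  -- Clipping removes only the part of `|f a|` above `g₀`, at most `g a - min (g a) g₀`. The
  -- integral of this excess tends to zero since the integrals of `g a` converge.
  have hdiff : ∀ a, ‖(∫ ω, f a ω ∂ν) - ∫ ω, k a ω ∂ν‖
      ≤ (∫ ω, g a ω ∂ν) - ∫ ω, min (g a ω) (g₀ ω) ∂ν := fun a => by
    rw [← integral_sub (hfi a) (hki a), ← integral_sub (hg a) (hmi a)]
    refine norm_integral_le_of_norm_le ((hg a).sub (hmi a)) ?_
    filter_upwards [hfg a, hg₀0] with ω h h0
    rw [Real.norm_eq_abs]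
    simp only [k]
    rw [abs_le] at h ⊢
    rcases le_total (f a ω) (g₀ ω) with h1 | h1 <;> rcases le_total (g a ω) (g₀ ω) with h2 | h2 <;>
    rcases le_total (-g₀ ω) (f a ω) with h3 | h3 <;>
    simp only [h1, h2, h3, min_eq_left, min_eq_right, max_eq_left, max_eq_right] <;>
    first
      | (constructor <;> linarith)
      | (rw [max_eq_right (by linarith)]; constructor <;> linarith)
  have h0 : Tendsto (fun a => (∫ ω, g a ω ∂ν) - ∫ ω, min (g a ω) (g₀ ω) ∂ν) l (𝓝 0) := by
    simpa using hgi.sub hmin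
  have h1 := (squeeze_zero_norm hdiff h0).add hklim
  simpa using h1

end Pratt

/-! ### Gaussian arrays: shifts, linear forms, covariances. -/

section GaussianVectors

open scoped ENNReal

/-- One-dimensional Cameron–Martin formula, from `-(y - θ)² / 2 = -y² / 2 + (θ y - θ² / 2)`. -/
theorem gaussianReal_map_add_eq_withDensity (θ : ℝ) :
    (gaussianReal 0 1).map (· + θ) =
      (gaussianReal 0 1).withDensity fun y => ENNReal.ofReal (Real.exp (θ * y - θ ^ 2 / 2)) := by
  rw [gaussianReal_map_add_const, gaussianReal_of_var_ne_zero _ one_ne_zero,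
    gaussianReal_of_var_ne_zero _ one_ne_zero,
    ← withDensity_mul _ (measurable_gaussianPDF _ _) (by fun_prop)]
  congr 1
  ext y
  rw [Pi.mul_apply, gaussianPDF, gaussianPDF, ← ENNReal.ofReal_mul (gaussianPDFReal_nonneg _ _ _)]
  congr 1
  simp only [gaussianPDFReal, NNReal.coe_one, mul_one]
  rw [mul_assoc, ← Real.exp_add]
  congr 2
  ring

/-- The densities multiply by independence, checked on boxes. General factors allow two uses:
entries within a row, then rows within an array. -/
theorem pi_map_add_eq_withDensity {ι : Type*} [Fintype ι] {E : ι → Type*}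
    [∀ i, MeasurableSpace (E i)] [∀ i, Add (E i)] [∀ i, MeasurableAdd (E i)] {ν : ∀ i, Measure (E i)}
    [∀ i, IsProbabilityMeasure (ν i)] {θ : ∀ i, E i} {ρ : ∀ i, E i → ℝ≥0∞}
    (hρ : ∀ i, Measurable (ρ i)) (h : ∀ i, (ν i).map (· + θ i) = (ν i).withDensity (ρ i)) :
    (Measure.pi ν).map (· + θ) = (Measure.pi ν).withDensity fun y => ∏ i, ρ i (y i) := by
  have hm : ∀ i, Measurable fun y : E i => y + θ i := fun i => measurable_add_const (θ i)
  have hp : ∀ i, IsProbabilityMeasure ((ν i).map (· + θ i)) := fun i =>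
    Measure.isProbabilityMeasure_map (hm i).aemeasurable
  have e1 : (Measure.pi ν).map (· + θ) = Measure.pi fun i => (ν i).map (· + θ i) :=
    Measure.pi_map_pi (f := fun i (y : E i) => y + θ i) fun i => (hm i).aemeasurable
  rw [e1]
  refine Measure.pi_eq fun s hs => ?_
  rw [withDensity_apply _ (MeasurableSet.univ_pi hs), ← lintegral_indicator (.univ_pi hs)]
  have e2 : ∀ y : ∀ i, E i, (univ.pi s).indicator (fun y => ∏ i, ρ i (y i)) y
      = ∏ i, (s i).indicator (ρ i) (y i) := fun y => by
    classical
    by_cases hy : y ∈ univ.pi s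
    · rw [indicator_of_mem hy]
      exact Finset.prod_congr rfl fun i _ => (indicator_of_mem (hy i (mem_univ i)) _).symm
    · rw [indicator_of_notMem hy]
      simp only [mem_univ_pi, not_forall] at hy
      obtain ⟨i, hi⟩ := hy
      exact (Finset.prod_eq_zero (Finset.mem_univ i) (indicator_of_notMem hi _)).symm
  simp only [e2]
  rw [lintegral_prod_eq_prod_lintegral_of_indepFun Finset.univ
    (fun i (y : ∀ i, E i) => (s i).indicator (ρ i) (y i))
    (iIndepFun_pi fun i => ((hρ i).indicator (hs i)).aemeasurable)
    fun i => ((hρ i).indicator (hs i)).comp (measurable_pi_apply i)]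
  refine Finset.prod_congr rfl fun i _ => ?_
  rw [h i, withDensity_apply _ (hs i), ← lintegral_indicator (hs i)]
  exact (measurePreserving_eval ν i).lintegral_comp ((hρ i).indicator (hs i))

/-- The law of a Gaussian array with independent standard entries. -/
def gaussianArray (n K : ℕ) : Measure (Fin n → Fin K → ℝ) :=
  Measure.pi fun _ => Measure.pi fun _ => gaussianReal 0 1

instance (n K : ℕ) : IsProbabilityMeasure (gaussianArray n K) := by
  unfold gaussianArray; infer_instance

variable {n K : ℕ}

theorem pi_gaussianReal_map_add_eq_withDensity {ι : Type*} [Fintype ι] (θ : ι → ℝ) :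
    (Measure.pi fun _ : ι => gaussianReal 0 1).map (· + θ) =
      (Measure.pi fun _ : ι => gaussianReal 0 1).withDensity
        fun y => ENNReal.ofReal (Real.exp (θ ⬝ᵥ y - θ ⬝ᵥ θ / 2)) := by
  rw [pi_map_add_eq_withDensity (fun i => by fun_prop)
    fun i => gaussianReal_map_add_eq_withDensity (θ i)]
  congr 1
  ext y
  rw [← ENNReal.ofReal_prod_of_nonneg (fun i _ => (Real.exp_pos _).le), ← Real.exp_sum]
  simp only [dotProduct, Finset.sum_sub_distrib, Finset.sum_div, pow_two]

theorem gaussianArray_map_add_eq_withDensity (θ : Fin n → Fin K → ℝ) :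
    (gaussianArray n K).map (· + θ) = (gaussianArray n K).withDensity
      fun y => ENNReal.ofReal (Real.exp ((∑ j, θ j ⬝ᵥ y j) - (∑ j, θ j ⬝ᵥ θ j) / 2)) := by
  rw [gaussianArray, pi_map_add_eq_withDensity (fun i => by fun_prop)
    fun i => pi_gaussianReal_map_add_eq_withDensity (θ i)]
  congr 1
  ext y
  rw [← ENNReal.ofReal_prod_of_nonneg (fun i _ => (Real.exp_pos _).le), ← Real.exp_sum]
  simp only [Finset.sum_sub_distrib, Finset.sum_div]

theorem integral_cexp_gaussianArray (c : Fin n → Fin K → ℝ) :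
    ∫ y, Complex.exp ((∑ j, c j ⬝ᵥ y j : ℝ) * Complex.I) ∂(gaussianArray n K)
      = Complex.exp (-((∑ j, c j ⬝ᵥ c j : ℝ) : ℂ) / 2) := by
  have e : ∀ y : Fin n → Fin K → ℝ, Complex.exp ((∑ j, c j ⬝ᵥ y j : ℝ) * Complex.I)
      = ∏ j, ∏ k, Complex.exp (c j k * y j k * Complex.I) := fun y => by
    simp only [dotProduct, ← Complex.exp_sum, ← Finset.sum_mul]
    push_cast
    rfl
  simp only [e]
  rw [gaussianArray, integral_fintype_prod_eq_prod
    (f := fun j (z : Fin K → ℝ) => ∏ k, Complex.exp (c j k * z k * Complex.I))]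
  have e2 : ∀ j, ∫ z, ∏ k, Complex.exp (c j k * z k * Complex.I)
      ∂(Measure.pi fun _ : Fin K => gaussianReal 0 1)
      = ∏ k, Complex.exp (-(c j k : ℂ) ^ 2 / 2) := fun j => by
    rw [integral_fintype_prod_eq_prod
      (f := fun k (z : ℝ) => Complex.exp (c j k * z * Complex.I))]
    refine Finset.prod_congr rfl fun k _ => ?_
    have := charFun_gaussianReal (μ := 0) (v := 1) (c j k)
    rw [charFun_apply_real] at this
    rw [this]
    congr 1
    push_cast
    ring
  simp only [e2]
  simp only [← Complex.exp_sum]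
  congr 1
  push_cast [dotProduct]
  rw [← Finset.sum_neg_distrib, Finset.sum_div]
  refine Finset.sum_congr rfl fun j _ => ?_
  rw [← Finset.sum_neg_distrib, Finset.sum_div]
  refine Finset.sum_congr rfl fun k _ => ?_
  ring

theorem measurable_sum_dotProduct (c : Fin n → Fin K → ℝ) :
    Measurable fun y : Fin n → Fin K → ℝ => ∑ j, c j ⬝ᵥ y j := by
  simp only [dotProduct]; fun_prop

theorem map_sum_dotProduct_gaussianArray (c : Fin n → Fin K → ℝ) :
    (gaussianArray n K).map (fun y => ∑ j, c j ⬝ᵥ y j)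
      = gaussianReal 0 (∑ j, c j ⬝ᵥ c j).toNNReal := by
  have h0 : 0 ≤ ∑ j, c j ⬝ᵥ c j :=
    Finset.sum_nonneg fun j _ => Finset.sum_nonneg fun k _ => mul_self_nonneg _
  have hm := measurable_sum_dotProduct c
  have : IsProbabilityMeasure ((gaussianArray n K).map (fun y => ∑ j, c j ⬝ᵥ y j)) :=
    Measure.isProbabilityMeasure_map hm.aemeasurable
  refine Measure.ext_of_charFun (funext fun t => ?_)
  rw [charFun_apply_real, charFun_gaussianReal,
    integral_map hm.aemeasurable (by fun_prop), Real.coe_toNNReal _ h0]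
  have := integral_cexp_gaussianArray (t • c)
  simp only [Pi.smul_apply, smul_dotProduct, dotProduct_smul, ← Finset.smul_sum] at this
  simp only [smul_eq_mul] at this
  push_cast at this ⊢
  rw [this]
  congr 1
  ring

theorem integral_sq_gaussianArray (c : Fin n → Fin K → ℝ) :
    Integrable (fun y => (∑ j, c j ⬝ᵥ y j) ^ 2) (gaussianArray n K) ∧
    ∫ y, (∑ j, c j ⬝ᵥ y j) ^ 2 ∂(gaussianArray n K) = ∑ j, c j ⬝ᵥ c j := by
  have h0 : 0 ≤ ∑ j, c j ⬝ᵥ c j :=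
    Finset.sum_nonneg fun j _ => Finset.sum_nonneg fun k _ => mul_self_nonneg _
  have hm := measurable_sum_dotProduct c
  have hL := map_sum_dotProduct_gaussianArray c
  have hi : Integrable (fun z : ℝ => z ^ 2) ((gaussianArray n K).map (fun y => ∑ j, c j ⬝ᵥ y j)) := by
    rw [hL]; exact (memLp_id_gaussianReal 2).integrable_sq
  refine ⟨hi.comp_measurable hm, ?_⟩
  have h1 := integral_map (μ := gaussianArray n K) hm.aemeasurable (f := fun z : ℝ => z ^ 2)
    (by fun_prop)
  rw [← h1, hL]
  have h2 := variance_fun_id_gaussianReal (μ := 0) (v := (∑ j, c j ⬝ᵥ c j).toNNReal)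
  rw [variance_of_integral_eq_zero (by fun_prop) (by simp)] at h2
  rw [h2, Real.coe_toNNReal _ h0]

/-- Linear forms of a standard Gaussian array have covariance equal to their inner product. -/
theorem integral_mul_gaussianArray (a b : Fin n → Fin K → ℝ) :
    Integrable (fun y => (∑ j, a j ⬝ᵥ y j) * ∑ j, b j ⬝ᵥ y j) (gaussianArray n K) ∧
    ∫ y, (∑ j, a j ⬝ᵥ y j) * (∑ j, b j ⬝ᵥ y j) ∂(gaussianArray n K) = ∑ j, a j ⬝ᵥ b j := by
  obtain ⟨i1, e1⟩ := integral_sq_gaussianArray (a + b)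
  obtain ⟨i2, e2⟩ := integral_sq_gaussianArray (a - b)
  have e : (fun y : Fin n → Fin K → ℝ => (∑ j, a j ⬝ᵥ y j) * ∑ j, b j ⬝ᵥ y j)
      -- Polarisation reduces the covariance to the variances of `a + b` and `a - b`.
      = fun y => 1 / 4 * ((∑ j, (a + b) j ⬝ᵥ y j) ^ 2 - (∑ j, (a - b) j ⬝ᵥ y j) ^ 2) := by
    ext y
    simp only [Pi.add_apply, Pi.sub_apply, add_dotProduct, sub_dotProduct, Finset.sum_add_distrib,
      Finset.sum_sub_distrib]
    ring
  rw [e]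
  refine ⟨(i1.sub i2).const_mul _, ?_⟩
  rw [integral_const_mul, integral_sub i1 i2, e1, e2]
  simp only [Pi.add_apply, Pi.sub_apply, add_dotProduct, sub_dotProduct, dotProduct_add,
    dotProduct_sub, Finset.sum_add_distrib, Finset.sum_sub_distrib]
  simp only [dotProduct_comm (b _) (a _)]
  ring

/-- Since `exp (c|z|) ≤ exp (cz) + exp (-cz)`, one-dimensional exponential moments suffice. This
provides the integrable envelope for difference quotients of tilts. -/
theorem integrable_exp_abs_gaussianArray (c : ℝ) :
    Integrable (fun y => Real.exp (c * ∑ j, ∑ k, |y j k|)) (gaussianArray n K) := by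
  have h1 : Integrable (fun z : ℝ => Real.exp (c * |z|)) (gaussianReal 0 1) := by
    refine ((integrable_exp_mul_gaussianReal c).add (integrable_exp_mul_gaussianReal (-c))).mono'
      (by fun_prop) (.of_forall fun z => ?_)
    rw [Real.norm_of_nonneg (Real.exp_pos _).le]
    have h1 := Real.exp_pos (c * z)
    have h2 := Real.exp_pos (-c * z)
    rcases abs_cases z with ⟨h, _⟩ | ⟨h, _⟩ <;> rw [h]
    · simp only [Pi.add_apply]; linarith
    · rw [show c * -z = -c * z by ring]; simp only [Pi.add_apply]; linarith
  have h2 : Integrable (fun z : Fin K → ℝ => ∏ k, Real.exp (c * |z k|))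
      (Measure.pi fun _ => gaussianReal 0 1) := Integrable.fintype_prod fun _ => h1
  have h3 : Integrable (fun y : Fin n → Fin K → ℝ => ∏ j, ∏ k, Real.exp (c * |y j k|))
      (gaussianArray n K) :=
    Integrable.fintype_prod (f := fun _ (z : Fin K → ℝ) => ∏ k, Real.exp (c * |z k|)) fun _ => h2
  refine h3.congr (.of_forall fun y => ?_)
  simp only [← Real.exp_sum, Finset.mul_sum]

/-- The law of `(B y_j)_j` for a standard Gaussian array `y` depends on `B` through `B Bᵀ`, and adding
independent copies adds these covariances. -/
theorem map_mulVec_gaussianArray {A B C : Matrix (Fin K) (Fin K) ℝ}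
    (h : A * Aᵀ = B * Bᵀ + C * Cᵀ) :
    (gaussianArray n K).map (fun y j => A *ᵥ y j)
      = ((gaussianArray n K).prod (gaussianArray n K)).map
        (fun z j => B *ᵥ z.1 j + C *ᵥ z.2 j) := by
  have hmul : ∀ M : Matrix (Fin K) (Fin K) ℝ,
      Measurable fun y : Fin n → Fin K → ℝ => fun j => M *ᵥ y j := fun M => by
    refine measurable_pi_lambda _ fun j => measurable_pi_lambda _ fun k => ?_
    simp only [Matrix.mulVec, dotProduct]; fun_prop
  have hm1 := hmul A
  have hm2 : Measurable fun (z : (Fin n → Fin K → ℝ) × (Fin n → Fin K → ℝ)) (j : Fin n) =>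
      B *ᵥ z.1 j + C *ᵥ z.2 j :=
    ((hmul B).comp measurable_fst).add ((hmul C).comp measurable_snd)
  have := Measure.isProbabilityMeasure_map (μ := gaussianArray n K) hm1.aemeasurable
  have := Measure.isProbabilityMeasure_map
    (μ := (gaussianArray n K).prod (gaussianArray n K)) hm2.aemeasurable
  refine Measure.ext_of_charFunDual (funext fun L => ?_)
  set c : Fin n → Fin K → ℝ := fun j k => L (Pi.single j (Pi.single k 1)) with hc
  -- Every functional is given by its coefficient array, so both characteristic functionals are
  -- explicit Gaussian exponentials and agree by the covariance identity `h`.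
  have hL : ∀ h : Fin n → Fin K → ℝ, L h = ∑ j, c j ⬝ᵥ h j := fun h => by
    have : h = ∑ j, ∑ k, h j k • (Pi.single j (Pi.single k 1) : Fin n → Fin K → ℝ) := by
      ext j k
      simp [Finset.sum_apply, Pi.single_apply, apply_ite, ite_apply]
    conv_lhs => rw [this]
    simp only [map_sum, map_smul, smul_eq_mul, dotProduct, hc, mul_comm]
  rw [charFunDual_apply, charFunDual_apply, integral_map hm1.aemeasurable (by fun_prop),
    integral_map hm2.aemeasurable (by fun_prop)]
  simp only [hL, dotProduct_add, Finset.sum_add_distrib, Matrix.dotProduct_mulVec]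
  push_cast
  simp only [add_mul, Complex.exp_add]
  have h1 := integral_cexp_gaussianArray (fun j => c j ᵥ* A)
  have h2 := integral_cexp_gaussianArray (fun j => c j ᵥ* B)
  have h3 := integral_cexp_gaussianArray (fun j => c j ᵥ* C)
  push_cast at h1 h2 h3
  rw [integral_prod_mul (μ := gaussianArray n K) (ν := gaussianArray n K)
    (fun y : Fin n → Fin K → ℝ => Complex.exp ((∑ j, ((c j ᵥ* B ⬝ᵥ y j : ℝ) : ℂ)) * Complex.I))
    (fun y : Fin n → Fin K → ℝ => Complex.exp ((∑ j, ((c j ᵥ* C ⬝ᵥ y j : ℝ) : ℂ)) * Complex.I)),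
    h1, h2, h3, ← Complex.exp_add]
  have hq : ∀ (M : Matrix (Fin K) (Fin K) ℝ) (v : Fin K → ℝ),
      v ᵥ* M ⬝ᵥ v ᵥ* M = v ⬝ᵥ (M * Mᵀ) *ᵥ v := fun M v => by
    rw [← Matrix.mulVec_mulVec, ← Matrix.dotProduct_mulVec, Matrix.mulVec_transpose]
  simp only [hq, h, Matrix.add_mulVec, dotProduct_add]
  congr 1
  push_cast
  rw [Finset.sum_add_distrib]
  ring

end GaussianVectors

end

noncomputable section

/-! ### Abstract likelihoods: posterior moments and their continuity. -/

section Weights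

open Filter Topology

variable {X Y : Type*} [MeasurableSpace X] [MeasurableSpace Y]

/-- The unnormalised posterior integral of `f` for the likelihood `w`. -/
def wInt (μ : Measure X) (w : X → Y → ℝ) (f : X → ℝ) (y : Y) : ℝ := ∫ x, f x * w x y ∂μ

/-- The unnormalised posterior covariance of `f` and `g` for the likelihood `w`. -/
def wCov (μ : Measure X) (w : X → Y → ℝ) (f g : X → ℝ) (y : Y) : ℝ :=
  wInt μ w (fun x => f x * g x) y - wInt μ w f y * wInt μ w g y / wInt μ w (fun _ => 1) y

/-- A likelihood: jointly measurable, nonnegative, bounded for each observation, and of total mass at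
most one for each signal. -/
structure IsWeight (γ : Measure Y) (w : X → Y → ℝ) (B : Y → ℝ) : Prop where
  meas : Measurable (Function.uncurry w)
  nonneg : ∀ x y, 0 ≤ w x y
  le_bound : ∀ x y, w x y ≤ B y
  integrable : ∀ x, Integrable (w x) γ
  integral_le : ∀ x, ∫ y, w x y ∂γ ≤ 1

namespace IsWeight

variable {μ : Measure X} {γ : Measure Y} {w : X → Y → ℝ} {B : Y → ℝ}

theorem meas_left (h : IsWeight γ w B) (y : Y) : Measurable fun x => w x y :=
  h.meas.comp measurable_prodMk_right

theorem integrable_mul (h : IsWeight γ w B) {f : X → ℝ} (hf : Integrable f μ) (y : Y) :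
    Integrable (fun x => f x * w x y) μ :=
  hf.mul_bdd (c := B y) (h.meas_left y).aestronglyMeasurable
    (.of_forall fun x => by rw [Real.norm_of_nonneg (h.nonneg x y)]; exact h.le_bound x y)

theorem wInt_nonneg (h : IsWeight γ w B) {f : X → ℝ} (hf : ∀ x, 0 ≤ f x) (y : Y) :
    0 ≤ wInt μ w f y :=
  integral_nonneg fun x => mul_nonneg (hf x) (h.nonneg x y)

theorem wInt_mono (h : IsWeight γ w B) {f g : X → ℝ} (hf : Integrable f μ) (hg : Integrable g μ)
    (hfg : ∀ x, f x ≤ g x) (y : Y) : wInt μ w f y ≤ wInt μ w g y :=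
  integral_mono (h.integrable_mul hf y) (h.integrable_mul hg y)
    fun x => mul_le_mul_of_nonneg_right (hfg x) (h.nonneg x y)

theorem abs_wInt_le (h : IsWeight γ w B) {f q : X → ℝ} (hq : Integrable q μ)
    (hfq : ∀ x, |f x| ≤ q x) (y : Y) : |wInt μ w f y| ≤ wInt μ w q y := by
  refine norm_integral_le_of_norm_le (f := fun x => f x * w x y) (h.integrable_mul hq y)
    (.of_forall fun x => ?_)
  rw [norm_mul, Real.norm_of_nonneg (h.nonneg x y)]
  exact mul_le_mul_of_nonneg_right (hfq x) (h.nonneg x y)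

theorem measurable_wInt [SFinite μ] (h : IsWeight γ w B) {f : X → ℝ} (hf : Measurable f) :
    Measurable (wInt μ w f) :=
  (StronglyMeasurable.integral_prod_left
    (f := fun x y => f x * w x y)
    ((hf.comp measurable_fst).mul h.meas).stronglyMeasurable).measurable

theorem measurable_wCov [SFinite μ] (h : IsWeight γ w B) {f g : X → ℝ} (hf : Measurable f)
    (hg : Measurable g) : Measurable (wCov μ w f g) :=
  (h.measurable_wInt (hf.mul hg)).sub
    (((h.measurable_wInt hf).mul (h.measurable_wInt hg)).div (h.measurable_wInt measurable_const))

/-- The gap is `Z` times the posterior variance: with `m = wInt f / Z` it equals the integral of `(f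
- m)² w`. If `Z = 0`, the quotient is zero by convention. -/
theorem sq_wInt_div_le [IsFiniteMeasure μ] (h : IsWeight γ w B) {f : X → ℝ} (hf : Integrable f μ)
    (hf2 : Integrable (fun x => f x ^ 2) μ) (y : Y) :
    wInt μ w f y ^ 2 / wInt μ w (fun _ => 1) y ≤ wInt μ w (fun x => f x ^ 2) y := by
  set Z := wInt μ w (fun _ => 1) y
  have hZ0 : 0 ≤ Z := h.wInt_nonneg (fun _ => zero_le_one) y
  rcases hZ0.eq_or_lt with hZ | hZ
  · rw [← hZ, div_zero]
    exact h.wInt_nonneg (fun x => sq_nonneg _) y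
  set m := wInt μ w f y / Z with hm
  have i1 := h.integrable_mul hf y
  have i2 := h.integrable_mul hf2 y
  have i0 := h.integrable_mul (integrable_const (1 : ℝ) : Integrable (fun _ => (1 : ℝ)) μ) y
  have e : ∫ x, (f x - m) ^ 2 * w x y ∂μ
      = wInt μ w (fun x => f x ^ 2) y - 2 * m * wInt μ w f y + m ^ 2 * Z := by
    simp only [wInt, Z]
    rw [← integral_const_mul, ← integral_const_mul, ← integral_sub i2 (i1.const_mul _),
      ← integral_add (f := fun x => f x ^ 2 * w x y - 2 * m * (f x * w x y))
        (i2.sub (i1.const_mul _)) (i0.const_mul _)]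
    refine integral_congr_ae (.of_forall fun x => ?_)
    simp only; ring
  have h0 : 0 ≤ ∫ x, (f x - m) ^ 2 * w x y ∂μ :=
    integral_nonneg fun x => mul_nonneg (sq_nonneg _) (h.nonneg x y)
  rw [e] at h0
  have e2 : wInt μ w f y = m * Z := by rw [hm]; field_simp
  have e3 : wInt μ w f y ^ 2 / Z = m ^ 2 * Z := by rw [e2]; field_simp
  rw [e3]
  rw [e2] at h0
  nlinarith

variable {f g k l q : X → ℝ}

/-- On a finite measure, from `|f| ≤ f² + 1`. -/
theorem _root_.integrable_of_sq_le [IsFiniteMeasure μ] (hf : Measurable f) (hq : Integrable q μ)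
    (hfq : ∀ x, f x ^ 2 ≤ q x) : Integrable f μ := by
  refine (hq.add (integrable_const (1 : ℝ))).mono' hf.aestronglyMeasurable (.of_forall fun x => ?_)
  rw [Real.norm_eq_abs, Pi.add_apply]
  have := hfq x
  have h2 := sq_nonneg (|f x| - 1)
  have h3 := sq_abs (f x)
  have h4 := abs_nonneg (f x)
  nlinarith

theorem _root_.abs_mul_le_of_sq_le {a b c : ℝ} (ha : a ^ 2 ≤ c) (hb : b ^ 2 ≤ c) : |a * b| ≤ c := by
  rw [abs_le]
  constructor <;> nlinarith [sq_nonneg (a + b), sq_nonneg (a - b)]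

/-- Giving each factor one `1 / √Z` reduces the product to the two squares controlled by
`sq_wInt_div_le`. The identity also holds for `Z = 0`, so no positivity is needed. -/
theorem abs_wInt_mul_div_le [IsFiniteMeasure μ] (h : IsWeight γ w B) (hf : Measurable f)
    (hg : Measurable g) (hq : Integrable q μ) (hfq : ∀ x, f x ^ 2 ≤ q x) (hgq : ∀ x, g x ^ 2 ≤ q x)
    (y : Y) : |wInt μ w f y * wInt μ w g y / wInt μ w (fun _ => 1) y| ≤ wInt μ w q y := by
  have key : ∀ {f : X → ℝ}, Measurable f → (∀ x, f x ^ 2 ≤ q x) →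
      wInt μ w f y ^ 2 / wInt μ w (fun _ => 1) y ≤ wInt μ w q y := fun {f} hf hfq => by
    have hf2 : Integrable (fun x => f x ^ 2) μ := hq.mono' (by fun_prop)
      (.of_forall fun x => by rw [Real.norm_of_nonneg (sq_nonneg _)]; exact hfq x)
    exact (h.sq_wInt_div_le (integrable_of_sq_le hf hq hfq) hf2 y).trans (h.wInt_mono hf2 hq hfq y)
  have hZ0 : 0 ≤ wInt μ w (fun _ => 1) y := h.wInt_nonneg (fun _ => zero_le_one) y
  have h1 := key hf hfq
  have h2 := key hg hgq
  set Z := wInt μ w (fun _ => 1) y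
  have e : ∀ a b : ℝ, a * b / Z = (a / √Z) * (b / √Z) := fun a b => by
    rw [div_mul_div_comm, Real.mul_self_sqrt hZ0]
  rw [e]
  rw [pow_two, e, ← pow_two] at h1 h2
  exact abs_mul_le_of_sq_le h1 h2

theorem abs_wCov_le [IsFiniteMeasure μ] (h : IsWeight γ w B) (hf : Measurable f)
    (hg : Measurable g) (hq : Integrable q μ) (hfq : ∀ x, f x ^ 2 ≤ q x) (hgq : ∀ x, g x ^ 2 ≤ q x)
    (y : Y) : |wCov μ w f g y| ≤ 2 * wInt μ w q y := by
  have h1 := h.abs_wInt_le (f := fun x => f x * g x) hq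
    (fun x => abs_mul_le_of_sq_le (hfq x) (hgq x)) y
  have h2 := h.abs_wInt_mul_div_le hf hg hq hfq hgq y
  rw [wCov]
  exact (abs_sub _ _).trans (by linarith)

/-- Each covariance is at most `2 wInt q`, and `(wInt q)² / Z ≤ wInt (q²)`. As `q` is quadratic in
the signal for coordinate functions, this is where fourth moments enter. -/
theorem abs_wCov_mul_div_le [IsFiniteMeasure μ] (h : IsWeight γ w B) (hf : Measurable f)
    (hg : Measurable g) (hk : Measurable k) (hl : Measurable l) (hqm : Measurable q)
    (hq2 : Integrable (fun x => q x ^ 2) μ) (hfq : ∀ x, f x ^ 2 ≤ q x) (hgq : ∀ x, g x ^ 2 ≤ q x)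
    (hkq : ∀ x, k x ^ 2 ≤ q x) (hlq : ∀ x, l x ^ 2 ≤ q x) (y : Y) :
    |wCov μ w f k y * wCov μ w g l y / wInt μ w (fun _ => 1) y|
      ≤ 4 * wInt μ w (fun x => q x ^ 2) y := by
  have hq : Integrable q μ := integrable_of_sq_le hqm hq2 fun x => le_rfl
  have h1 := h.abs_wCov_le hf hk hq hfq hkq y
  have h2 := h.abs_wCov_le hg hl hq hgq hlq y
  have h3 := h.sq_wInt_div_le hq hq2 y
  have hZ0 : 0 ≤ wInt μ w (fun _ => 1) y := h.wInt_nonneg (fun _ => zero_le_one) y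
  rw [abs_div, abs_mul, abs_of_nonneg hZ0]
  calc |wCov μ w f k y| * |wCov μ w g l y| / wInt μ w (fun _ => 1) y
      ≤ (2 * wInt μ w q y) * (2 * wInt μ w q y) / wInt μ w (fun _ => 1) y := by
        have := (abs_nonneg _).trans h1
        gcongr
    _ = 4 * (wInt μ w q y ^ 2 / wInt μ w (fun _ => 1) y) := by ring
    _ ≤ _ := by gcongr

/-- Integrating over the observation first leaves at most `|f|`, because each signal has total mass
at most one. The pointwise bound `B`, which need not be integrable, plays no part. -/
theorem integrable_prod [IsFiniteMeasure μ] [SFinite γ] (h : IsWeight γ w B)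
    (hf : Integrable f μ) : Integrable (fun z : X × Y => f z.1 * w z.1 z.2) (μ.prod γ) := by
  have hm : AEStronglyMeasurable (fun z : X × Y => f z.1 * w z.1 z.2) (μ.prod γ) :=
    hf.aestronglyMeasurable.comp_fst.mul h.meas.aestronglyMeasurable
  rw [integrable_prod_iff hm]
  refine ⟨.of_forall fun x => (h.integrable x).const_mul (f x), ?_⟩
  refine hf.norm.mono' hm.norm.integral_prod_right' (.of_forall fun x => ?_)
  have e : ∀ y, ‖f x * w x y‖ = ‖f x‖ * w x y := fun y => by
    rw [norm_mul, Real.norm_of_nonneg (h.nonneg x y)]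
  simp only [e]
  rw [integral_const_mul, norm_mul, norm_norm,
    Real.norm_of_nonneg (integral_nonneg fun y => h.nonneg x y)]
  exact mul_le_of_le_one_right (norm_nonneg _) (h.integral_le x)

theorem integrable_wInt [IsFiniteMeasure μ] [SFinite γ] (h : IsWeight γ w B)
    (hf : Integrable f μ) : Integrable (wInt μ w f) γ :=
  (h.integrable_prod hf).integral_prod_right

theorem integral_wInt [IsFiniteMeasure μ] [SFinite γ] (h : IsWeight γ w B)
    (hf : Integrable f μ) : ∫ y, wInt μ w f y ∂γ = ∫ x, f x * ∫ y, w x y ∂γ ∂μ := by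
  have := integral_integral_swap (f := fun x y => f x * w x y) (h.integrable_prod hf)
  simp only [integral_const_mul] at this
  exact this.symm

theorem integral_wInt_le [IsFiniteMeasure μ] [SFinite γ] (h : IsWeight γ w B)
    (hf : Integrable f μ) (hf0 : ∀ x, 0 ≤ f x) : ∫ y, wInt μ w f y ∂γ ≤ ∫ x, f x ∂μ := by
  rw [h.integral_wInt hf]
  refine integral_mono_of_nonneg
    (.of_forall fun x => mul_nonneg (hf0 x) (integral_nonneg (h.nonneg x))) hf
    (.of_forall fun x => mul_le_of_le_one_right (hf0 x) (h.integral_le x))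

variable {A : Type*} {W : A → X → Y → ℝ} {F : Filter A}

theorem tendsto_wInt [F.IsCountablyGenerated] (hW : ∀ a, IsWeight γ (W a) B)
    (hlim : ∀ x y, Tendsto (fun a => W a x y) F (𝓝 (w x y))) (hf : Integrable f μ) (y : Y) :
    Tendsto (fun a => wInt μ (W a) f y) F (𝓝 (wInt μ w f y)) := by
  refine tendsto_integral_filter_of_dominated_convergence (fun x => ‖f x‖ * B y)
    (.of_forall fun a => ((hW a).integrable_mul hf y).aestronglyMeasurable)
    (.of_forall fun a => .of_forall fun x => ?_) (hf.norm.mul_const _)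
    (.of_forall fun x => (hlim x y).const_mul _)
  rw [norm_mul, Real.norm_of_nonneg ((hW a).nonneg x y)]
  exact mul_le_mul_of_nonneg_left ((hW a).le_bound x y) (norm_nonneg _)

/-- Exchanging the integrals turns this into ordinary dominated convergence for `f` times the total
mass. It supplies the convergence of dominating integrals that Pratt's lemma asks for. -/
theorem tendsto_integral_wInt [F.IsCountablyGenerated] [IsFiniteMeasure μ] [SFinite γ]
    (hW : ∀ a, IsWeight γ (W a) B) (hw : IsWeight γ w B)
    (hmass : ∀ x, Tendsto (fun a => ∫ y, W a x y ∂γ) F (𝓝 (∫ y, w x y ∂γ)))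
    (hf : Integrable f μ) :
    Tendsto (fun a => ∫ y, wInt μ (W a) f y ∂γ) F (𝓝 (∫ y, wInt μ w f y ∂γ)) := by
  simp only [(hW _).integral_wInt hf, hw.integral_wInt hf]
  refine tendsto_integral_filter_of_dominated_convergence (fun x => ‖f x‖)
    (.of_forall fun a => hf.aestronglyMeasurable.mul
      (hW a).meas.stronglyMeasurable.integral_prod_right.aestronglyMeasurable)
    (.of_forall fun a => .of_forall fun x => ?_) hf.norm
    (.of_forall fun x => (hmass x).const_mul _)
  rw [norm_mul, Real.norm_of_nonneg (integral_nonneg ((hW a).nonneg x))]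
  exact mul_le_of_le_one_right (norm_nonneg _) ((hW a).integral_le x)

/-- Continuity of the mean product of posterior means in the likelihood. -/
theorem tendsto_integral_wInt_mul_div [F.IsCountablyGenerated] [IsFiniteMeasure μ] [SFinite γ]
    (hW : ∀ a, IsWeight γ (W a) B) (hw : IsWeight γ w B)
    (hlim : ∀ x y, Tendsto (fun a => W a x y) F (𝓝 (w x y)))
    (hmass : ∀ x, Tendsto (fun a => ∫ y, W a x y ∂γ) F (𝓝 (∫ y, w x y ∂γ)))
    (hZ : ∀ y, wInt μ w (fun _ => 1) y ≠ 0)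
    (hf : Measurable f) (hg : Measurable g) (hq : Integrable q μ)
    (hfq : ∀ x, f x ^ 2 ≤ q x) (hgq : ∀ x, g x ^ 2 ≤ q x) :
    Tendsto (fun a => ∫ y, wInt μ (W a) f y * wInt μ (W a) g y / wInt μ (W a) (fun _ => 1) y ∂γ) F
      (𝓝 (∫ y, wInt μ w f y * wInt μ w g y / wInt μ w (fun _ => 1) y ∂γ)) := by
  have h1 : Integrable (fun _ : X => (1 : ℝ)) μ := integrable_const _
  -- The bound `wInt q` depends on the likelihood, whence Pratt's lemma.
  refine tendsto_integral_of_tendsto_of_abs_le (g := fun a y => wInt μ (W a) q y)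
    (g₀ := fun y => wInt μ w q y) (fun a => ?_) (fun a => (hW a).integrable_wInt hq)
    (hw.integrable_wInt hq)
    (fun a => .of_forall fun y => (hW a).abs_wInt_mul_div_le hf hg hq hfq hgq y)
    (.of_forall fun y => hw.abs_wInt_mul_div_le hf hg hq hfq hgq y)
    (.of_forall fun y => ?_) (.of_forall fun y => tendsto_wInt hW hlim hq y)
    (tendsto_integral_wInt hW hw hmass hq)
  · exact ((((hW a).measurable_wInt hf).mul ((hW a).measurable_wInt hg)).div
      ((hW a).measurable_wInt measurable_const)).aestronglyMeasurable
  · exact ((tendsto_wInt hW hlim (integrable_of_sq_le hf hq hfq) y).mul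
      (tendsto_wInt hW hlim (integrable_of_sq_le hg hq hgq) y)).div (tendsto_wInt hW hlim h1 y) (hZ y)

/-- Continuity of the mean product of posterior covariances in the likelihood. -/
theorem tendsto_integral_wCov_mul_div [F.IsCountablyGenerated] [IsFiniteMeasure μ] [SFinite γ]
    (hW : ∀ a, IsWeight γ (W a) B) (hw : IsWeight γ w B)
    (hlim : ∀ x y, Tendsto (fun a => W a x y) F (𝓝 (w x y)))
    (hmass : ∀ x, Tendsto (fun a => ∫ y, W a x y ∂γ) F (𝓝 (∫ y, w x y ∂γ)))
    (hZ : ∀ y, wInt μ w (fun _ => 1) y ≠ 0)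
    (hf : Measurable f) (hg : Measurable g) (hk : Measurable k) (hl : Measurable l)
    (hqm : Measurable q) (hq2 : Integrable (fun x => q x ^ 2) μ)
    (hfq : ∀ x, f x ^ 2 ≤ q x) (hgq : ∀ x, g x ^ 2 ≤ q x)
    (hkq : ∀ x, k x ^ 2 ≤ q x) (hlq : ∀ x, l x ^ 2 ≤ q x) :
    Tendsto (fun a => ∫ y, wCov μ (W a) f k y * wCov μ (W a) g l y
        / wInt μ (W a) (fun _ => 1) y ∂γ) F
      (𝓝 (∫ y, wCov μ w f k y * wCov μ w g l y / wInt μ w (fun _ => 1) y ∂γ)) := by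
  have h1 : Integrable (fun _ : X => (1 : ℝ)) μ := integrable_const _
  have hq : Integrable q μ := integrable_of_sq_le hqm hq2 fun x => le_rfl
  have hcov : ∀ {f k : X → ℝ}, Measurable f → Measurable k → (∀ x, f x ^ 2 ≤ q x) →
      (∀ x, k x ^ 2 ≤ q x) → ∀ y, Tendsto (fun a => wCov μ (W a) f k y) F (𝓝 (wCov μ w f k y)) := by
    intro f k hf hk hfq hkq y
    have hfk : Integrable (fun x => f x * k x) μ := hq.mono' (hf.mul hk).aestronglyMeasurable
      (.of_forall fun x => abs_mul_le_of_sq_le (hfq x) (hkq x))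
    exact (tendsto_wInt hW hlim hfk y).sub
      (((tendsto_wInt hW hlim (integrable_of_sq_le hf hq hfq) y).mul
        (tendsto_wInt hW hlim (integrable_of_sq_le hk hq hkq) y)).div
        (tendsto_wInt hW hlim h1 y) (hZ y))
  refine tendsto_integral_of_tendsto_of_abs_le
    (g := fun a y => 4 * wInt μ (W a) (fun x => q x ^ 2) y)
    (g₀ := fun y => 4 * wInt μ w (fun x => q x ^ 2) y) (fun a => ?_)
    (fun a => ((hW a).integrable_wInt hq2).const_mul _)
    ((hw.integrable_wInt hq2).const_mul _)
    (fun a => .of_forall fun y => (hW a).abs_wCov_mul_div_le hf hg hk hl hqm hq2 hfq hgq hkq hlq y)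
    (.of_forall fun y => hw.abs_wCov_mul_div_le hf hg hk hl hqm hq2 hfq hgq hkq hlq y)
    (.of_forall fun y => ?_) (.of_forall fun y => (tendsto_wInt hW hlim hq2 y).const_mul _) ?_
  · exact ((((hW a).measurable_wCov hf hk).mul ((hW a).measurable_wCov hg hl)).div
      ((hW a).measurable_wInt measurable_const)).aestronglyMeasurable
  · exact ((hcov hf hk hfq hkq y).mul (hcov hg hl hgq hlq y)).div (tendsto_wInt hW hlim h1 y) (hZ y)
  · simp only [integral_const_mul]
    exact (tendsto_integral_wInt hW hw hmass hq2).const_mul _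

end IsWeight

end Weights

end

noncomputable section

/-! ### Estimates for Cameron–Martin densities of small shifts. -/

section Tilting

open Filter Topology

variable {n K : ℕ}

/-- The Cameron–Martin density of a Gaussian array shifted by `t`. -/
def gaussianTilt (t ξ : Fin n → Fin K → ℝ) : ℝ :=
  Real.exp ((∑ j, t j ⬝ᵥ ξ j) - (∑ j, t j ⬝ᵥ t j) / 2)

theorem measurable_gaussianTilt :
    Measurable fun z : (Fin n → Fin K → ℝ) × (Fin n → Fin K → ℝ) => gaussianTilt z.1 z.2 := by
  simp only [gaussianTilt, dotProduct]; fun_prop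

theorem gaussianTilt_pos (t ξ : Fin n → Fin K → ℝ) : 0 < gaussianTilt t ξ := Real.exp_pos _

/-- The density of a probability measure has integral one; compare total masses. -/
theorem integrable_of_map_eq_withDensity {Ω : Type*} [MeasurableSpace Ω] {ν : Measure Ω}
    [IsProbabilityMeasure ν] {T : Ω → Ω} (hT : Measurable T) {ρ : Ω → ℝ} (hρ : Measurable ρ)
    (hρ0 : ∀ ω, 0 ≤ ρ ω) (h : ν.map T = ν.withDensity fun ω => ENNReal.ofReal (ρ ω)) :
    Integrable ρ ν ∧ ∫ ω, ρ ω ∂ν = 1 := by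
  have h1 : ∫⁻ ω, ENNReal.ofReal (ρ ω) ∂ν = 1 := by
    have := congrArg (fun ν : Measure Ω => ν univ) h
    rw [Measure.map_apply hT MeasurableSet.univ, withDensity_apply _ .univ,
      Measure.restrict_univ, preimage_univ, measure_univ] at this
    exact this.symm
  have hnn : 0 ≤ᵐ[ν] ρ := .of_forall hρ0
  refine ⟨⟨hρ.aestronglyMeasurable, ?_⟩, ?_⟩
  · rw [hasFiniteIntegral_iff_ofReal hnn, h1]
    exact ENNReal.one_lt_top
  · rw [integral_eq_lintegral_of_nonneg_ae hnn hρ.aestronglyMeasurable, h1, ENNReal.toReal_one]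

theorem integrable_gaussianTilt (t : Fin n → Fin K → ℝ) :
    Integrable (gaussianTilt t) (gaussianArray n K) ∧
      ∫ ξ, gaussianTilt t ξ ∂(gaussianArray n K) = 1 := by
  have hm : Measurable fun ξ => gaussianTilt t ξ := by simp only [gaussianTilt, dotProduct]; fun_prop
  have h0 : ∀ ξ, 0 ≤ gaussianTilt t ξ := fun ξ => (gaussianTilt_pos t ξ).le
  have hT : Measurable fun ξ : Fin n → Fin K → ℝ => ξ + t := by fun_prop
  exact integrable_of_map_eq_withDensity hT hm h0 (gaussianArray_map_add_eq_withDensity t)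

theorem abs_exp_sub_one_le_mul_exp (z : ℝ) : |Real.exp z - 1| ≤ |z| * Real.exp |z| := by
  have h1 := Real.add_one_le_exp z
  have h2 := Real.add_one_le_exp (-z)
  have h3 := Real.exp_pos z
  have h4 : Real.exp z * Real.exp (-z) = 1 := by rw [← Real.exp_add]; simp
  have h5 : 1 ≤ Real.exp |z| := Real.one_le_exp (abs_nonneg z)
  rcases abs_cases z with ⟨h, hz⟩ | ⟨h, hz⟩
  · rw [h, abs_of_nonneg (by linarith)]
    nlinarith
  · rw [h] at h5 ⊢
    have h6 : Real.exp z ≤ 1 := Real.exp_le_one_iff.2 hz.le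
    rw [abs_of_nonpos (by linarith)]
    nlinarith

theorem gaussianTilt_smul (s : ℝ) (t ξ : Fin n → Fin K → ℝ) :
    gaussianTilt (s • t) ξ
      = Real.exp (s * (∑ j, t j ⬝ᵥ ξ j) - s ^ 2 * (∑ j, t j ⬝ᵥ t j) / 2) := by
  simp only [gaussianTilt, Pi.smul_apply, smul_dotProduct, dotProduct_smul, smul_eq_mul,
    ← Finset.mul_sum]
  congr 2
  ring

/-- An envelope for the exponent of a tilt of size at most `c`. -/
def tiltBound (c : ℝ) (ξ : Fin n → Fin K → ℝ) : ℝ :=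
  c * (∑ j, ∑ k, |ξ j k|) + n * K * c ^ 2

theorem tiltBound_nonneg {c : ℝ} (hc : 0 ≤ c) (ξ : Fin n → Fin K → ℝ) : 0 ≤ tiltBound c ξ := by
  unfold tiltBound; positivity

theorem abs_sum_dotProduct_le {c : ℝ} {t : Fin n → Fin K → ℝ}
    (ht : ∀ j k, |t j k| ≤ c) (ξ : Fin n → Fin K → ℝ) :
    |∑ j, t j ⬝ᵥ ξ j| ≤ c * (∑ j, ∑ k, |ξ j k|) := by
  rw [Finset.mul_sum]
  refine (Finset.abs_sum_le_sum_abs _ _).trans (Finset.sum_le_sum fun j _ => ?_)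
  rw [Finset.mul_sum]
  refine (Finset.abs_sum_le_sum_abs _ _).trans (Finset.sum_le_sum fun k _ => ?_)
  rw [abs_mul]
  exact mul_le_mul_of_nonneg_right (ht j k) (abs_nonneg _)

theorem sum_dotProduct_self_nonneg (t : Fin n → Fin K → ℝ) : 0 ≤ ∑ j, t j ⬝ᵥ t j :=
  Finset.sum_nonneg fun _ _ => Finset.sum_nonneg fun _ _ => mul_self_nonneg _

theorem sum_dotProduct_self_le {c : ℝ} {t : Fin n → Fin K → ℝ} (ht : ∀ j k, |t j k| ≤ c) :
    ∑ j, t j ⬝ᵥ t j ≤ n * K * c ^ 2 := by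
  have : ∀ j k, t j k * t j k ≤ c ^ 2 := fun j k => by
    rw [← pow_two, ← sq_abs]
    exact pow_le_pow_left₀ (abs_nonneg _) (ht j k) 2
  calc ∑ j, t j ⬝ᵥ t j ≤ ∑ _j : Fin n, ∑ _k : Fin K, c ^ 2 :=
        Finset.sum_le_sum fun j _ => Finset.sum_le_sum fun k _ => this j k
    _ = n * K * c ^ 2 := by simp [mul_assoc]

theorem abs_tilt_exponent_le {c s : ℝ} (hs : s ∈ Ioc (0 : ℝ) 1) {t : Fin n → Fin K → ℝ}
    (ht : ∀ j k, |t j k| ≤ c) (ξ : Fin n → Fin K → ℝ) :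
    |s * (∑ j, t j ⬝ᵥ ξ j) - s ^ 2 * (∑ j, t j ⬝ᵥ t j) / 2| ≤ s * tiltBound c ξ := by
  have h1 := abs_sum_dotProduct_le ht ξ
  have h2 := sum_dotProduct_self_nonneg t
  have h3 := sum_dotProduct_self_le ht
  have e : s * (∑ j, t j ⬝ᵥ ξ j) - s ^ 2 * (∑ j, t j ⬝ᵥ t j) / 2
      = s * ((∑ j, t j ⬝ᵥ ξ j) - s * (∑ j, t j ⬝ᵥ t j) / 2) := by ring
  rw [e, abs_mul, abs_of_pos hs.1]
  refine mul_le_mul_of_nonneg_left ?_ hs.1.le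
  have h4 : s * (∑ j, t j ⬝ᵥ t j) ≤ ∑ j, t j ⬝ᵥ t j := mul_le_of_le_one_left h2 hs.2
  have h5 : 0 ≤ s * (∑ j, t j ⬝ᵥ t j) := mul_nonneg hs.1.le h2
  rw [abs_le] at h1 ⊢
  unfold tiltBound
  constructor <;> linarith

theorem gaussianTilt_smul_le {c s : ℝ} (hs : s ∈ Ioc (0 : ℝ) 1) {t : Fin n → Fin K → ℝ}
    (ht : ∀ j k, |t j k| ≤ c) (hc : 0 ≤ c) (ξ : Fin n → Fin K → ℝ) :
    gaussianTilt (s • t) ξ ≤ Real.exp (tiltBound c ξ) := by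
  rw [gaussianTilt_smul]
  exact Real.exp_le_exp.2 ((le_abs_self _).trans ((abs_tilt_exponent_le hs ht ξ).trans
    (mul_le_of_le_one_left (tiltBound_nonneg hc ξ) hs.2)))

/-- This keeps the tilted partition function away from zero when it stands in a denominator. -/
theorem le_gaussianTilt_smul {c s : ℝ} (hs : s ∈ Ioc (0 : ℝ) 1) {t : Fin n → Fin K → ℝ}
    (ht : ∀ j k, |t j k| ≤ c) (hc : 0 ≤ c) (ξ : Fin n → Fin K → ℝ) :
    Real.exp (-tiltBound c ξ) ≤ gaussianTilt (s • t) ξ := by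
  rw [gaussianTilt_smul]
  refine Real.exp_le_exp.2 (neg_le_of_abs_le ((abs_tilt_exponent_le hs ht ξ).trans
    (mul_le_of_le_one_left (tiltBound_nonneg hc ξ) hs.2)))

/-- The exponent is at most `s b` with `b = tiltBound c ξ`, so the quotient is at most `b exp b ≤
exp (2b)`, uniformly in `s`. -/
theorem abs_gaussianTilt_smul_sub_one_le {c s : ℝ} (hs : s ∈ Ioc (0 : ℝ) 1)
    {t : Fin n → Fin K → ℝ} (ht : ∀ j k, |t j k| ≤ c) (hc : 0 ≤ c) (ξ : Fin n → Fin K → ℝ) :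
    |(gaussianTilt (s • t) ξ - 1) / s| ≤ Real.exp (2 * tiltBound c ξ) := by
  have h0 := tiltBound_nonneg hc ξ
  have h1 := abs_tilt_exponent_le hs ht ξ
  have h2 : s * tiltBound c ξ ≤ tiltBound c ξ := mul_le_of_le_one_left h0 hs.2
  rw [gaussianTilt_smul, abs_div, abs_of_pos hs.1, div_le_iff₀ hs.1]
  refine (abs_exp_sub_one_le_mul_exp _).trans ?_
  calc _ ≤ (s * tiltBound c ξ) * Real.exp (tiltBound c ξ) := by
        have := mul_nonneg hs.1.le h0
        gcongr; exact h1.trans h2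
    _ ≤ (s * Real.exp (tiltBound c ξ)) * Real.exp (tiltBound c ξ) := by
        have := (Real.add_one_le_exp (tiltBound c ξ))
        have hs0 := hs.1.le
        gcongr; linarith
    _ = Real.exp (2 * tiltBound c ξ) * s := by
        rw [mul_assoc, ← Real.exp_add, ← two_mul, mul_comm]

theorem tendsto_gaussianTilt_smul (t ξ : Fin n → Fin K → ℝ) :
    Tendsto (fun s : ℝ => gaussianTilt (s • t) ξ) (𝓝[>] 0) (𝓝 1) := by
  simp only [gaussianTilt_smul]
  refine tendsto_nhdsWithin_of_tendsto_nhds ?_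
  refine Continuous.tendsto' (by fun_prop) _ _ (by simp)

/-- The normalising term of the exponent is quadratic in `s`, so only the linear form in the noise
survives at first order. -/
theorem tendsto_gaussianTilt_smul_sub_one_div (t ξ : Fin n → Fin K → ℝ) :
    Tendsto (fun s : ℝ => (gaussianTilt (s • t) ξ - 1) / s) (𝓝[>] 0) (𝓝 (∑ j, t j ⬝ᵥ ξ j)) := by
  have hd : HasDerivAt (fun s : ℝ => gaussianTilt (s • t) ξ) (∑ j, t j ⬝ᵥ ξ j) 0 := by
    simp only [gaussianTilt_smul]
    have h1 : HasDerivAt (fun s : ℝ => s * (∑ j, t j ⬝ᵥ ξ j) - s ^ 2 * (∑ j, t j ⬝ᵥ t j) / 2)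
        (1 * (∑ j, t j ⬝ᵥ ξ j) - (2 * 0) * (∑ j, t j ⬝ᵥ t j) / 2) 0 := by
      refine ((hasDerivAt_id (0 : ℝ)).mul_const _).sub ?_
      refine HasDerivAt.div_const (HasDerivAt.mul_const ?_ _) _
      simpa using hasDerivAt_pow 2 (0 : ℝ)
    have := h1.exp
    simpa using this
  have := (hasDerivAt_iff_tendsto_slope_zero.1 hd).mono_left
    (nhdsWithin_mono (0 : ℝ) (fun s (hs : 0 < s) => hs.ne' : Ioi (0 : ℝ) ⊆ {0}ᶜ))
  refine this.congr fun s => ?_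
  simp [gaussianTilt, div_eq_inv_mul]

theorem integrable_exp_tiltBound (c m : ℝ) :
    Integrable (fun ξ : Fin n → Fin K → ℝ => Real.exp (m * tiltBound c ξ)) (gaussianArray n K) := by
  have := (integrable_exp_abs_gaussianArray (n := n) (K := K) (m * c)).mul_const
    (Real.exp (m * (n * K * c ^ 2)))
  refine this.congr (.of_forall fun ξ => ?_)
  simp only [← Real.exp_add, tiltBound]
  congr 1; ring

end Tilting

end

noncomputable section

/-! ### Second-order expansion under an additional weak observation. -/

section Tilting

open Filter Topology

variable {n K : ℕ} {X Y : Type*} [MeasurableSpace X] [MeasurableSpace Y]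

/-- The likelihood `w` refined by an independent Gaussian observation of `s θ(x)`. -/
def tiltedWeight (w : X → Y → ℝ) (θ : X → Fin n → Fin K → ℝ) (s : ℝ) (x : X)
    (z : Y × (Fin n → Fin K → ℝ)) : ℝ :=
  w x z.1 * gaussianTilt (s • θ x) z.2

namespace IsWeight

variable {μ : Measure X} {γ : Measure Y} {w : X → Y → ℝ} {B : Y → ℝ}
  {θ : X → Fin n → Fin K → ℝ} {c s : ℝ}

theorem tilted [SFinite γ] (h : IsWeight γ w B) (hθ : Measurable θ) (hc : 0 ≤ c)
    (hθc : ∀ x j k, |θ x j k| ≤ c) (hs : s ∈ Ioc (0 : ℝ) 1) :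
    IsWeight (γ.prod (gaussianArray n K)) (tiltedWeight w θ s)
      (fun z => B z.1 * Real.exp (tiltBound c z.2)) where
  meas := by
    refine (h.meas.comp (measurable_fst.prodMk (measurable_fst.comp measurable_snd))).mul ?_
    exact measurable_gaussianTilt.comp (f := fun p : X × Y × (Fin n → Fin K → ℝ) =>
      (s • θ p.1, p.2.2)) (((hθ.comp measurable_fst).const_smul s).prodMk
        (measurable_snd.comp measurable_snd))
  nonneg x z := mul_nonneg (h.nonneg _ _) (gaussianTilt_pos _ _).le
  le_bound x z := mul_le_mul (h.le_bound _ _) (gaussianTilt_smul_le hs (hθc x) hc _)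
    (gaussianTilt_pos _ _).le ((h.nonneg x _).trans (h.le_bound x _))
  integrable x := (h.integrable x).mul_prod (integrable_gaussianTilt (s • θ x)).1
  integral_le x := by
    simp only [tiltedWeight]
    rw [integral_prod_mul (μ := γ) (ν := gaussianArray n K) (fun y => w x y)
      (fun ξ => gaussianTilt (s • θ x) ξ)]
    rw [(integrable_gaussianTilt (s • θ x)).2, mul_one]
    exact h.integral_le x

/-- Martingale property: the tilt has mean one for every signal, so averaging over the additional
noise restores the untilted integral. -/
theorem integral_wInt_tilted [IsFiniteMeasure μ] [SFinite γ] (h : IsWeight γ w B)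
    (hθ : Measurable θ) (hc : 0 ≤ c) (hθc : ∀ x j k, |θ x j k| ≤ c) (hs : s ∈ Ioc (0 : ℝ) 1)
    {f : X → ℝ} (hf : Integrable f μ) (y : Y) :
    Integrable (fun ξ => wInt μ (tiltedWeight w θ s) f (y, ξ)) (gaussianArray n K) ∧
    ∫ ξ, wInt μ (tiltedWeight w θ s) f (y, ξ) ∂(gaussianArray n K) = wInt μ w f y := by
  have hT : IsWeight (gaussianArray n K) (fun x ξ => gaussianTilt (s • θ x) ξ)
      (fun ξ => Real.exp (tiltBound c ξ)) :=
    { meas := measurable_gaussianTilt.comp (f := fun p : X × (Fin n → Fin K → ℝ) =>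
        (s • θ p.1, p.2)) (((hθ.comp measurable_fst).const_smul s).prodMk measurable_snd)
      nonneg := fun x ξ => (gaussianTilt_pos _ _).le
      le_bound := fun x ξ => gaussianTilt_smul_le hs (hθc x) hc ξ
      integrable := fun x => (integrable_gaussianTilt _).1
      integral_le := fun x => (integrable_gaussianTilt _).2.le }
  have hfw := h.integrable_mul hf y
  have e : ∀ ξ, wInt μ (tiltedWeight w θ s) f (y, ξ)
      = wInt μ (fun x ξ => gaussianTilt (s • θ x) ξ) (fun x => f x * w x y) ξ := fun ξ => by
    simp only [wInt, tiltedWeight, mul_assoc]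
  simp only [e]
  refine ⟨hT.integrable_wInt hfw, ?_⟩
  rw [hT.integral_wInt hfw]
  simp only [(integrable_gaussianTilt _).2, mul_one]
  rfl

/-- Centred increments of unnormalised posterior integrals under a tilt. -/
theorem wInt_tilted_sub [IsFiniteMeasure μ] [SFinite γ] (h : IsWeight γ w B)
    (hθ : Measurable θ) (hc : 0 ≤ c) (hθc : ∀ x j k, |θ x j k| ≤ c) (hs : s ∈ Ioc (0 : ℝ) 1)
    {f : X → ℝ} (hf : Integrable f μ) {y : Y} (hZ : wInt μ w (fun _ => 1) y ≠ 0)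
    (ξ : Fin n → Fin K → ℝ) :
    wInt μ (tiltedWeight w θ s) f (y, ξ)
        - wInt μ w f y / wInt μ w (fun _ => 1) y * wInt μ (tiltedWeight w θ s) (fun _ => 1) (y, ξ)
      = s * ∫ x, (f x - wInt μ w f y / wInt μ w (fun _ => 1) y) * w x y
          * ((gaussianTilt (s • θ x) ξ - 1) / s) ∂μ := by
  set m := wInt μ w f y / wInt μ w (fun _ => 1) y with hm
  have h1 : Integrable (fun _ : X => (1 : ℝ)) μ := integrable_const _
  have hT := h.tilted hθ hc hθc hs
  -- The centred function has zero posterior integral, so 1 may be subtracted from the tilt; this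
  -- extracts the factor `s`.
  have e1 : ∫ x, (f x - m) * w x y ∂μ = 0 := by
    have : ∀ x, (f x - m) * w x y = f x * w x y - m * (1 * w x y) := fun x => by ring
    simp only [this]
    rw [integral_sub (h.integrable_mul hf y) ((h.integrable_mul h1 y).const_mul m),
      integral_const_mul]
    change wInt μ w f y - m * wInt μ w (fun _ => 1) y = 0
    rw [hm, div_mul_cancel₀ _ hZ, sub_self]
  have e2 : wInt μ (tiltedWeight w θ s) f (y, ξ)
      - m * wInt μ (tiltedWeight w θ s) (fun _ => 1) (y, ξ)
      = ∫ x, (f x - m) * tiltedWeight w θ s x (y, ξ) ∂μ := by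
    have : ∀ x, (f x - m) * tiltedWeight w θ s x (y, ξ) = f x * tiltedWeight w θ s x (y, ξ)
        - m * (1 * tiltedWeight w θ s x (y, ξ)) := fun x => by ring
    simp only [this]
    rw [integral_sub (hT.integrable_mul hf (y, ξ)) ((hT.integrable_mul h1 (y, ξ)).const_mul m),
      integral_const_mul]
    rfl
  have hfm : Integrable (fun x => f x - m) μ := hf.sub (integrable_const _)
  rw [e2, ← sub_zero (∫ x, _ ∂μ), ← e1,
    ← integral_sub (hT.integrable_mul hfm (y, ξ)) (h.integrable_mul hfm y), ← integral_const_mul]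
  refine integral_congr_ae (.of_forall fun x => ?_)
  simp only [tiltedWeight]
  have := hs.1.ne'
  field_simp

theorem abs_integral_increment_le [IsFiniteMeasure μ] (h : IsWeight γ w B) (hc : 0 ≤ c)
    (hθc : ∀ x j k, |θ x j k| ≤ c) (hs : s ∈ Ioc (0 : ℝ) 1) {f : X → ℝ} {d : ℝ}
    (hfd : ∀ x, |f x| ≤ d) (y : Y) (ξ : Fin n → Fin K → ℝ) :
    |∫ x, f x * w x y * ((gaussianTilt (s • θ x) ξ - 1) / s) ∂μ|
      ≤ d * Real.exp (2 * tiltBound c ξ) * wInt μ w (fun _ => 1) y := by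
  have h1 : Integrable (fun _ : X => (1 : ℝ)) μ := integrable_const _
  rw [wInt, ← integral_const_mul]
  refine norm_integral_le_of_norm_le
    (f := fun x => f x * w x y * ((gaussianTilt (s • θ x) ξ - 1) / s))
    ((h.integrable_mul h1 y).const_mul _) (.of_forall fun x => ?_)
  rw [norm_mul, norm_mul, Real.norm_of_nonneg (h.nonneg x y), Real.norm_eq_abs, Real.norm_eq_abs]
  calc |f x| * w x y * |(gaussianTilt (s • θ x) ξ - 1) / s|
      ≤ d * w x y * Real.exp (2 * tiltBound c ξ) := by
        have h2 := abs_gaussianTilt_smul_sub_one_le hs (hθc x) hc ξ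
        have h3 := h.nonneg x y
        have h4 := (abs_nonneg _).trans (hfd x)
        gcongr
        exact hfd x
    _ = _ := by ring

theorem tendsto_integral_increment [IsFiniteMeasure μ] (h : IsWeight γ w B) (hθ : Measurable θ)
    (hc : 0 ≤ c) (hθc : ∀ x j k, |θ x j k| ≤ c) {f : X → ℝ} {d : ℝ} (hf : Measurable f)
    (hfd : ∀ x, |f x| ≤ d) (y : Y) (ξ : Fin n → Fin K → ℝ) :
    Tendsto (fun s : ℝ => ∫ x, f x * w x y * ((gaussianTilt (s • θ x) ξ - 1) / s) ∂μ) (𝓝[>] 0)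
      (𝓝 (∫ x, f x * w x y * ∑ j, θ x j ⬝ᵥ ξ j ∂μ)) := by
  have h1 : Integrable (fun _ : X => (1 : ℝ)) μ := integrable_const _
  refine tendsto_integral_filter_of_dominated_convergence
    (fun x => d * Real.exp (2 * tiltBound c ξ) * (1 * w x y)) ?_ ?_
    ((h.integrable_mul h1 y).const_mul _)
    (.of_forall fun x => (tendsto_gaussianTilt_smul_sub_one_div (θ x) ξ).const_mul _)
  · refine .of_forall fun s => Measurable.aestronglyMeasurable ?_
    have hm : Measurable fun x => gaussianTilt (s • θ x) ξ :=
      measurable_gaussianTilt.comp (f := fun x => (s • θ x, ξ))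
        ((hθ.const_smul s).prodMk measurable_const)
    exact (hf.mul (h.meas_left y)).mul ((hm.sub measurable_const).div measurable_const)
  · filter_upwards [Ioc_mem_nhdsGT one_pos] with s hs
    refine .of_forall fun x => ?_
    rw [norm_mul, norm_mul, Real.norm_of_nonneg (h.nonneg x y), Real.norm_eq_abs, Real.norm_eq_abs]
    calc |f x| * w x y * |(gaussianTilt (s • θ x) ξ - 1) / s|
        ≤ d * w x y * Real.exp (2 * tiltBound c ξ) := by
          have h2 := abs_gaussianTilt_smul_sub_one_le hs (hθc x) hc ξ
          have h3 := h.nonneg x y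
          have h4 := (abs_nonneg _).trans (hfd x)
          gcongr
          exact hfd x
      _ = _ := by ring

/-- Centring `f` at its posterior mean turns products into covariances: the first-order response to
the field `ξ` is linear in `ξ` with the covariances of `f` and `θ` as coefficients. -/
theorem integral_centred_mul_sum_dotProduct [IsFiniteMeasure μ] (h : IsWeight γ w B)
    (hθ : Measurable θ) (hθc : ∀ x j k, |θ x j k| ≤ c) {f : X → ℝ}
    (hf : Measurable f) {d : ℝ} (hfd : ∀ x, |f x| ≤ d) (y : Y) (ξ : Fin n → Fin K → ℝ) :
    ∫ x, (f x - wInt μ w f y / wInt μ w (fun _ => 1) y) * w x y * ∑ j, θ x j ⬝ᵥ ξ j ∂μ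
      = ∑ j, (fun k => wCov μ w f (fun x => θ x j k) y) ⬝ᵥ ξ j := by
  set m := wInt μ w f y / wInt μ w (fun _ => 1) y with hm
  have hθm : ∀ j k, Measurable fun x => θ x j k := fun j k =>
    (measurable_pi_apply k).comp ((measurable_pi_apply j).comp hθ)
  have hfi : Integrable f μ := Integrable.of_bound hf.aestronglyMeasurable d
    (.of_forall hfd)
  have hθi : ∀ j k, Integrable (fun x => θ x j k) μ := fun j k =>
    Integrable.of_bound (hθm j k).aestronglyMeasurable c (.of_forall fun x => hθc x j k)
  have hfθi : ∀ j k, Integrable (fun x => f x * θ x j k) μ := fun j k =>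
    Integrable.of_bound (hf.mul (hθm j k)).aestronglyMeasurable (d * c) (.of_forall fun x => by
      rw [norm_mul]
      exact mul_le_mul (hfd x) (hθc x j k) (norm_nonneg _) ((abs_nonneg _).trans (hfd x)))
  have e : ∀ x, (f x - m) * w x y * ∑ j, θ x j ⬝ᵥ ξ j
      = ∑ j, ∑ k, ((f x * θ x j k * w x y) - m * (θ x j k * w x y)) * ξ j k := fun x => by
    simp only [dotProduct, Finset.mul_sum]
    refine Finset.sum_congr rfl fun j _ => Finset.sum_congr rfl fun k _ => ?_
    ring
  have i : ∀ j k, Integrable (fun x => ((f x * θ x j k * w x y) - m * (θ x j k * w x y)) * ξ j k) μ :=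
    fun j k => ((h.integrable_mul (hfθi j k) y).sub
      ((h.integrable_mul (hθi j k) y).const_mul m)).mul_const _
  simp only [e]
  rw [integral_finsetSum _ fun j _ => integrable_finsetSum _ fun k _ => i j k]
  refine Finset.sum_congr rfl fun j _ => ?_
  rw [integral_finsetSum _ fun k _ => i j k]
  refine Finset.sum_congr rfl fun k _ => ?_
  rw [integral_mul_const, integral_sub (h.integrable_mul (hfθi j k) y)
    ((h.integrable_mul (hθi j k) y).const_mul m), integral_const_mul]
  simp only [wCov, wInt, hm]
  ring

theorem _root_.MeasureTheory.integral_lin_comb_three {Ω : Type*} [MeasurableSpace Ω] {ν : Measure Ω}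
    {a b z : Ω → ℝ} (ha : Integrable a ν) (hb : Integrable b ν) (hz : Integrable z ν) (p q r : ℝ) :
    ∫ ω, p * a ω + q * b ω - r * z ω ∂ν = p * ∫ ω, a ω ∂ν + q * ∫ ω, b ω ∂ν - r * ∫ ω, z ω ∂ν := by
  have := ((ha.const_mul p).add (hb.const_mul q))
  rw [integral_sub (f := fun ω => p * a ω + q * b ω) this (hz.const_mul r),
    integral_add (ha.const_mul p) (hb.const_mul q), integral_const_mul, integral_const_mul,
    integral_const_mul]

/-- The derivative in `s²` at `s = 0` of the mean product of posterior means under a bounded tilt. -/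
theorem tendsto_tilted_sub_div_sq [IsFiniteMeasure μ] [SFinite γ] (h : IsWeight γ w B)
    (hθ : Measurable θ) (hc : 0 ≤ c) (hθc : ∀ x j k, |θ x j k| ≤ c) {f g : X → ℝ}
    (hf : Measurable f) (hg : Measurable g) (hfc : ∀ x, |f x| ≤ c) (hgc : ∀ x, |g x| ≤ c)
    (hZ : ∀ y, 0 < wInt μ w (fun _ => 1) y) :
    Tendsto (fun s : ℝ => ((∫ z, wInt μ (tiltedWeight w θ s) f z * wInt μ (tiltedWeight w θ s) g z
          / wInt μ (tiltedWeight w θ s) (fun _ => 1) z ∂(γ.prod (gaussianArray n K)))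
        - ∫ y, wInt μ w f y * wInt μ w g y / wInt μ w (fun _ => 1) y ∂γ) / s ^ 2) (𝓝[>] 0)
      (𝓝 (∫ y, (∑ j, ∑ k, wCov μ w f (fun x => θ x j k) y * wCov μ w g (fun x => θ x j k) y)
        / wInt μ w (fun _ => 1) y ∂γ)) := by
  have h1 : Integrable (fun _ : X => (1 : ℝ)) μ := integrable_const _
  have hbi : ∀ {f : X → ℝ}, Measurable f → (∀ x, |f x| ≤ c) → Integrable f μ := fun hf hfc =>
    Integrable.of_bound hf.aestronglyMeasurable c (.of_forall hfc)
  set Z : Y → ℝ := wInt μ w (fun _ => 1) with hZdef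
  have hZm : Measurable Z := h.measurable_wInt measurable_const
  set m : (X → ℝ) → Y → ℝ := fun f y => wInt μ w f y / Z y with hm
  have hmm : ∀ {f : X → ℝ}, Measurable f → Measurable (m f) := fun hf =>
    (h.measurable_wInt hf).div hZm
  have hmc : ∀ {f : X → ℝ}, (∀ x, |f x| ≤ c) → ∀ y, |m f y| ≤ c := fun {f} hfc y => by
    have := h.abs_wInt_le (integrable_const (μ := μ) c) hfc y
    have e : wInt μ w (fun _ => c) y = c * Z y := by
      simp only [hZdef, wInt, one_mul, integral_const_mul]
    rw [e] at this
    rw [abs_div, abs_of_pos (hZ y), div_le_iff₀ (hZ y)]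
    exact this
  have hfm : ∀ {f : X → ℝ}, (∀ x, |f x| ≤ c) → ∀ y x, |f x - m f y| ≤ 2 * c := fun {f} hfc y x =>
    (abs_sub _ _).trans (by linarith [hfc x, hmc hfc y])
  set U : ℝ → (X → ℝ) → Y × (Fin n → Fin K → ℝ) → ℝ := fun s f z =>
    wInt μ (tiltedWeight w θ s) f z
  set I : ℝ → (X → ℝ) → Y × (Fin n → Fin K → ℝ) → ℝ := fun s f z =>
    ∫ x, (f x - m f z.1) * w x z.1 * ((gaussianTilt (s • θ x) z.2 - 1) / s) ∂μ
  set J : (X → ℝ) → Y × (Fin n → Fin K → ℝ) → ℝ := fun f z =>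
    ∑ j, (fun k => wCov μ w f (fun x => θ x j k) z.1) ⬝ᵥ z.2 j
  have hUI : ∀ {s : ℝ}, s ∈ Ioc (0 : ℝ) 1 → ∀ {f : X → ℝ}, Measurable f → (∀ x, |f x| ≤ c) →
      ∀ z, U s f z - m f z.1 * U s (fun _ => 1) z = s * I s f z := fun hs f hf hfc z =>
    h.wInt_tilted_sub hθ hc hθc hs (hbi hf hfc) (hZ z.1).ne' z.2
  have hUm : ∀ {s : ℝ}, s ∈ Ioc (0 : ℝ) 1 → ∀ {f : X → ℝ}, Measurable f → Measurable (U s f) :=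
    fun hs f hf => (h.tilted hθ hc hθc hs).measurable_wInt hf
  have hIm : ∀ {s : ℝ}, s ∈ Ioc (0 : ℝ) 1 → ∀ {f : X → ℝ}, Measurable f → (∀ x, |f x| ≤ c) →
      Measurable (I s f) := fun {s} hs f hf hfc => by
    have e : I s f = fun z => (U s f z - m f z.1 * U s (fun _ => 1) z) / s := by
      ext z
      rw [hUI hs hf hfc, mul_div_cancel_left₀ _ hs.1.ne']
    rw [e]
    exact ((hUm hs hf).sub (((hmm hf).comp measurable_fst).mul (hUm hs measurable_const))).div_const s
  have hIle : ∀ {s : ℝ}, s ∈ Ioc (0 : ℝ) 1 → ∀ {f : X → ℝ}, (∀ x, |f x| ≤ c) →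
      ∀ z, |I s f z| ≤ 2 * c * Real.exp (2 * tiltBound c z.2) * Z z.1 := fun hs f hfc z =>
    h.abs_integral_increment_le hc hθc hs (hfm hfc z.1) z.1 z.2
  have hUZ : ∀ {s : ℝ}, s ∈ Ioc (0 : ℝ) 1 → ∀ z,
      Real.exp (-tiltBound c z.2) * Z z.1 ≤ U s (fun _ => 1) z := fun {s} hs z => by
    simp only [U, hZdef, wInt]
    rw [← integral_const_mul]
    refine integral_mono ((h.integrable_mul h1 z.1).const_mul _)
      ((h.tilted hθ hc hθc hs).integrable_mul h1 z) fun x => ?_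
    have := mul_le_mul_of_nonneg_left (le_gaussianTilt_smul hs (hθc x) hc z.2) (h.nonneg x z.1)
    simp only [tiltedWeight]
    linarith
  -- The exponent 5 counts two for each of the two increments and one for the lower bound of the
  -- denominator.
  set D : Y × (Fin n → Fin K → ℝ) → ℝ := fun z =>
    Z z.1 * (4 * c ^ 2 * Real.exp (5 * tiltBound c z.2)) with hD
  have hDi : Integrable D (γ.prod (gaussianArray n K)) :=
    (h.integrable_wInt h1).mul_prod ((integrable_exp_tiltBound c 5).const_mul _)
  have hq : ∀ {s : ℝ}, s ∈ Ioc (0 : ℝ) 1 → ∀ z,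
      |I s f z * I s g z / U s (fun _ => 1) z| ≤ D z := fun {s} hs z => by
    have hz := hZ z.1
    have hU := hUZ hs z
    have hU0 : 0 < U s (fun _ => 1) z := lt_of_lt_of_le (by positivity) hU
    rw [abs_div, abs_mul, abs_of_pos hU0, div_le_iff₀ hU0]
    calc |I s f z| * |I s g z|
        ≤ (2 * c * Real.exp (2 * tiltBound c z.2) * Z z.1)
          * (2 * c * Real.exp (2 * tiltBound c z.2) * Z z.1) :=
          mul_le_mul (hIle hs hfc z) (hIle hs hgc z) (abs_nonneg _) (by positivity)
      _ = D z * (Real.exp (-tiltBound c z.2) * Z z.1) := by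
          have e : Real.exp (5 * tiltBound c z.2) * Real.exp (-tiltBound c z.2)
              = Real.exp (2 * tiltBound c z.2) * Real.exp (2 * tiltBound c z.2) := by
            rw [← Real.exp_add, ← Real.exp_add]; congr 1; ring
          simp only [hD]
          linear_combination (-(4 * c ^ 2 * Z z.1 ^ 2)) * e
      _ ≤ D z * U s (fun _ => 1) z := by
          have : 0 ≤ D z := by simp only [hD]; positivity
          gcongr
  have hQm : ∀ {s : ℝ}, s ∈ Ioc (0 : ℝ) 1 →
      Measurable fun z => I s f z * I s g z / U s (fun _ => 1) z := fun hs =>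
    ((hIm hs hf hfc).mul (hIm hs hg hgc)).div (hUm hs measurable_const)
  -- Substituting `U f = s I f + m f * U 1`, with `U 1` the tilted partition function, splits `U f *
  -- U g / U 1` into `s² I f * I g / U 1` and the part `l`, linear in the tilted integrals. By the
  -- martingale property `l` integrates to the value at `s = 0`, so the identity is exact.
  have hstep : ∀ {s : ℝ}, s ∈ Ioc (0 : ℝ) 1 →
      (∫ z, U s f z * U s g z / U s (fun _ => 1) z ∂(γ.prod (gaussianArray n K)))
        - ∫ y, wInt μ w f y * wInt μ w g y / Z y ∂γ
      = s ^ 2 * ∫ z, I s f z * I s g z / U s (fun _ => 1) z ∂(γ.prod (gaussianArray n K)) := by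
    intro s hs
    have hT := h.tilted hθ hc hθc hs
    set l : Y × (Fin n → Fin K → ℝ) → ℝ := fun z =>
      m g z.1 * U s f z + m f z.1 * U s g z - m f z.1 * m g z.1 * U s (fun _ => 1) z with hl
    have hUi : ∀ {f : X → ℝ}, Integrable f μ →
        Integrable (U s f) (γ.prod (gaussianArray n K)) := fun hf => hT.integrable_wInt hf
    have i1 : Integrable (fun z => m g z.1 * U s f z) (γ.prod (gaussianArray n K)) :=
      (hUi (hbi hf hfc)).bdd_mul (c := c) ((hmm hg).comp measurable_fst).aestronglyMeasurable
        (.of_forall fun z => hmc hgc z.1)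
    have i2 : Integrable (fun z => m f z.1 * U s g z) (γ.prod (gaussianArray n K)) :=
      (hUi (hbi hg hgc)).bdd_mul (c := c) ((hmm hf).comp measurable_fst).aestronglyMeasurable
        (.of_forall fun z => hmc hfc z.1)
    have i3 : Integrable (fun z => m f z.1 * m g z.1 * U s (fun _ => 1) z)
        (γ.prod (gaussianArray n K)) :=
      (hUi h1).bdd_mul (c := c * c)
        (((hmm hf).comp measurable_fst).mul ((hmm hg).comp measurable_fst)).aestronglyMeasurable
        (.of_forall fun z => by
          rw [norm_mul]; exact mul_le_mul (hmc hfc z.1) (hmc hgc z.1) (norm_nonneg _) hc)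
    have hli : Integrable l (γ.prod (gaussianArray n K)) := (i1.add i2).sub i3
    have hint : ∫ z, l z ∂(γ.prod (gaussianArray n K))
        = ∫ y, wInt μ w f y * wInt μ w g y / Z y ∂γ := by
      rw [integral_prod _ hli]
      refine integral_congr_ae (.of_forall fun y => ?_)
      simp only [hl]
      obtain ⟨j1, e1⟩ := h.integral_wInt_tilted hθ hc hθc hs (hbi hf hfc) y
      obtain ⟨j2, e2⟩ := h.integral_wInt_tilted hθ hc hθc hs (hbi hg hgc) y
      obtain ⟨j3, e3⟩ := h.integral_wInt_tilted hθ hc hθc hs h1 y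
      refine (integral_lin_comb_three j1 j2 j3 _ _ _).trans ?_
      rw [e1, e2, e3]
      have := (hZ y).ne'
      simp only [hm]
      rw [← hZdef]
      field_simp
      ring
    have hQi : Integrable (fun z => I s f z * I s g z / U s (fun _ => 1) z)
        (γ.prod (gaussianArray n K)) :=
      hDi.mono' (hQm hs).aestronglyMeasurable (.of_forall (hq hs))
    rw [← hint, ← integral_const_mul, sub_eq_iff_eq_add, ← integral_add (hQi.const_mul _) hli]
    refine integral_congr_ae (.of_forall fun z => ?_)
    have hU0 : U s (fun _ => 1) z ≠ 0 :=
      (lt_of_lt_of_le (mul_pos (Real.exp_pos _) (hZ z.1)) (hUZ hs z)).ne'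
    have a1 := hUI hs hf hfc z
    have a2 := hUI hs hg hgc z
    have b1 : U s f z = s * I s f z + m f z.1 * U s (fun _ => 1) z := by linarith
    have b2 : U s g z = s * I s g z + m g z.1 * U s (fun _ => 1) z := by linarith
    simp only [hl]
    rw [b1, b2]
    field_simp
    ring
  have hJ : ∀ {f : X → ℝ}, Measurable f → (∀ x, |f x| ≤ c) → ∀ z,
      Tendsto (fun s => I s f z) (𝓝[>] 0) (𝓝 (J f z)) := fun {f} hf hfc z => by
    have := h.tendsto_integral_increment (μ := μ) hθ hc hθc (hf.sub_const (m f z.1))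
      (hfm hfc z.1) z.1 z.2
    rw [h.integral_centred_mul_sum_dotProduct hθ hθc hf hfc z.1 z.2] at this
    exact this
  have hUlim : ∀ z, Tendsto (fun s => U s (fun _ => 1) z) (𝓝[>] 0) (𝓝 (Z z.1)) := fun z => by
    refine tendsto_integral_filter_of_dominated_convergence
      (fun x => Real.exp (tiltBound c z.2) * (1 * w x z.1)) ?_ ?_
      ((h.integrable_mul h1 z.1).const_mul _) (.of_forall fun x => ?_)
    · filter_upwards [Ioc_mem_nhdsGT one_pos] with s hs
      exact ((h.tilted hθ hc hθc hs).integrable_mul h1 z).aestronglyMeasurable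
    · filter_upwards [Ioc_mem_nhdsGT one_pos] with s hs
      refine .of_forall fun x => ?_
      have := mul_le_mul_of_nonneg_left (gaussianTilt_smul_le hs (hθc x) hc z.2) (h.nonneg x z.1)
      rw [one_mul, Real.norm_of_nonneg ((h.tilted hθ hc hθc hs).nonneg x z), one_mul, mul_comm]
      exact this
    · have := (tendsto_gaussianTilt_smul (θ x) z.2).const_mul (w x z.1)
      simpa only [tiltedWeight, one_mul, mul_one] using this
  have hlim : ∀ z, Tendsto (fun s => I s f z * I s g z / U s (fun _ => 1) z) (𝓝[>] 0)
      (𝓝 (J f z * J g z / Z z.1)) := fun z =>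
    ((hJ hf hfc z).mul (hJ hg hgc z)).div (hUlim z) (hZ z.1).ne'
  have hJle : ∀ z, |J f z * J g z / Z z.1| ≤ D z := fun z =>
    le_of_tendsto (hlim z).abs (by
      filter_upwards [Ioc_mem_nhdsGT one_pos] with s hs using hq hs z)
  have hJm : ∀ {f : X → ℝ}, Measurable f → Measurable (J f) := fun {f} hf => by
    have : ∀ j k, Measurable (wCov μ w f (fun x => θ x j k)) := fun j k =>
      h.measurable_wCov hf ((measurable_pi_apply k).comp ((measurable_pi_apply j).comp hθ))
    simp only [J, dotProduct]
    refine Finset.measurable_fun_sum _ fun j _ => Finset.measurable_fun_sum _ fun k _ => ?_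
    exact ((this j k).comp measurable_fst).mul
      ((measurable_pi_apply k).comp ((measurable_pi_apply j).comp measurable_snd))
  have hJi : Integrable (fun z => J f z * J g z / Z z.1) (γ.prod (gaussianArray n K)) :=
    hDi.mono' (((hJm hf).mul (hJm hg)).div (hZm.comp measurable_fst)).aestronglyMeasurable
      (.of_forall hJle)
  -- For fixed `y`, `J f` and `J g` are linear forms in the Gaussian `ξ`; their covariance is the
  -- inner product of their coefficients.
  have hval : ∫ z, J f z * J g z / Z z.1 ∂(γ.prod (gaussianArray n K))
      = ∫ y, (∑ j, ∑ k, wCov μ w f (fun x => θ x j k) y * wCov μ w g (fun x => θ x j k) y)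
        / Z y ∂γ := by
    rw [integral_prod _ hJi]
    refine integral_congr_ae (.of_forall fun y => ?_)
    simp only [J]
    rw [integral_div, (integral_mul_gaussianArray _ _).2]
    simp only [dotProduct]
  rw [← hval]
  have hmain : Tendsto (fun s => ∫ z, I s f z * I s g z / U s (fun _ => 1) z
      ∂(γ.prod (gaussianArray n K))) (𝓝[>] 0)
      (𝓝 (∫ z, J f z * J g z / Z z.1 ∂(γ.prod (gaussianArray n K)))) := by
    refine tendsto_integral_filter_of_dominated_convergence D ?_ ?_ hDi (.of_forall hlim)
    · filter_upwards [Ioc_mem_nhdsGT one_pos] with s hs using (hQm hs).aestronglyMeasurable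
    · filter_upwards [Ioc_mem_nhdsGT one_pos] with s hs using .of_forall (hq hs)
  refine hmain.congr' ?_
  filter_upwards [Ioc_mem_nhdsGT one_pos] with s hs
  rw [hstep hs, mul_div_cancel_left₀ _ (pow_ne_zero 2 hs.1.ne')]

end IsWeight

end Tilting

end

noncomputable section

namespace TensorInterp

open Filter Topology

/-! ### The matrix square root. -/

section MatSqrt

variable {K : ℕ} {R : Matrix (Fin K) (Fin K) ℝ}

open scoped MatrixOrder in
theorem posSemidef_matSqrt (R : Matrix (Fin K) (Fin K) ℝ) : (matSqrt R).PosSemidef :=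
  Matrix.nonneg_iff_posSemidef.1 (CFC.sqrt_nonneg R)

open scoped MatrixOrder in
theorem matSqrt_mul_self (hR : R.PosSemidef) : matSqrt R * matSqrt R = R :=
  CFC.sqrt_mul_sqrt_self R (Matrix.nonneg_iff_posSemidef.2 hR)

theorem transpose_matSqrt (R : Matrix (Fin K) (Fin K) ℝ) : (matSqrt R)ᵀ = matSqrt R := by
  have := (posSemidef_matSqrt R).isHermitian
  rwa [Matrix.IsHermitian, Matrix.conjTranspose_eq_transpose_of_trivial] at this

theorem matSqrt_mulVec_dotProduct (hR : R.PosSemidef)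
    (v u : Fin K → ℝ) : (matSqrt R *ᵥ v) ⬝ᵥ (matSqrt R *ᵥ u) = v ⬝ᵥ R *ᵥ u := by
  conv_rhs => rw [← matSqrt_mul_self hR]
  rw [← Matrix.mulVec_mulVec, Matrix.dotProduct_mulVec v, ← Matrix.mulVec_transpose,
    transpose_matSqrt]

theorem matSqrt_mulVec_dotProduct_self (hR : R.PosSemidef) (v : Fin K → ℝ) :
    (matSqrt R *ᵥ v) ⬝ᵥ (matSqrt R *ᵥ v) = v ⬝ᵥ R *ᵥ v := matSqrt_mulVec_dotProduct hR v v

end MatSqrt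

end TensorInterp

end

section MatSqrtContinuity

-- The operator norm supplies the C⋆-algebra structure used by the functional calculus; the
-- conclusion concerns the topology only.
open scoped MatrixOrder Matrix.Norms.L2Operator in
theorem TensorInterp.continuousOn_matSqrt (K : ℕ) :
    ContinuousOn (TensorInterp.matSqrt (K := K)) {R | R.PosSemidef} := by
  have h := CFC.continuousOn_sqrt (A := Matrix (Fin K) (Fin K) ℝ)
  simp only [Matrix.nonneg_iff_posSemidef] at h
  exact h

end MatSqrtContinuity

noncomputable section

/-! ### The posterior weight of the tensor model as a Gaussian density. -/

namespace TensorInterp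

open Filter Topology

variable {p n K : ℕ}

/-- The space of the tensor noise and the side noise. -/
abbrev Noise (p n K : ℕ) : Type := (TensorIndex p n → ℝ) × Config n K

/-- The law of the tensor noise. -/
def tensorNoise (p n : ℕ) : Measure (TensorIndex p n → ℝ) := Measure.pi fun _ => gaussianReal 0 1

instance : IsProbabilityMeasure (tensorNoise p n) := by unfold tensorNoise; infer_instance

/-- The joint law of the tensor noise and the side noise. -/
def noiseLaw (p n K : ℕ) : Measure (Noise p n K) := (tensorNoise p n).prod (gaussianArray n K)

instance : IsProbabilityMeasure (noiseLaw p n K) := by unfold noiseLaw; infer_instance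

/-- The Cameron–Martin density of the tensor noise shifted by `θ`. -/
def tensorTilt (θ Y : TensorIndex p n → ℝ) : ℝ := Real.exp (θ ⬝ᵥ Y - θ ⬝ᵥ θ / 2)

theorem measurable_tensorTilt :
    Measurable fun z : (TensorIndex p n → ℝ) × (TensorIndex p n → ℝ) => tensorTilt z.1 z.2 := by
  simp only [tensorTilt, dotProduct]; fun_prop

theorem integrable_tensorTilt (θ : TensorIndex p n → ℝ) :
    Integrable (tensorTilt θ) (tensorNoise p n) ∧ ∫ Y, tensorTilt θ Y ∂(tensorNoise p n) = 1 := by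
  have hm : Measurable fun Y => tensorTilt θ Y := by simp only [tensorTilt, dotProduct]; fun_prop
  have h0 : ∀ Y, 0 ≤ tensorTilt θ Y := fun Y => (Real.exp_pos _).le
  have hT : Measurable fun Y : TensorIndex p n → ℝ => Y + θ := by fun_prop
  exact integrable_of_map_eq_withDensity hT hm h0 (pi_gaussianReal_map_add_eq_withDensity θ)

/-- Completing the square. The right side does not depend on the signal, which yields a bound
`noiseBound` uniform in `x`, `t` and `R`. -/
theorem exp_dotProduct_sub_le {ι : Type*} [Fintype ι] (θ Y : ι → ℝ) :
    θ ⬝ᵥ Y - θ ⬝ᵥ θ / 2 ≤ Y ⬝ᵥ Y / 2 := by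
  have h : 0 ≤ (θ - Y) ⬝ᵥ (θ - Y) := Finset.sum_nonneg fun i _ => mul_self_nonneg _
  simp only [sub_dotProduct, dotProduct_sub, dotProduct_comm Y θ] at h
  linarith

/-- The posterior weight `exp (-H)`. -/
def gibbsWeight (p : ℕ) {n K : ℕ} (t : ℝ) (R : Matrix (Fin K) (Fin K) ℝ) (x : Config n K)
    (y : Noise p n K) : ℝ :=
  Real.exp (-hamiltonian t R y.1 y.2 x)

/-- The noiseless tensor signal. -/
def tensorSignal (p : ℕ) {n K : ℕ} (t : ℝ) (x : Config n K) : TensorIndex p n → ℝ :=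
  fun i => amplitude p n t * tensorEntry x i

/-- The noiseless side signal. -/
def sideSignal {n K : ℕ} (R : Matrix (Fin K) (Fin K) ℝ) (x : Config n K) : Config n K :=
  fun j => matSqrt R *ᵥ x j

theorem measurable_tensorEntry (i : TensorIndex p n) :
    Measurable fun x : Config n K => tensorEntry x i := by
  unfold tensorEntry; fun_prop

theorem measurable_tensorSignal (t : ℝ) :
    Measurable (tensorSignal p t : Config n K → TensorIndex p n → ℝ) :=
  measurable_pi_lambda _ fun i => (measurable_tensorEntry i).const_mul _

theorem measurable_sideSignal (R : Matrix (Fin K) (Fin K) ℝ) :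
    Measurable (sideSignal R : Config n K → Config n K) := by
  refine measurable_pi_lambda _ fun j => measurable_pi_lambda _ fun k => ?_
  simp only [sideSignal, Matrix.mulVec, dotProduct]; fun_prop

theorem amplitude_sq {t : ℝ} (ht : t ≤ 1) :
    amplitude p n t ^ 2 = (1 - t) * ((p - 1).factorial : ℝ) / (n : ℝ) ^ (p - 1) := by
  rw [amplitude, Real.sq_sqrt]
  have : 0 ≤ 1 - t := by linarith
  positivity

/-- The square terms of `H` are the normalisations of two Gaussian shifts, so `exp (-H)` is the
density of the observations given `x` relative to pure noise. The hypotheses make the amplitude and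
`matSqrt R` square to the intended quantities. -/
theorem gibbsWeight_eq {t : ℝ} (ht : t ≤ 1) {R : Matrix (Fin K) (Fin K) ℝ} (hR : R.PosSemidef)
    (x : Config n K) (y : Noise p n K) :
    gibbsWeight p t R x y
      = tensorTilt (tensorSignal p t x) y.1 * gaussianTilt (sideSignal R x) y.2 := by
  rw [gibbsWeight, tensorTilt, gaussianTilt, ← Real.exp_add]
  congr 1
  have hs : ∀ j, sideSignal R x j ⬝ᵥ sideSignal R x j = x j ⬝ᵥ R *ᵥ x j := fun j =>
    matSqrt_mulVec_dotProduct_self hR (x j)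
  have hc : ∀ j, sideSignal R x j ⬝ᵥ y.2 j = y.2 j ⬝ᵥ matSqrt R *ᵥ x j := fun j =>
    dotProduct_comm _ _
  have hY : tensorSignal p t x ⬝ᵥ y.1 = ∑ i, amplitude p n t * tensorEntry x i * y.1 i := rfl
  have hT : tensorSignal p t x ⬝ᵥ tensorSignal p t x
      = ∑ i : TensorIndex p n,
        amplitude p n t * tensorEntry x i * (amplitude p n t * tensorEntry x i) := rfl
  simp only [hs, hc, hamiltonian, hY, hT]
  rw [neg_add, Finset.sum_div, Finset.sum_div, ← Finset.sum_sub_distrib, ← Finset.sum_sub_distrib,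
    ← Finset.sum_neg_distrib, ← Finset.sum_neg_distrib]
  congr 1
  · refine Finset.sum_congr rfl fun i _ => ?_
    have e : (1 - t) * ((p - 1).factorial : ℝ) / (2 * (n : ℝ) ^ (p - 1))
        = amplitude p n t ^ 2 / 2 := by
      rw [amplitude_sq ht, div_div, mul_comm (2 : ℝ)]
    rw [e]; ring
  · refine Finset.sum_congr rfl fun j _ => ?_
    ring

/-- The bound of the posterior weight in terms of the observations. -/
def noiseBound (y : Noise p n K) : ℝ :=
  Real.exp (y.1 ⬝ᵥ y.1 / 2) * Real.exp ((∑ j, y.2 j ⬝ᵥ y.2 j) / 2)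

theorem gibbsWeight_le {t : ℝ} (ht : t ≤ 1) {R : Matrix (Fin K) (Fin K) ℝ} (hR : R.PosSemidef)
    (x : Config n K) (y : Noise p n K) : gibbsWeight p t R x y ≤ noiseBound y := by
  rw [gibbsWeight_eq ht hR, tensorTilt, gaussianTilt, noiseBound]
  refine mul_le_mul (Real.exp_le_exp.2 (exp_dotProduct_sub_le _ _)) (Real.exp_le_exp.2 ?_)
    (Real.exp_pos _).le (Real.exp_pos _).le
  rw [Finset.sum_div, Finset.sum_div, ← Finset.sum_sub_distrib]
  exact Finset.sum_le_sum fun j _ => exp_dotProduct_sub_le _ _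

theorem measurable_gibbsWeight {t : ℝ} (ht : t ≤ 1) {R : Matrix (Fin K) (Fin K) ℝ}
    (hR : R.PosSemidef) :
    Measurable (Function.uncurry (gibbsWeight (n := n) p t R)) := by
  have e : Function.uncurry (gibbsWeight (n := n) p t R) = fun z : Config n K × Noise p n K =>
      tensorTilt (tensorSignal p t z.1) z.2.1 * gaussianTilt (sideSignal R z.1) z.2.2 :=
    funext fun z => gibbsWeight_eq ht hR z.1 z.2
  rw [e]
  refine Measurable.mul ?_ ?_
  · exact measurable_tensorTilt.comp
      (f := fun z : Config n K × Noise p n K => (tensorSignal p t z.1, z.2.1))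
      (((measurable_tensorSignal t).comp measurable_fst).prodMk
        (measurable_fst.comp measurable_snd))
  · exact measurable_gaussianTilt.comp
      (f := fun z : Config n K × Noise p n K => (sideSignal R z.1, z.2.2))
      (((measurable_sideSignal R).comp measurable_fst).prodMk
        (measurable_snd.comp measurable_snd))

theorem integrable_gibbsWeight {t : ℝ} (ht : t ≤ 1) {R : Matrix (Fin K) (Fin K) ℝ}
    (hR : R.PosSemidef) (x : Config n K) :
    Integrable (gibbsWeight p t R x) (noiseLaw p n K) ∧
      ∫ y, gibbsWeight p t R x y ∂(noiseLaw p n K) = 1 := by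
  have e : gibbsWeight p t R x = fun y : Noise p n K =>
      tensorTilt (tensorSignal p t x) y.1 * gaussianTilt (sideSignal R x) y.2 :=
    funext fun y => gibbsWeight_eq ht hR x y
  rw [e, noiseLaw]
  refine ⟨(integrable_tensorTilt _).1.mul_prod (integrable_gaussianTilt _).1, ?_⟩
  rw [integral_prod_mul (μ := tensorNoise p n) (ν := gaussianArray n K)
    (fun Y => tensorTilt (tensorSignal p t x) Y) (fun ξ => gaussianTilt (sideSignal R x) ξ),
    (integrable_tensorTilt _).2, (integrable_gaussianTilt _).2, mul_one]

/-- The posterior weight of the prior conditioned to `A`. -/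
def truncWeight (p : ℕ) {n K : ℕ} (A : Set (Config n K)) (t : ℝ) (R : Matrix (Fin K) (Fin K) ℝ)
    (x : Config n K) (y : Noise p n K) : ℝ :=
  A.indicator (fun _ => 1) x * gibbsWeight p t R x y

theorem truncWeight_univ (t : ℝ) (R : Matrix (Fin K) (Fin K) ℝ) :
    truncWeight (n := n) p univ t R = gibbsWeight p t R := by
  ext x y; simp [truncWeight]

theorem isWeight_truncWeight {A : Set (Config n K)} (hA : MeasurableSet A) {t : ℝ} (ht : t ≤ 1)
    {R : Matrix (Fin K) (Fin K) ℝ} (hR : R.PosSemidef) :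
    IsWeight (noiseLaw p n K) (truncWeight p A t R) noiseBound where
  meas := ((measurable_const.indicator hA).comp measurable_fst).mul (measurable_gibbsWeight ht hR)
  nonneg x y := mul_nonneg (indicator_nonneg (fun _ _ => zero_le_one) x) (Real.exp_pos _).le
  le_bound x y := by
    refine (mul_le_of_le_one_left (Real.exp_pos _).le ?_).trans (gibbsWeight_le ht hR x y)
    exact indicator_le_self' (fun _ _ => zero_le_one) x |>.trans le_rfl
  integrable x := (integrable_gibbsWeight ht hR x).1.const_mul _
  integral_le x := by
    simp only [truncWeight]
    rw [integral_const_mul, (integrable_gibbsWeight ht hR x).2, mul_one]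
    exact indicator_le_self' (fun _ _ => zero_le_one) x |>.trans le_rfl

theorem integral_truncWeight (A : Set (Config n K)) {t : ℝ} (ht : t ≤ 1)
    {R : Matrix (Fin K) (Fin K) ℝ} (hR : R.PosSemidef) (x : Config n K) :
    ∫ y, truncWeight p A t R x y ∂(noiseLaw p n K) = A.indicator (fun _ => 1) x := by
  simp only [truncWeight]
  rw [integral_const_mul, (integrable_gibbsWeight ht hR x).2, mul_one]

theorem wInt_truncWeight_pos {μ : Measure (Config n K)} [IsFiniteMeasure μ] {A : Set (Config n K)}
    (hA : MeasurableSet A) (hμ : μ A ≠ 0) {t : ℝ} (ht : t ≤ 1) {R : Matrix (Fin K) (Fin K) ℝ}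
    (hR : R.PosSemidef) (y : Noise p n K) : 0 < wInt μ (truncWeight p A t R) (fun _ => 1) y := by
  have h := isWeight_truncWeight (p := p) hA ht hR
  have hi := h.integrable_mul (integrable_const (μ := μ) (1 : ℝ)) y
  refine (integral_pos_iff_support_of_nonneg
    (fun x => mul_nonneg zero_le_one (h.nonneg x y)) hi).2 ?_
  have hs : Function.support (fun x => 1 * truncWeight p A t R x y) = A := by
    ext x
    by_cases hx : x ∈ A <;> simp [truncWeight, gibbsWeight, hx]
  rw [hs]
  exact pos_iff_ne_zero.2 hμ

/-- Continuity of the posterior weight in time and in the side channel. -/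
theorem continuousOn_gibbsWeight (x : Config n K) (y : Noise p n K) :
    ContinuousOn (fun q : ℝ × Matrix (Fin K) (Fin K) ℝ => gibbsWeight p q.1 q.2 x y)
      (Icc 0 1 ×ˢ {R | R.PosSemidef}) := by
  have hs : ContinuousOn (fun q : ℝ × Matrix (Fin K) (Fin K) ℝ => matSqrt q.2)
      (Icc 0 1 ×ˢ {R | R.PosSemidef}) :=
    (continuousOn_matSqrt K).comp continuousOn_snd fun q hq => hq.2
  have ha : Continuous (amplitude p n) := by unfold amplitude; fun_prop
  simp only [gibbsWeight, hamiltonian]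
  refine Real.continuous_exp.comp_continuousOn (ContinuousOn.neg (ContinuousOn.add ?_ ?_))
  · refine Continuous.continuousOn (continuous_finsetSum _ fun i _ => ?_)
    fun_prop
  · refine continuousOn_finsetSum _ fun j _ => ContinuousOn.sub ?_ ?_
    · refine Continuous.continuousOn ?_
      exact continuous_const.mul (continuous_const.dotProduct
        (continuous_snd.matrix_mulVec continuous_const))
    · have : Continuous fun M : Matrix (Fin K) (Fin K) ℝ => y.2 j ⬝ᵥ M *ᵥ x j :=
        continuous_const.dotProduct (continuous_id.matrix_mulVec continuous_const)
      exact this.comp_continuousOn hs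

end TensorInterp

end

noncomputable section

/-! ### Mean products of posterior means and covariances. -/

section PosteriorMoments

variable {X Y : Type*} [MeasurableSpace X] [MeasurableSpace Y]

/-- The mean of the product of the posterior means of `f` and `g`. -/
def meanProd (μ : Measure X) (γ : Measure Y) (w : X → Y → ℝ) (f g : X → ℝ) : ℝ :=
  ∫ y, wInt μ w f y * wInt μ w g y / wInt μ w (fun _ => 1) y ∂γ

/-- The mean of the product of the posterior covariances of `f, k` and of `g, l`. -/
def meanCov (μ : Measure X) (γ : Measure Y) (w : X → Y → ℝ) (f k g l : X → ℝ) : ℝ :=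
  ∫ y, wCov μ w f k y * wCov μ w g l y / wInt μ w (fun _ => 1) y ∂γ

variable {μ : Measure X} {γ : Measure Y} {w : X → Y → ℝ} {B : Y → ℝ}

namespace IsWeight

theorem wCov_sum_right [IsFiniteMeasure μ] {ι : Type*} (s : Finset ι)
    (h : IsWeight γ w B) {f : X → ℝ} {g : ι → X → ℝ} (c : ι → ℝ)
    (hg : ∀ i, Integrable (g i) μ) (hfg : ∀ i, Integrable (fun x => f x * g i x) μ) (y : Y) :
    wCov μ w f (fun x => ∑ i ∈ s, c i * g i x) y = ∑ i ∈ s, c i * wCov μ w f (g i) y := by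
  have e1 : wInt μ w (fun x => f x * ∑ i ∈ s, c i * g i x) y
      = ∑ i ∈ s, c i * wInt μ w (fun x => f x * g i x) y := by
    simp only [wInt, ← integral_const_mul]
    rw [← integral_finsetSum _ fun i _ => (h.integrable_mul (hfg i) y).const_mul (c i)]
    refine integral_congr_ae (.of_forall fun x => ?_)
    simp only [Finset.mul_sum, Finset.sum_mul]
    exact Finset.sum_congr rfl fun i _ => by ring
  have e2 : wInt μ w (fun x => ∑ i ∈ s, c i * g i x) y = ∑ i ∈ s, c i * wInt μ w (g i) y := by
    simp only [wInt, ← integral_const_mul]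
    rw [← integral_finsetSum _ fun i _ => (h.integrable_mul (hg i) y).const_mul (c i)]
    refine integral_congr_ae (.of_forall fun x => ?_)
    simp only [Finset.sum_mul]
    exact Finset.sum_congr rfl fun i _ => by ring
  rw [wCov, e1, e2]
  simp only [wCov, mul_sub, Finset.sum_sub_distrib, Finset.mul_sum, Finset.sum_div]
  congr 1
  exact Finset.sum_congr rfl fun i _ => by ring

end IsWeight

end PosteriorMoments

section Indicator

variable {X Y : Type*} [MeasurableSpace X] {μ : Measure X} {w : X → Y → ℝ}

/-- Under a weight supported in `A`, functions matter only on `A`. Coordinates may thus be cut to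
bounded functions, as the tilting expansion requires. -/
theorem wInt_indicator {A : Set X} (hw : ∀ x ∉ A, ∀ y, w x y = 0) (f : X → ℝ) :
    wInt μ w (A.indicator f) = wInt μ w f := by
  ext y
  refine integral_congr_ae (.of_forall fun x => ?_)
  by_cases hx : x ∈ A
  · simp [hx]
  · simp [hx, hw x hx]

theorem wCov_indicator {A : Set X} (hw : ∀ x ∉ A, ∀ y, w x y = 0) (f g : X → ℝ) :
    wCov μ w (A.indicator f) (A.indicator g) = wCov μ w f g := by
  ext y
  have e : (fun x => A.indicator f x * A.indicator g x) = A.indicator fun x => f x * g x := by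
    ext x
    by_cases hx : x ∈ A <;> simp [hx]
  simp only [wCov, e, wInt_indicator hw]

end Indicator

/-! ### The side channel as a Gaussian field on the rows. -/

namespace TensorInterp

open Filter Topology

variable {p n K : ℕ}

/-- The sum of the squares of the entries of an array. -/
def sqSum (x : Config n K) : ℝ := ∑ j, ∑ l, x j l ^ 2

theorem measurable_sqSum : Measurable (sqSum : Config n K → ℝ) := by unfold sqSum; fun_prop

theorem sq_le_sqSum (x : Config n K) (j : Fin n) (l : Fin K) : x j l ^ 2 ≤ sqSum x :=
  (Finset.single_le_sum (f := fun l => x j l ^ 2) (fun _ _ => sq_nonneg _) (Finset.mem_univ l)).trans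
    (Finset.single_le_sum (f := fun j => ∑ l, x j l ^ 2)
      (fun _ _ => Finset.sum_nonneg fun _ _ => sq_nonneg _) (Finset.mem_univ j))

theorem truncWeight_eq_zero {A : Set (Config n K)} {t : ℝ} {R : Matrix (Fin K) (Fin K) ℝ} :
    ∀ x ∉ A, ∀ y, truncWeight p A t R x y = 0 := fun x hx y => by
  simp [truncWeight, hx]

/-- The posterior weight as a function of the effective field on the rows. -/
def fieldWeight (p : ℕ) {n K : ℕ} (A : Set (Config n K)) (t : ℝ) (P : Matrix (Fin K) (Fin K) ℝ)
    (x : Config n K) (z : Noise p n K) : ℝ :=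
  A.indicator (fun _ => 1) x * (tensorTilt (tensorSignal p t x) z.1
    * Real.exp ((∑ j, x j ⬝ᵥ z.2 j) - (∑ j, x j ⬝ᵥ P *ᵥ x j) / 2))

theorem measurable_fieldWeight {A : Set (Config n K)} (hA : MeasurableSet A) (t : ℝ)
    (P : Matrix (Fin K) (Fin K) ℝ) : Measurable (Function.uncurry (fieldWeight p A t P)) := by
  refine ((measurable_const.indicator hA).comp measurable_fst).mul (Measurable.mul ?_ ?_)
  · exact measurable_tensorTilt.comp
      (f := fun z : Config n K × Noise p n K => (tensorSignal p t z.1, z.2.1))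
      (((measurable_tensorSignal t).comp measurable_fst).prodMk
        (measurable_fst.comp measurable_snd))
  · simp only [Matrix.mulVec, dotProduct]; fun_prop

theorem measurable_wInt_fieldWeight {μ : Measure (Config n K)} [SFinite μ] {A : Set (Config n K)}
    (hA : MeasurableSet A) (t : ℝ) (P : Matrix (Fin K) (Fin K) ℝ) {f : Config n K → ℝ}
    (hf : Measurable f) : Measurable (wInt μ (fieldWeight p A t P) f) := by
  have h : Measurable (Function.uncurry fun (y : Noise p n K) (x : Config n K) =>
      f x * fieldWeight p A t P x y) :=
    (hf.comp measurable_snd).mul ((measurable_fieldWeight hA t P).comp measurable_swap)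
  exact h.stronglyMeasurable.integral_prod_right.measurable

theorem sum_mulVec_dotProduct (M : Matrix (Fin K) (Fin K) ℝ) (hM : Mᵀ = M) (x y : Config n K) :
    ∑ j, (M *ᵥ x j) ⬝ᵥ y j = ∑ j, x j ⬝ᵥ M *ᵥ y j :=
  Finset.sum_congr rfl fun j _ => by
    rw [Matrix.dotProduct_mulVec, ← Matrix.mulVec_transpose, hM]

/-- The side noise enters only through the field `√R ξ_j`, whose law is determined by its covariance
`R`. -/
theorem truncWeight_eq_fieldWeight (A : Set (Config n K)) {t : ℝ} (ht : t ≤ 1)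
    {R : Matrix (Fin K) (Fin K) ℝ} (hR : R.PosSemidef) (x : Config n K) (y : Noise p n K) :
    truncWeight p A t R x y = fieldWeight p A t R x (y.1, fun j => matSqrt R *ᵥ y.2 j) := by
  rw [truncWeight, fieldWeight, gibbsWeight_eq ht hR, gaussianTilt]
  simp only [sideSignal, matSqrt_mulVec_dotProduct_self hR]
  rw [sum_mulVec_dotProduct _ (transpose_matSqrt R)]

/-- Exponents add: the two fields sum and the quadratic forms combine to `R + s² S`. Off `A` both
sides vanish. -/
theorem tiltedWeight_eq_fieldWeight (A : Set (Config n K)) {t : ℝ} (ht : t ≤ 1)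
    {R S : Matrix (Fin K) (Fin K) ℝ} (hR : R.PosSemidef) (hS : S.PosSemidef) (s : ℝ)
    (x : Config n K) (z : Noise p n K × Config n K) :
    tiltedWeight (truncWeight p A t R) (A.indicator (sideSignal S)) s x z
      = fieldWeight p A t (R + s ^ 2 • S) x
          (z.1.1, fun j => matSqrt R *ᵥ z.1.2 j + (s • matSqrt S) *ᵥ z.2 j) := by
  by_cases hx : x ∈ A
  swap
  · simp [tiltedWeight, truncWeight, fieldWeight, hx]
  rw [tiltedWeight, truncWeight_eq_fieldWeight A ht hR, fieldWeight, fieldWeight,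
    indicator_of_mem hx, indicator_of_mem hx, gaussianTilt_smul, mul_assoc, mul_assoc,
    ← Real.exp_add]
  congr 3
  simp only [sideSignal, matSqrt_mulVec_dotProduct_self hS]
  rw [sum_mulVec_dotProduct _ (transpose_matSqrt S)]
  simp only [dotProduct_add, Matrix.add_mulVec, Finset.sum_add_distrib, Matrix.smul_mulVec,
    dotProduct_smul, smul_eq_mul, ← Finset.mul_sum]
  ring

theorem map_side_noiseLaw {A B C : Matrix (Fin K) (Fin K) ℝ} (h : A * Aᵀ = B * Bᵀ + C * Cᵀ) :
    (noiseLaw p n K).map (fun y => (y.1, fun j => A *ᵥ y.2 j))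
      = ((noiseLaw p n K).prod (gaussianArray n K)).map
        (fun z => (z.1.1, fun j => B *ᵥ z.1.2 j + C *ᵥ z.2 j)) := by
  have hmul : ∀ M : Matrix (Fin K) (Fin K) ℝ,
      Measurable fun (y : Config n K) (j : Fin n) => M *ᵥ y j := fun M => by
    refine measurable_pi_lambda _ fun j => measurable_pi_lambda _ fun k => ?_
    simp only [Matrix.mulVec, dotProduct]; fun_prop
  have hm : Measurable fun (z : Config n K × Config n K) (j : Fin n) =>
      B *ᵥ z.1 j + C *ᵥ z.2 j :=
    ((hmul B).comp measurable_fst).add ((hmul C).comp measurable_snd)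
  have e1 := Measure.map_prod_map (tensorNoise p n) (gaussianArray n K) measurable_id (hmul A)
  have e2 := Measure.map_prod_map (tensorNoise p n) ((gaussianArray n K).prod (gaussianArray n K))
    measurable_id hm
  rw [map_mulVec_gaussianArray h, e2, ← Measure.prodAssoc_prod,
    Measure.map_map (measurable_id.prodMap hm) MeasurableEquiv.prodAssoc.measurable] at e1
  exact e1.symm

/-- Strengthening the side channel by `s² S` amounts to an extra observation of `s √S x`. -/
theorem meanProd_truncWeight_add {μ : Measure (Config n K)} [SFinite μ] {A : Set (Config n K)}
    (hA : MeasurableSet A) {t : ℝ} (ht : t ≤ 1) {R S : Matrix (Fin K) (Fin K) ℝ}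
    (hR : R.PosSemidef) (hS : S.PosSemidef) (s : ℝ) {f g : Config n K → ℝ} (hf : Measurable f)
    (hg : Measurable g) :
    meanProd μ (noiseLaw p n K) (truncWeight p A t (R + s ^ 2 • S)) f g
      = meanProd μ ((noiseLaw p n K).prod (gaussianArray n K))
          (tiltedWeight (truncWeight p A t R) (A.indicator (sideSignal S)) s) f g := by
  have hRS : (R + s ^ 2 • S).PosSemidef := hR.add (hS.smul (sq_nonneg s))
  set P := R + s ^ 2 • S with hP
  -- Both means integrate the same function of the field, built from `V`; by `hlaw` the field has
  -- the same law on the two noise spaces.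
  set V := fieldWeight p A t P
  have hlaw := map_side_noiseLaw (p := p) (n := n) (A := matSqrt P) (B := matSqrt R)
    (C := s • matSqrt S) (by
      rw [Matrix.transpose_smul, transpose_matSqrt, transpose_matSqrt, transpose_matSqrt,
        matSqrt_mul_self hRS, matSqrt_mul_self hR, smul_mul_smul_comm, matSqrt_mul_self hS, hP,
        pow_two])
  have hmul : ∀ M : Matrix (Fin K) (Fin K) ℝ,
      Measurable fun (y : Config n K) (j : Fin n) => M *ᵥ y j := fun M => by
    refine measurable_pi_lambda _ fun j => measurable_pi_lambda _ fun k => ?_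
    simp only [Matrix.mulVec, dotProduct]; fun_prop
  have hm1 : Measurable fun y : Noise p n K => (y.1, fun j => matSqrt P *ᵥ y.2 j) :=
    measurable_fst.prodMk ((hmul _).comp measurable_snd)
  have hm2 : Measurable fun z : Noise p n K × Config n K =>
      (z.1.1, fun j => matSqrt R *ᵥ z.1.2 j + (s • matSqrt S) *ᵥ z.2 j) :=
    (measurable_fst.comp measurable_fst).prodMk
      (((hmul (matSqrt R)).comp (measurable_snd.comp measurable_fst)).add
        ((hmul (s • matSqrt S)).comp measurable_snd))
  have hΨ : Measurable fun z => wInt μ V f z * wInt μ V g z / wInt μ V (fun _ => 1) z :=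
    ((measurable_wInt_fieldWeight hA t P hf).mul (measurable_wInt_fieldWeight hA t P hg)).div
      (measurable_wInt_fieldWeight hA t P measurable_const)
  have e1 := integral_map (μ := noiseLaw p n K) hm1.aemeasurable hΨ.aestronglyMeasurable
  have e2 := integral_map (μ := (noiseLaw p n K).prod (gaussianArray n K)) hm2.aemeasurable
    hΨ.aestronglyMeasurable
  rw [hlaw, e2] at e1
  simp only [meanProd, wInt, truncWeight_eq_fieldWeight A ht hRS,
    tiltedWeight_eq_fieldWeight A ht hR hS]
  exact e1.symm

end TensorInterp

end

noncomputable section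

namespace TensorInterp

open Filter Topology

variable {p n K : ℕ} {μ : Measure (Config n K)} [IsFiniteMeasure μ]

/-! ### Continuity in time and in the side channel. -/

section Continuity

/-- Dominated convergence along neighbourhoods needs countably generated filters; the property is
transferred from the underlying function space. -/
instance : FirstCountableTopology (Matrix (Fin K) (Fin K) ℝ) :=
  inferInstanceAs (FirstCountableTopology (Fin K → Fin K → ℝ))

variable {A : Set (Config n K)} {f g k l q : Config n K → ℝ}

theorem tendsto_truncWeight {t : ℝ} {R : Matrix (Fin K) (Fin K) ℝ}
    (ht : t ∈ Icc (0 : ℝ) 1) (hR : R.PosSemidef) (x : Config n K) (y : Noise p n K) :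
    Tendsto (fun a : (Icc (0 : ℝ) 1 ×ˢ {R : Matrix (Fin K) (Fin K) ℝ | R.PosSemidef} :
        Set (ℝ × Matrix (Fin K) (Fin K) ℝ)) => truncWeight p A a.1.1 a.1.2 x y)
      (𝓝 ⟨(t, R), ht, hR⟩) (𝓝 (truncWeight p A t R x y)) := by
  have h := continuousOn_iff_continuous_domRestrict.1 (continuousOn_gibbsWeight (p := p) x y)
  exact (h.tendsto ⟨(t, R), ht, hR⟩).const_mul _

theorem continuousOn_meanProd (hA : MeasurableSet A) (hμ : μ A ≠ 0) (hf : Measurable f)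
    (hg : Measurable g) (hq : Integrable q μ) (hfq : ∀ x, f x ^ 2 ≤ q x)
    (hgq : ∀ x, g x ^ 2 ≤ q x) :
    ContinuousOn (fun a : ℝ × Matrix (Fin K) (Fin K) ℝ =>
      meanProd μ (noiseLaw p n K) (truncWeight p A a.1 a.2) f g)
      (Icc 0 1 ×ˢ {R | R.PosSemidef}) := by
  refine continuousOn_iff_continuous_domRestrict.2 (continuous_iff_continuousAt.2 fun a => ?_)
  obtain ⟨⟨t, R⟩, ht, hR⟩ := a
  refine IsWeight.tendsto_integral_wInt_mul_div (B := noiseBound)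
    (fun a => isWeight_truncWeight hA a.2.1.2 a.2.2) (isWeight_truncWeight hA ht.2 hR)
    (fun x y => tendsto_truncWeight ht hR x y) (fun x => ?_)
    (fun y => (wInt_truncWeight_pos hA hμ ht.2 hR y).ne') hf hg hq hfq hgq
  rw [integral_truncWeight A ht.2 hR]
  exact tendsto_const_nhds.congr fun a => (integral_truncWeight A a.2.1.2 a.2.2 x).symm

theorem continuousOn_meanCov (hA : MeasurableSet A) (hμ : μ A ≠ 0) (hf : Measurable f)
    (hk : Measurable k) (hg : Measurable g) (hl : Measurable l) (hqm : Measurable q)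
    (hq2 : Integrable (fun x => q x ^ 2) μ)
    (hfq : ∀ x, f x ^ 2 ≤ q x) (hkq : ∀ x, k x ^ 2 ≤ q x)
    (hgq : ∀ x, g x ^ 2 ≤ q x) (hlq : ∀ x, l x ^ 2 ≤ q x) :
    ContinuousOn (fun a : ℝ × Matrix (Fin K) (Fin K) ℝ =>
      meanCov μ (noiseLaw p n K) (truncWeight p A a.1 a.2) f k g l)
      (Icc 0 1 ×ˢ {R | R.PosSemidef}) := by
  refine continuousOn_iff_continuous_domRestrict.2 (continuous_iff_continuousAt.2 fun a => ?_)
  obtain ⟨⟨t, R⟩, ht, hR⟩ := a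
  refine IsWeight.tendsto_integral_wCov_mul_div (B := noiseBound)
    (fun a => isWeight_truncWeight hA a.2.1.2 a.2.2) (isWeight_truncWeight hA ht.2 hR)
    (fun x y => tendsto_truncWeight ht hR x y) (fun x => ?_)
    (fun y => (wInt_truncWeight_pos hA hμ ht.2 hR y).ne') hf hg hk hl hqm hq2 hfq hgq hkq hlq
  rw [integral_truncWeight A ht.2 hR]
  exact tendsto_const_nhds.congr fun a => (integral_truncWeight A a.2.1.2 a.2.2 x).symm

theorem abs_meanCov_le (hA : MeasurableSet A) {t : ℝ} (ht : t ≤ 1)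
    {R : Matrix (Fin K) (Fin K) ℝ} (hR : R.PosSemidef) (hf : Measurable f)
    (hk : Measurable k) (hg : Measurable g) (hl : Measurable l) (hqm : Measurable q)
    (hq2 : Integrable (fun x => q x ^ 2) μ)
    (hfq : ∀ x, f x ^ 2 ≤ q x) (hkq : ∀ x, k x ^ 2 ≤ q x)
    (hgq : ∀ x, g x ^ 2 ≤ q x) (hlq : ∀ x, l x ^ 2 ≤ q x) :
    |meanCov μ (noiseLaw p n K) (truncWeight p A t R) f k g l| ≤ 4 * ∫ x, q x ^ 2 ∂μ := by
  have h := isWeight_truncWeight (p := p) hA ht hR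
  have := norm_integral_le_of_norm_le (f := fun y =>
    wCov μ (truncWeight p A t R) f k y * wCov μ (truncWeight p A t R) g l y
      / wInt μ (truncWeight p A t R) (fun _ => 1) y) ((h.integrable_wInt hq2).const_mul 4)
    (.of_forall fun y => h.abs_wCov_mul_div_le hf hg hk hl hqm hq2 hfq hgq hkq hlq y)
  refine this.trans ?_
  rw [integral_const_mul]
  exact mul_le_mul_of_nonneg_left (h.integral_wInt_le hq2 fun x => sq_nonneg _) (by norm_num)

end Continuity

/-! ### Restriction of the prior to boxes and its removal. -/

section Truncation

/-- The arrays with entries bounded by `N`. -/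
def box (n K : ℕ) (N : ℕ) : Set (Config n K) := {x | ∀ j l, |x j l| ≤ N}

theorem measurableSet_box (N : ℕ) : MeasurableSet (box n K N) := by
  have e : box n K N = ⋂ j, ⋂ l, {x : Config n K | |x j l| ≤ (N : ℝ)} := by ext x; simp [box]
  rw [e]
  refine MeasurableSet.iInter fun j => MeasurableSet.iInter fun l => ?_
  exact measurableSet_le (by fun_prop) measurable_const

theorem eventually_mem_box (x : Config n K) : ∀ᶠ N in atTop, x ∈ box n K N := by
  simp only [box, mem_ofPred_eq, eventually_all]
  intro j l
  obtain ⟨N, hN⟩ := exists_nat_ge |x j l|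
  filter_upwards [eventually_ge_atTop N] with M hM
  exact hN.trans (by exact_mod_cast hM)

theorem tendsto_truncWeight_box {t : ℝ} {R : Matrix (Fin K) (Fin K) ℝ} (x : Config n K)
    (y : Noise p n K) :
    Tendsto (fun N => truncWeight p (box n K N) t R x y) atTop (𝓝 (gibbsWeight p t R x y)) :=
  tendsto_const_nhds.congr' (by
    filter_upwards [eventually_mem_box x] with N hN
    simp [truncWeight, hN])

theorem eventually_measure_box_ne_zero {ν : Measure (Config n K)} (hν : ν ≠ 0) : ∀ᶠ N in atTop, ν (box n K N) ≠ 0 := by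
  have hmono : Monotone (box n K) := fun M N h x hx j l => (hx j l).trans (by exact_mod_cast h)
  have hU : ⋃ N, box n K N = univ := by
    ext x
    simpa using (eventually_mem_box x).exists
  have h := tendsto_measure_iUnion_atTop (μ := ν) hmono
  rw [hU] at h
  exact h.eventually_ne (by simpa using hν)

theorem tendsto_integral_truncWeight_box {t : ℝ} (ht : t ≤ 1) {R : Matrix (Fin K) (Fin K) ℝ}
    (hR : R.PosSemidef) (x : Config n K) :
    Tendsto (fun N => ∫ y, truncWeight p (box n K N) t R x y ∂(noiseLaw p n K)) atTop
      (𝓝 (∫ y, gibbsWeight p t R x y ∂(noiseLaw p n K))) := by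
  rw [(integrable_gibbsWeight ht hR x).2]
  refine tendsto_const_nhds.congr' ?_
  filter_upwards [eventually_mem_box x] with N hN
  rw [integral_truncWeight _ ht hR, indicator_of_mem hN]

theorem isWeight_gibbsWeight {t : ℝ} (ht : t ≤ 1) {R : Matrix (Fin K) (Fin K) ℝ}
    (hR : R.PosSemidef) : IsWeight (noiseLaw p n K) (gibbsWeight p t R) noiseBound :=
  truncWeight_univ (p := p) (n := n) t R ▸ isWeight_truncWeight MeasurableSet.univ ht hR

theorem wInt_gibbsWeight_pos (hμ : μ ≠ 0) {t : ℝ} (ht : t ≤ 1) {R : Matrix (Fin K) (Fin K) ℝ}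
    (hR : R.PosSemidef) (y : Noise p n K) : 0 < wInt μ (gibbsWeight p t R) (fun _ => 1) y :=
  truncWeight_univ (p := p) (n := n) t R ▸
    wInt_truncWeight_pos MeasurableSet.univ (by simpa using hμ) ht hR y

variable {f g k l q : Config n K → ℝ}

theorem tendsto_meanProd_box (hμ : μ ≠ 0) {t : ℝ} (ht : t ≤ 1) {R : Matrix (Fin K) (Fin K) ℝ}
    (hR : R.PosSemidef) (hf : Measurable f) (hg : Measurable g) (hq : Integrable q μ)
    (hfq : ∀ x, f x ^ 2 ≤ q x) (hgq : ∀ x, g x ^ 2 ≤ q x) :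
    Tendsto (fun N => meanProd μ (noiseLaw p n K) (truncWeight p (box n K N) t R) f g) atTop
      (𝓝 (meanProd μ (noiseLaw p n K) (gibbsWeight p t R) f g)) :=
  IsWeight.tendsto_integral_wInt_mul_div (B := noiseBound)
    (fun N => isWeight_truncWeight (measurableSet_box N) ht hR) (isWeight_gibbsWeight ht hR)
    (fun x y => tendsto_truncWeight_box x y) (fun x => tendsto_integral_truncWeight_box ht hR x)
    (fun y => (wInt_gibbsWeight_pos hμ ht hR y).ne') hf hg hq hfq hgq

theorem tendsto_meanCov_box (hμ : μ ≠ 0) {t : ℝ} (ht : t ≤ 1) {R : Matrix (Fin K) (Fin K) ℝ}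
    (hR : R.PosSemidef) (hf : Measurable f)
    (hk : Measurable k) (hg : Measurable g) (hl : Measurable l) (hqm : Measurable q)
    (hq2 : Integrable (fun x => q x ^ 2) μ)
    (hfq : ∀ x, f x ^ 2 ≤ q x) (hkq : ∀ x, k x ^ 2 ≤ q x)
    (hgq : ∀ x, g x ^ 2 ≤ q x) (hlq : ∀ x, l x ^ 2 ≤ q x) :
    Tendsto (fun N => meanCov μ (noiseLaw p n K) (truncWeight p (box n K N) t R) f k g l) atTop
      (𝓝 (meanCov μ (noiseLaw p n K) (gibbsWeight p t R) f k g l)) :=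
  IsWeight.tendsto_integral_wCov_mul_div (B := noiseBound)
    (fun N => isWeight_truncWeight (measurableSet_box N) ht hR) (isWeight_gibbsWeight ht hR)
    (fun x y => tendsto_truncWeight_box x y) (fun x => tendsto_integral_truncWeight_box ht hR x)
    (fun y => (wInt_gibbsWeight_pos hμ ht hR y).ne') hf hg hk hl hqm hq2 hfq hgq hkq hlq

end Truncation

end TensorInterp

end

noncomputable section

/-! ### Derivative of mean products along positive semidefinite directions. -/

namespace TensorInterp

open Filter Topology

variable {p n K : ℕ} {μ : Measure (Config n K)} [IsFiniteMeasure μ]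

/-- The derivative of the mean product of the posterior means of `f` and `g` along the direction `S`
of the side channel. -/
def covForm (μ : Measure (Config n K)) (w : Config n K → Noise p n K → ℝ)
    (S : Matrix (Fin K) (Fin K) ℝ) (f g : Config n K → ℝ) : ℝ :=
  ∑ i, ∑ a, ∑ b, S a b * meanCov μ (noiseLaw p n K) w f (fun x => x i a) g (fun x => x i b)

theorem measurable_coord (j : Fin n) (l : Fin K) : Measurable fun x : Config n K => x j l := by
  fun_prop

theorem integrable_sqSum (hq2 : Integrable (fun x : Config n K => sqSum x ^ 2) μ) :
    Integrable (sqSum : Config n K → ℝ) μ :=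
  integrable_of_sq_le measurable_sqSum hq2 fun _ => le_rfl

/-- Covariances are linear in the side signal, and `(√S u) · (√S v) = u · S v`; the square root
disappears and the limit of the tilting expansion becomes linear in `S`. -/
theorem integral_sum_wCov_sideSignal (hq2 : Integrable (fun x : Config n K => sqSum x ^ 2) μ)
    {A : Set (Config n K)} (hA : MeasurableSet A) {t : ℝ} (ht : t ≤ 1)
    {R S : Matrix (Fin K) (Fin K) ℝ} (hR : R.PosSemidef) (hS : S.PosSemidef)
    {f g : Config n K → ℝ} (hf : Measurable f) (hg : Measurable g)
    (hfq : ∀ x, f x ^ 2 ≤ sqSum x) (hgq : ∀ x, g x ^ 2 ≤ sqSum x) :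
    ∫ y, (∑ j, ∑ k, wCov μ (truncWeight p A t R) f (fun x => sideSignal S x j k) y
        * wCov μ (truncWeight p A t R) g (fun x => sideSignal S x j k) y)
      / wInt μ (truncWeight p A t R) (fun _ => 1) y ∂(noiseLaw p n K)
      = covForm μ (truncWeight p A t R) S f g := by
  set w := truncWeight p A t R
  have h : IsWeight (noiseLaw p n K) w noiseBound := isWeight_truncWeight hA ht hR
  have hq := integrable_sqSum hq2
  have hi : ∀ (j : Fin n) (l : Fin K), Integrable (fun x : Config n K => x j l) μ := fun j l =>
    integrable_of_sq_le (measurable_coord j l) hq fun x => sq_le_sqSum x j l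
  have hcov : ∀ {f : Config n K → ℝ}, Measurable f → (∀ x, f x ^ 2 ≤ sqSum x) → ∀ j k y,
      wCov μ w f (fun x => sideSignal S x j k) y
        = (matSqrt S *ᵥ fun a => wCov μ w f (fun x => x j a) y) k := fun {f} hf hfq j k y => by
    have := h.wCov_sum_right (f := f) (g := fun a x => x j a) Finset.univ (matSqrt S k)
      (fun a => hi j a) (fun a => hq.mono' (hf.mul (measurable_coord j a)).aestronglyMeasurable
        (.of_forall fun x => abs_mul_le_of_sq_le (hfq x) (sq_le_sqSum x j a))) y
    exact this
  have hterm : ∀ i a b, Integrable (fun y => wCov μ w f (fun x => x i a) y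
      * wCov μ w g (fun x => x i b) y / wInt μ w (fun _ => 1) y) (noiseLaw p n K) := fun i a b => by
    refine ((h.integrable_wInt hq2).const_mul 4).mono' ?_ (.of_forall fun y =>
      h.abs_wCov_mul_div_le hf hg (measurable_coord i a) (measurable_coord i b) measurable_sqSum
        hq2 hfq hgq (fun x => sq_le_sqSum x i a) (fun x => sq_le_sqSum x i b) y)
    exact (((h.measurable_wCov hf (measurable_coord i a)).mul
      (h.measurable_wCov hg (measurable_coord i b))).div
      (h.measurable_wInt measurable_const)).aestronglyMeasurable
  have hpt : ∀ y, (∑ j, ∑ k, wCov μ w f (fun x => sideSignal S x j k) y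
        * wCov μ w g (fun x => sideSignal S x j k) y) / wInt μ w (fun _ => 1) y
      = ∑ i, ∑ a, ∑ b, S a b * (wCov μ w f (fun x => x i a) y
        * wCov μ w g (fun x => x i b) y / wInt μ w (fun _ => 1) y) := fun y => by
    rw [Finset.sum_div]
    refine Finset.sum_congr rfl fun j _ => ?_
    simp only [hcov hf hfq, hcov hg hgq]
    have := matSqrt_mulVec_dotProduct hS (fun a => wCov μ w f (fun x => x j a) y)
      (fun a => wCov μ w g (fun x => x j a) y)
    rw [dotProduct] at this
    rw [this]
    simp only [dotProduct, Matrix.mulVec, Finset.mul_sum, Finset.sum_div]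
    exact Finset.sum_congr rfl fun a _ => Finset.sum_congr rfl fun b _ => by ring
  simp only [hpt, covForm, meanCov]
  refine (integral_finsetSum _ fun i _ => integrable_finsetSum _ fun a _ =>
    integrable_finsetSum _ fun b _ => (hterm i a b).const_mul _).trans ?_
  refine Finset.sum_congr rfl fun i _ => ?_
  refine (integral_finsetSum _ fun a _ => integrable_finsetSum _ fun b _ =>
    (hterm i a b).const_mul _).trans ?_
  refine Finset.sum_congr rfl fun a _ => ?_
  refine (integral_finsetSum _ fun b _ => (hterm i a b).const_mul _).trans ?_
  exact Finset.sum_congr rfl fun b _ => integral_const_mul _ _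

/-- The right derivative of the mean product of posterior means of entries, for a bounded prior. -/
theorem tendsto_meanProd_box_sub_div (hq2 : Integrable (fun x : Config n K => sqSum x ^ 2) μ) {N : ℕ}
    (hμ : μ (box n K N) ≠ 0) {t : ℝ} (ht : t ≤ 1) {R S : Matrix (Fin K) (Fin K) ℝ}
    (hR : R.PosSemidef) (hS : S.PosSemidef) (j : Fin n) (l l' : Fin K) :
    Tendsto (fun s : ℝ => (meanProd μ (noiseLaw p n K) (truncWeight p (box n K N) t (R + s ^ 2 • S))
          (fun x => x j l) (fun x => x j l')
        - meanProd μ (noiseLaw p n K) (truncWeight p (box n K N) t R)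
          (fun x => x j l) (fun x => x j l')) / s ^ 2) (𝓝[>] 0)
      (𝓝 (covForm μ (truncWeight p (box n K N) t R) S (fun x => x j l) (fun x => x j l'))) := by
  set A := box n K N
  have hA : MeasurableSet A := measurableSet_box N
  -- One constant bounding on the box both the coordinates and every entry of `√S x_j`.
  set c : ℝ := N + ∑ k, ∑ a, |matSqrt S k a| * N with hc
  have hs0 : 0 ≤ ∑ k, ∑ a, |matSqrt S k a| * (N : ℝ) := by positivity
  have hc0 : 0 ≤ c := by positivity
  have hcoord : ∀ (j : Fin n) (l : Fin K) x, |A.indicator (fun x : Config n K => x j l) x| ≤ c :=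
    fun j l x => by
      by_cases hx : x ∈ A
      · rw [indicator_of_mem hx]
        exact (hx j l).trans (by linarith)
      · simpa [hx] using hc0
  have hθc : ∀ x j k, |A.indicator (sideSignal S) x j k| ≤ c := fun x j k => by
    by_cases hx : x ∈ A
    · rw [indicator_of_mem hx]
      calc |sideSignal S x j k| ≤ ∑ a, |matSqrt S k a * x j a| :=
            Finset.abs_sum_le_sum_abs (fun a => matSqrt S k a * x j a) Finset.univ
        _ ≤ ∑ a, |matSqrt S k a| * N := Finset.sum_le_sum fun a _ => by
            rw [abs_mul]; exact mul_le_mul_of_nonneg_left (hx j a) (abs_nonneg _)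
        _ ≤ ∑ k, ∑ a, |matSqrt S k a| * (N : ℝ) :=
            Finset.single_le_sum (f := fun k => ∑ a, |matSqrt S k a| * (N : ℝ))
              (fun k _ => by positivity) (Finset.mem_univ k)
        _ ≤ c := by rw [hc]; linarith [(Nat.cast_nonneg N : (0 : ℝ) ≤ N)]
    · simpa [hx] using hc0
  have h := (isWeight_truncWeight (p := p) hA ht hR).tendsto_tilted_sub_div_sq (μ := μ)
    ((measurable_sideSignal S).indicator hA) hc0 hθc ((measurable_coord j l).indicator hA)
    ((measurable_coord j l').indicator hA) (hcoord j l) (hcoord j l')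
    (wInt_truncWeight_pos hA hμ ht hR)
  have hw : ∀ x ∉ A, ∀ y, truncWeight p A t R x y = 0 := truncWeight_eq_zero
  have e : ∀ j k, (fun x => A.indicator (sideSignal S) x j k)
      = A.indicator fun x => sideSignal S x j k := fun j k => by
    ext x
    by_cases hx : x ∈ A <;> simp [hx]
  have hw2 : ∀ s : ℝ, ∀ x ∉ A, ∀ y,
      tiltedWeight (truncWeight p A t R) (A.indicator (sideSignal S)) s x y = 0 :=
    fun s x hx y => by rw [tiltedWeight, hw x hx, zero_mul]
  simp only [e, wCov_indicator hw, wInt_indicator hw, wInt_indicator (hw2 _)] at h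
  rw [integral_sum_wCov_sideSignal hq2 hA ht hR hS (measurable_coord j l) (measurable_coord j l')
    (fun x => sq_le_sqSum x j l) (fun x => sq_le_sqSum x j l')] at h
  refine h.congr fun s => ?_
  rw [meanProd_truncWeight_add hA ht hR hS s (measurable_coord j l) (measurable_coord j l')]
  rfl

/-- The expansion at base point `R + u S` is read with `s = √(v - u)`, so quotients by `s²` are
slopes. Extra observations can only be added, which gives a right derivative. -/
theorem hasDerivWithinAt_meanProd_box (hq2 : Integrable (fun x : Config n K => sqSum x ^ 2) μ)
    {N : ℕ} (hμ : μ (box n K N) ≠ 0) {t : ℝ} (ht : t ≤ 1) {R S : Matrix (Fin K) (Fin K) ℝ}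
    (hR : R.PosSemidef) (hS : S.PosSemidef) (j : Fin n) (l l' : Fin K) {u : ℝ} (hu : 0 ≤ u) :
    HasDerivWithinAt (fun u : ℝ => meanProd μ (noiseLaw p n K)
        (truncWeight p (box n K N) t (R + u • S)) (fun x => x j l) (fun x => x j l'))
      (covForm μ (truncWeight p (box n K N) t (R + u • S)) S (fun x => x j l) (fun x => x j l'))
      (Ioi u) u := by
  rw [hasDerivWithinAt_iff_tendsto_slope' (notMem_Ioi.2 le_rfl)]
  have h := tendsto_meanProd_box_sub_div (p := p) hq2 hμ ht (hR.add (hS.smul hu)) hS j l l'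
  have hsq : Tendsto (fun v => √(v - u)) (𝓝[>] u) (𝓝[>] 0) := by
    refine tendsto_nhdsWithin_iff.2 ⟨?_, ?_⟩
    · have : Continuous fun v : ℝ => √(v - u) := by fun_prop
      simpa using (this.tendsto u).mono_left nhdsWithin_le_nhds
    · filter_upwards [self_mem_nhdsWithin] with v hv using Real.sqrt_pos.2 (sub_pos.2 hv)
  refine (h.comp hsq).congr' ?_
  filter_upwards [self_mem_nhdsWithin] with v hv
  have hv' : 0 ≤ v - u := (sub_pos.2 hv).le
  rw [Function.comp_apply, Real.sq_sqrt hv', slope_def_field, add_assoc, ← add_smul,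
    add_sub_cancel]

theorem continuousOn_add_smul {t : ℝ} (ht : t ∈ Icc (0 : ℝ) 1) {R S : Matrix (Fin K) (Fin K) ℝ}
    (hR : R.PosSemidef) (hS : S.PosSemidef)
    {F : ℝ × Matrix (Fin K) (Fin K) ℝ → ℝ} (hF : ContinuousOn F (Icc 0 1 ×ˢ {R | R.PosSemidef})) :
    ContinuousOn (fun u : ℝ => F (t, R + u • S)) (Icc 0 1) := by
  refine hF.comp (f := fun u : ℝ => (t, R + u • S)) (Continuous.continuousOn ?_)
    fun u hu => ⟨ht, hR.add (hS.smul hu.1)⟩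
  exact continuous_const.prodMk (continuous_const.add (continuous_id.smul continuous_const))

theorem continuousOn_covForm (hq2 : Integrable (fun x : Config n K => sqSum x ^ 2) μ)
    {A : Set (Config n K)} (hA : MeasurableSet A) (hμ : μ A ≠ 0) (S : Matrix (Fin K) (Fin K) ℝ)
    (j : Fin n) (l l' : Fin K) :
    ContinuousOn (fun a : ℝ × Matrix (Fin K) (Fin K) ℝ =>
      covForm μ (truncWeight p A a.1 a.2) S (fun x => x j l) (fun x => x j l'))
      (Icc 0 1 ×ˢ {R | R.PosSemidef}) := by
  unfold covForm
  refine continuousOn_finsetSum _ fun i _ => continuousOn_finsetSum _ fun a _ =>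
    continuousOn_finsetSum _ fun b _ => continuousOn_const.mul ?_
  exact continuousOn_meanCov hA hμ (measurable_coord j l) (measurable_coord i a)
    (measurable_coord j l') (measurable_coord i b) measurable_sqSum hq2
    (fun x => sq_le_sqSum x j l) (fun x => sq_le_sqSum x i a) (fun x => sq_le_sqSum x j l')
    (fun x => sq_le_sqSum x i b)

theorem abs_covForm_le (hq2 : Integrable (fun x : Config n K => sqSum x ^ 2) μ)
    {A : Set (Config n K)} (hA : MeasurableSet A) {t : ℝ} (ht : t ≤ 1)
    {R : Matrix (Fin K) (Fin K) ℝ} (hR : R.PosSemidef) (S : Matrix (Fin K) (Fin K) ℝ)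
    (j : Fin n) (l l' : Fin K) :
    |covForm μ (truncWeight p A t R) S (fun x => x j l) (fun x => x j l')|
      ≤ n * (∑ a, ∑ b, |S a b|) * (4 * ∫ x, sqSum x ^ 2 ∂μ) := by
  have hsum : ∑ _i : Fin n, ∑ a, ∑ b, |S a b| * (4 * ∫ x, sqSum x ^ 2 ∂μ)
      = n * (∑ a, ∑ b, |S a b|) * (4 * ∫ x, sqSum x ^ 2 ∂μ) := by
    simp only [Finset.sum_const, Finset.card_univ, Fintype.card_fin, nsmul_eq_mul,
      ← Finset.sum_mul, mul_assoc]
  rw [← hsum, covForm]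
  refine (Finset.abs_sum_le_sum_abs _ _).trans (Finset.sum_le_sum fun i _ => ?_)
  refine (Finset.abs_sum_le_sum_abs _ _).trans (Finset.sum_le_sum fun a _ => ?_)
  refine (Finset.abs_sum_le_sum_abs _ _).trans (Finset.sum_le_sum fun b _ => ?_)
  rw [abs_mul]
  exact mul_le_mul_of_nonneg_left (abs_meanCov_le hA ht hR (measurable_coord j l)
    (measurable_coord i a) (measurable_coord j l') (measurable_coord i b) measurable_sqSum hq2
    (fun x => sq_le_sqSum x j l) (fun x => sq_le_sqSum x i a) (fun x => sq_le_sqSum x j l')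
    (fun x => sq_le_sqSum x i b)) (abs_nonneg _)

/-- The fundamental theorem of calculus needs only continuity and right derivatives. -/
theorem integral_covForm_box (hq2 : Integrable (fun x : Config n K => sqSum x ^ 2) μ)
    {N : ℕ} (hμ : μ (box n K N) ≠ 0) {t : ℝ} (ht : t ∈ Icc (0 : ℝ) 1)
    {R S : Matrix (Fin K) (Fin K) ℝ} (hR : R.PosSemidef) (hS : S.PosSemidef) (j : Fin n)
    (l l' : Fin K) :
    ∫ u in (0 : ℝ)..1, covForm μ (truncWeight p (box n K N) t (R + u • S)) S
        (fun x => x j l) (fun x => x j l')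
      = meanProd μ (noiseLaw p n K) (truncWeight p (box n K N) t (R + S))
          (fun x => x j l) (fun x => x j l')
        - meanProd μ (noiseLaw p n K) (truncWeight p (box n K N) t R)
          (fun x => x j l) (fun x => x j l') := by
  have hA := measurableSet_box (n := n) (K := K) N
  have h := intervalIntegral.integral_eq_sub_of_hasDeriv_right (a := (0 : ℝ)) (b := 1)
    (f := fun u : ℝ => meanProd μ (noiseLaw p n K) (truncWeight p (box n K N) t (R + u • S))
      (fun x => x j l) (fun x => x j l'))
    (f' := fun u => covForm μ (truncWeight p (box n K N) t (R + u • S)) S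
        (fun x => x j l) (fun x => x j l')) ?_ ?_ ?_
  · simpa using h
  · rw [uIcc_of_le zero_le_one]
    exact continuousOn_add_smul ht hR hS (continuousOn_meanProd hA hμ (measurable_coord j l)
      (measurable_coord j l') (integrable_sqSum hq2) (fun x => sq_le_sqSum x j l)
      (fun x => sq_le_sqSum x j l'))
  · intro u hu
    rw [min_eq_left zero_le_one] at hu
    exact hasDerivWithinAt_meanProd_box hq2 hμ ht.2 hR hS j l l' hu.1.le
  · refine ContinuousOn.intervalIntegrable ?_
    rw [uIcc_of_le zero_le_one]
    exact continuousOn_add_smul ht hR hS (continuousOn_covForm hq2 hA hμ S j l l')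

/-- The mean product of posterior means of entries is the integral of its derivative along positive
semidefinite increments of the side channel. -/
theorem integral_covForm (hq2 : Integrable (fun x : Config n K => sqSum x ^ 2) μ)
    (hμ : μ ≠ 0) {t : ℝ} (ht : t ∈ Icc (0 : ℝ) 1) {R S : Matrix (Fin K) (Fin K) ℝ}
    (hR : R.PosSemidef) (hS : S.PosSemidef) (j : Fin n) (l l' : Fin K) :
    ∫ u in (0 : ℝ)..1, covForm μ (gibbsWeight p t (R + u • S)) S (fun x => x j l) (fun x => x j l')
      = meanProd μ (noiseLaw p n K) (gibbsWeight p t (R + S)) (fun x => x j l) (fun x => x j l')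
        - meanProd μ (noiseLaw p n K) (gibbsWeight p t R) (fun x => x j l) (fun x => x j l') := by
  have hR' : ∀ {R : Matrix (Fin K) (Fin K) ℝ}, R.PosSemidef → Tendsto (fun N =>
      meanProd μ (noiseLaw p n K) (truncWeight p (box n K N) t R) (fun x => x j l)
        (fun x => x j l')) atTop
      (𝓝 (meanProd μ (noiseLaw p n K) (gibbsWeight p t R) (fun x => x j l) (fun x => x j l'))) :=
    fun hR => tendsto_meanProd_box hμ ht.2 hR (measurable_coord j l) (measurable_coord j l')
      (integrable_sqSum hq2) (fun x => sq_le_sqSum x j l) (fun x => sq_le_sqSum x j l')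
  have hlim := (hR' (hR.add hS)).sub (hR' hR)
  have hev := eventually_measure_box_ne_zero hμ
  -- The truncation is removed under the integral sign: the bound of `abs_covForm_le` does not
  -- depend on `N` or `u`. Passing to the limit in the derivative itself would require more.
  have hint : Tendsto (fun N => ∫ u in (0 : ℝ)..1,
      covForm μ (truncWeight p (box n K N) t (R + u • S)) S (fun x => x j l) (fun x => x j l'))
      atTop (𝓝 (∫ u in (0 : ℝ)..1,
        covForm μ (gibbsWeight p t (R + u • S)) S (fun x => x j l) (fun x => x j l'))) := by
    refine intervalIntegral.tendsto_integral_filter_of_dominated_convergence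
      (fun _ => n * (∑ a, ∑ b, |S a b|) * (4 * ∫ x, sqSum x ^ 2 ∂μ)) ?_ ?_ (by simp) ?_
    · filter_upwards [hev] with N hN
      rw [uIoc_of_le zero_le_one]
      exact ((continuousOn_add_smul ht hR hS (continuousOn_covForm hq2 (measurableSet_box N) hN S
        j l l')).mono Ioc_subset_Icc_self).aestronglyMeasurable measurableSet_Ioc
    · refine .of_forall fun N => .of_forall fun u hu => ?_
      rw [uIoc_of_le zero_le_one] at hu
      exact abs_covForm_le hq2 (measurableSet_box N) ht.2 (hR.add (hS.smul hu.1.le)) S j l l'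
    · refine .of_forall fun u hu => ?_
      rw [uIoc_of_le zero_le_one] at hu
      refine tendsto_finsetSum _ fun i _ => tendsto_finsetSum _ fun a _ =>
        tendsto_finsetSum _ fun b _ => Tendsto.const_mul _ ?_
      exact tendsto_meanCov_box hμ ht.2 (hR.add (hS.smul hu.1.le)) (measurable_coord j l)
        (measurable_coord i a) (measurable_coord j l') (measurable_coord i b) measurable_sqSum hq2
        (fun x => sq_le_sqSum x j l) (fun x => sq_le_sqSum x i a) (fun x => sq_le_sqSum x j l')
        (fun x => sq_le_sqSum x i b)
  refine tendsto_nhds_unique hint (hlim.congr' ?_)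
  filter_upwards [hev] with N hN
  exact (integral_covForm_box hq2 hN ht hR hS j l l').symm

end TensorInterp

end

noncomputable section

/-! ### Bayes optimality and the overlap matrix. -/

namespace TensorInterp

open Filter Topology

variable {p n K : ℕ}

/-- The Cameron–Martin formula for the joint law of the two noises. -/
theorem noiseLaw_map_add_eq_withDensity {t : ℝ} (ht : t ≤ 1) {R : Matrix (Fin K) (Fin K) ℝ}
    (hR : R.PosSemidef) (x : Config n K) :
    (noiseLaw p n K).map (fun y => (tensorSignal p t x + y.1, sideSignal R x + y.2))
      = (noiseLaw p n K).withDensity fun y => ENNReal.ofReal (gibbsWeight p t R x y) := by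
  have hm1 : Measurable fun Y : TensorIndex p n → ℝ => Y + tensorSignal p t x := by fun_prop
  have hm2 : Measurable fun Y : Config n K => Y + sideSignal R x := by fun_prop
  have h1 := pi_gaussianReal_map_add_eq_withDensity (tensorSignal p t x)
  have h2 := gaussianArray_map_add_eq_withDensity (sideSignal R x)
  have hd1 : Measurable fun Y => ENNReal.ofReal (tensorTilt (tensorSignal p t x) Y) :=
    (measurable_tensorTilt.comp (measurable_const.prodMk measurable_id)).ennreal_ofReal
  have hd2 : Measurable fun Y => ENNReal.ofReal (gaussianTilt (sideSignal R x) Y) :=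
    (measurable_gaussianTilt.comp (measurable_const.prodMk measurable_id)).ennreal_ofReal
  have e := Measure.map_prod_map (tensorNoise p n) (gaussianArray n K) hm1 hm2
  have e1 : (tensorNoise p n).map (fun Y => Y + tensorSignal p t x)
      = (tensorNoise p n).withDensity
        fun Y => ENNReal.ofReal (tensorTilt (tensorSignal p t x) Y) := h1
  have e2 : (gaussianArray n K).map (fun Y => Y + sideSignal R x)
      = (gaussianArray n K).withDensity
        fun Y => ENNReal.ofReal (gaussianTilt (sideSignal R x) Y) := h2
  rw [e1, e2, prod_withDensity hd1 hd2] at e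
  have e3 : (fun y : Noise p n K => (tensorSignal p t x + y.1, sideSignal R x + y.2))
      = Prod.map (fun Y => Y + tensorSignal p t x) fun Y => Y + sideSignal R x := by
    ext y <;> simp [add_comm]
  rw [e3, noiseLaw, ← e]
  congr 1
  ext y
  rw [gibbsWeight_eq ht hR, ENNReal.ofReal_mul (show 0 ≤ tensorTilt _ _ from (Real.exp_pos _).le)]

/-- The joint law of the signal and the observations. -/
theorem map_prod_observation {μ : Measure (Config n K)} [SFinite μ] {t : ℝ} (ht : t ≤ 1)
    {R : Matrix (Fin K) (Fin K) ℝ} (hR : R.PosSemidef) :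
    (μ.prod (noiseLaw p n K)).map
        (fun ω => (ω.1, (tensorSignal p t ω.1 + ω.2.1, sideSignal R ω.1 + ω.2.2)))
      = (μ.prod (noiseLaw p n K)).withDensity
        fun z => ENNReal.ofReal (gibbsWeight p t R z.1 z.2) := by
  have hΦ : Measurable fun ω : Config n K × Noise p n K =>
      (ω.1, (tensorSignal p t ω.1 + ω.2.1, sideSignal R ω.1 + ω.2.2)) :=
    measurable_fst.prodMk ((((measurable_tensorSignal t).comp measurable_fst).add
      (measurable_fst.comp measurable_snd)).prodMk
      (((measurable_sideSignal R).comp measurable_fst).add (measurable_snd.comp measurable_snd)))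
  have hw := (measurable_gibbsWeight (p := p) (n := n) ht hR).ennreal_ofReal
  ext s hs
  have hw' : Measurable fun z : Config n K × Noise p n K =>
      ENNReal.ofReal (gibbsWeight p t R z.1 z.2) := hw
  rw [Measure.map_apply hΦ hs, withDensity_apply _ hs, ← lintegral_indicator hs,
    Measure.prod_apply (hΦ hs), lintegral_prod _ (hw'.indicator hs).aemeasurable]
  refine lintegral_congr fun x => ?_
  have hmx : Measurable fun y : Noise p n K =>
      (tensorSignal p t x + y.1, sideSignal R x + y.2) := by fun_prop
  have hsx : MeasurableSet (Prod.mk x ⁻¹' s) := measurable_prodMk_left hs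
  have h := congrArg (fun ν => ν (Prod.mk x ⁻¹' s)) (noiseLaw_map_add_eq_withDensity (p := p) ht hR x)
  simp only [Measure.map_apply hmx hsx, withDensity_apply _ hsx, ← lintegral_indicator hsx] at h
  exact h

variable {μ : Measure (Config n K)} [IsFiniteMeasure μ]

/-- Bayes optimality: correlating a posterior mean with the signal is the same as correlating it with
another posterior mean. -/
theorem integral_posterior_mul_signal {t : ℝ} (ht : t ≤ 1)
    {R : Matrix (Fin K) (Fin K) ℝ} (hR : R.PosSemidef) {f g q : Config n K → ℝ}
    (hf : Measurable f) (hg : Measurable g) (hq : Integrable q μ) (hfq : ∀ x, f x ^ 2 ≤ q x)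
    (hgq : ∀ x, g x ^ 2 ≤ q x) :
    Integrable (fun z : Config n K × Noise p n K => wInt μ (gibbsWeight p t R) f z.2
        / wInt μ (gibbsWeight p t R) (fun _ => 1) z.2 * g z.1 * gibbsWeight p t R z.1 z.2)
      (μ.prod (noiseLaw p n K)) ∧
    ∫ z : Config n K × Noise p n K, wInt μ (gibbsWeight p t R) f z.2
        / wInt μ (gibbsWeight p t R) (fun _ => 1) z.2 * g z.1 * gibbsWeight p t R z.1 z.2
      ∂(μ.prod (noiseLaw p n K))
      = meanProd μ (noiseLaw p n K) (gibbsWeight p t R) f g := by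
  set w : Config n K → Noise p n K → ℝ := gibbsWeight p t R
  have h : IsWeight (noiseLaw p n K) w noiseBound := isWeight_gibbsWeight ht hR
  have hgi : Integrable g μ := integrable_of_sq_le hg hq hgq
  have hm : Measurable fun y => wInt μ w f y / wInt μ w (fun _ => 1) y :=
    (h.measurable_wInt hf).div (h.measurable_wInt measurable_const)
  have hF : Measurable fun z : Config n K × Noise p n K =>
      wInt μ w f z.2 / wInt μ w (fun _ => 1) z.2 * g z.1 * w z.1 z.2 :=
    ((hm.comp measurable_snd).mul (hg.comp measurable_fst)).mul h.meas
  have hassoc : ∀ (x : Config n K) (y : Noise p n K),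
      wInt μ w f y / wInt μ w (fun _ => 1) y * g x * w x y
        = wInt μ w f y / wInt μ w (fun _ => 1) y * (g x * w x y) := fun x y => mul_assoc _ _ _
  have hint : Integrable (fun z : Config n K × Noise p n K =>
      wInt μ w f z.2 / wInt μ w (fun _ => 1) z.2 * g z.1 * w z.1 z.2)
      (μ.prod (noiseLaw p n K)) := by
    -- Integrating over the signal first turns the absolute value into a product of two posterior
    -- integrals over `Z`, which `wInt q` dominates.
    refine (integrable_prod_iff' hF.aestronglyMeasurable).2 ⟨.of_forall fun y => ?_, ?_⟩
    · simp only [hassoc]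
      exact (h.integrable_mul hgi y).const_mul _
    · have e : ∀ y, ∫ x, ‖wInt μ w f y / wInt μ w (fun _ => 1) y * g x * w x y‖ ∂μ
          = |wInt μ w f y * wInt μ w (fun x => |g x|) y / wInt μ w (fun _ => 1) y| := fun y => by
        have : ∀ x, ‖wInt μ w f y / wInt μ w (fun _ => 1) y * g x * w x y‖
            = |wInt μ w f y / wInt μ w (fun _ => 1) y| * (|g x| * w x y) := fun x => by
          rw [hassoc, norm_mul, norm_mul, Real.norm_of_nonneg (h.nonneg x y)]; rfl
        simp only [this, integral_const_mul]
        rw [mul_div_right_comm, abs_mul]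
        congr 1
        exact (abs_of_nonneg (h.wInt_nonneg (fun x => abs_nonneg _) y)).symm
      simp only [e]
      refine (h.integrable_wInt hq).mono' ?_ (.of_forall fun y => ?_)
      · exact ((((h.measurable_wInt hf).mul (h.measurable_wInt hg.abs)).div
          (h.measurable_wInt measurable_const)).abs).aestronglyMeasurable
      · rw [Real.norm_eq_abs, abs_abs]
        exact h.abs_wInt_mul_div_le hf hg.abs hq hfq (fun x => by rw [sq_abs]; exact hgq x) y
  refine ⟨hint, ?_⟩
  rw [integral_prod_symm _ hint, meanProd]
  refine integral_congr_ae (.of_forall fun y => ?_)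
  simp only [hassoc, integral_const_mul]
  rw [mul_div_right_comm]
  rfl

/-- The overlap matrix as the mean of products of posterior means. -/
def posteriorOverlap (p : ℕ) {n K : ℕ} (μ : Measure (Config n K)) (t : ℝ)
    (R : Matrix (Fin K) (Fin K) ℝ) : Matrix (Fin K) (Fin K) ℝ :=
  Matrix.of fun l l' => 1 / (n : ℝ) * ∑ j, meanProd μ (noiseLaw p n K) (gibbsWeight p t R)
    (fun x => x j l) (fun x => x j l')

theorem isSymm_posteriorOverlap (ν : Measure (Config n K)) (t : ℝ) (R : Matrix (Fin K) (Fin K) ℝ) :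
    (posteriorOverlap p ν t R).IsSymm := by
  ext l l'
  simp only [posteriorOverlap, Matrix.transpose_apply, Matrix.of_apply, meanProd]
  congr 1
  refine Finset.sum_congr rfl fun j _ => integral_congr_ae (.of_forall fun y => ?_)
  simp only [mul_comm]

/-- The bracket depends on signal and noise only through signal and observations, whose joint law
has density `gibbsWeight` relative to prior times noise. Bayes optimality then exchanges the signal
for a posterior mean. -/
theorem meanOverlap_eq_posteriorOverlap (PX : Measure (Fin K → ℝ)) [IsProbabilityMeasure PX]
    (hq : Integrable (sqSum : Config n K → ℝ) (Measure.pi fun _ => PX)) {t : ℝ} (ht : t ≤ 1)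
    {R : Matrix (Fin K) (Fin K) ℝ} (hR : R.PosSemidef) :
    meanOverlap p n PX t R = posteriorOverlap p (Measure.pi fun _ : Fin n => PX) t R := by
  ext l l'
  set μ : Measure (Config n K) := Measure.pi fun _ : Fin n => PX with hμdef
  set w : Config n K → Noise p n K → ℝ := gibbsWeight p t R with hw
  have h : IsWeight (noiseLaw p n K) w noiseBound := isWeight_gibbsWeight ht hR
  have hi : ∀ (j : Fin n) (l : Fin K), Integrable (fun x : Config n K => x j l) μ := fun j l =>
    integrable_of_sq_le (measurable_coord j l) hq fun x => sq_le_sqSum x j l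
  set Φ : Config n K × Noise p n K → Config n K × Noise p n K := fun ω =>
    (ω.1, (tensorSignal p t ω.1 + ω.2.1, sideSignal R ω.1 + ω.2.2)) with hΦdef
  have hΦ : Measurable Φ :=
    measurable_fst.prodMk ((((measurable_tensorSignal t).comp measurable_fst).add
      (measurable_fst.comp measurable_snd)).prodMk
      (((measurable_sideSignal R).comp measurable_fst).add (measurable_snd.comp measurable_snd)))
  set H : Config n K × Noise p n K → ℝ := fun z =>
    1 / (n : ℝ) * ∑ j, wInt μ w (fun x => x j l) z.2 / wInt μ w (fun _ => 1) z.2 * z.1 j l' with hH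
  have hgibbs : ∀ ω : Sample p n K, gibbs PX t R (obsTensor t ω) (obsSide R ω)
      (fun x => overlap x ω.1 l l') = H (Φ ω) := fun ω => by
    set y : Noise p n K := (obsTensor t ω, obsSide R ω) with hy
    have hyΦ : (Φ ω).2 = y := rfl
    have hZ : partitionFn PX t R (obsTensor t ω) (obsSide R ω) = wInt μ w (fun _ => 1) y := by
      simp only [partitionFn, wInt, one_mul]
      rfl
    have e : ∀ x : Config n K, overlap x ω.1 l l'
          * (Real.exp (-hamiltonian t R (obsTensor t ω) (obsSide R ω) x)
            / wInt μ w (fun _ => 1) y)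
        = ∑ j, 1 / (n : ℝ) * (ω.1 j l' / wInt μ w (fun _ => 1) y) * (x j l * w x y) := fun x => by
      have : Real.exp (-hamiltonian t R (obsTensor t ω) (obsSide R ω) x) = w x y := rfl
      rw [this, overlap, Matrix.of_apply, Finset.mul_sum, Finset.sum_mul]
      exact Finset.sum_congr rfl fun j _ => by ring
    rw [gibbs, hZ]
    simp only [e]
    refine (integral_finsetSum _ fun j _ => (h.integrable_mul (hi j l) y).const_mul _).trans ?_
    simp only [integral_const_mul, hH, hyΦ, Finset.mul_sum]
    refine Finset.sum_congr rfl fun j _ => ?_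
    change _ * wInt μ w (fun x => x j l) y = _ * (_ * ω.1 j l')
    ring
  have hHm : Measurable H := by
    refine measurable_const.mul (Finset.measurable_fun_sum _ fun j _ => Measurable.mul ?_ ?_)
    · exact ((h.measurable_wInt (measurable_coord j l)).div
        (h.measurable_wInt measurable_const)).comp measurable_snd
    · exact (measurable_coord j l').comp measurable_fst
  have hlaw : sampleLaw p n PX = μ.prod (noiseLaw p n K) := rfl
  have hb := fun j => integral_posterior_mul_signal (p := p) ht hR (measurable_coord j l)
    (measurable_coord j l') hq (fun x => sq_le_sqSum x j l) (fun x => sq_le_sqSum x j l')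
  have hwm : Measurable fun z : Config n K × Noise p n K => ENNReal.ofReal (w z.1 z.2) :=
    (measurable_gibbsWeight ht hR).ennreal_ofReal
  rw [meanOverlap, Matrix.of_apply, hlaw]
  simp only [hgibbs]
  rw [← integral_map hΦ.aemeasurable hHm.aestronglyMeasurable, map_prod_observation ht hR,
    integral_withDensity_eq_integral_toReal_smul hwm (.of_forall fun z => ENNReal.ofReal_lt_top),
    posteriorOverlap, Matrix.of_apply, Finset.mul_sum]
  have e : ∀ z : Config n K × Noise p n K, (ENNReal.ofReal (w z.1 z.2)).toReal • H z
      = ∑ j, 1 / (n : ℝ) * (wInt μ w (fun x => x j l) z.2 / wInt μ w (fun _ => 1) z.2 * z.1 j l'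
        * w z.1 z.2) := fun z => by
    rw [ENNReal.toReal_ofReal (h.nonneg _ _), smul_eq_mul]
    simp only [hH, Finset.mul_sum]
    exact Finset.sum_congr rfl fun j _ => by ring
  refine (integral_congr_ae (.of_forall e)).trans ?_
  refine (integral_finsetSum _ fun j _ => (hb j).1.const_mul _).trans ?_
  exact Finset.sum_congr rfl fun j _ => by rw [integral_const_mul, (hb j).2]

theorem integrable_wInt_mul_div {A : Set (Config n K)} (hA : MeasurableSet A) {t : ℝ} (ht : t ≤ 1)
    {R : Matrix (Fin K) (Fin K) ℝ} (hR : R.PosSemidef) {f g q : Config n K → ℝ}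
    (hf : Measurable f) (hg : Measurable g) (hq : Integrable q μ) (hfq : ∀ x, f x ^ 2 ≤ q x)
    (hgq : ∀ x, g x ^ 2 ≤ q x) :
    Integrable (fun y => wInt μ (truncWeight p A t R) f y * wInt μ (truncWeight p A t R) g y
      / wInt μ (truncWeight p A t R) (fun _ => 1) y) (noiseLaw p n K) := by
  have h := isWeight_truncWeight (p := p) hA ht hR
  refine (h.integrable_wInt hq).mono' ?_ (.of_forall fun y =>
    h.abs_wInt_mul_div_le hf hg hq hfq hgq y)
  exact (((h.measurable_wInt hf).mul (h.measurable_wInt hg)).div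
    (h.measurable_wInt measurable_const)).aestronglyMeasurable

/-- The quadratic form at `v` is the average over rows of the mean square of the posterior mean of
`v · x_j`. -/
theorem posSemidef_posteriorOverlap (hq : Integrable (sqSum : Config n K → ℝ) μ) {t : ℝ}
    (ht : t ≤ 1) {R : Matrix (Fin K) (Fin K) ℝ} (hR : R.PosSemidef) :
    (posteriorOverlap p μ t R).PosSemidef := by
  have h : IsWeight (noiseLaw p n K) (gibbsWeight p t R) noiseBound := isWeight_gibbsWeight ht hR
  refine Matrix.PosSemidef.of_dotProduct_mulVec_nonneg ?_ fun v => ?_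
  · rw [Matrix.IsHermitian, Matrix.conjTranspose_eq_transpose_of_trivial]
    exact isSymm_posteriorOverlap μ t R
  have hi : ∀ j (l l' : Fin K), Integrable (fun y => wInt μ (gibbsWeight p t R) (fun x => x j l) y
      * wInt μ (gibbsWeight p t R) (fun x => x j l') y
      / wInt μ (gibbsWeight p t R) (fun _ => 1) y) (noiseLaw p n K) := fun j l l' => by
    rw [← truncWeight_univ]
    exact integrable_wInt_mul_div MeasurableSet.univ ht hR (measurable_coord j l)
      (measurable_coord j l') hq (fun x => sq_le_sqSum x j l) (fun x => sq_le_sqSum x j l')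
  have e : star v ⬝ᵥ posteriorOverlap p μ t R *ᵥ v = 1 / (n : ℝ) * ∑ j, ∫ y,
      (∑ l, v l * wInt μ (gibbsWeight p t R) (fun x => x j l) y) ^ 2
        / wInt μ (gibbsWeight p t R) (fun _ => 1) y ∂(noiseLaw p n K) := by
    have e1 : ∀ j, ∫ y, (∑ l, v l * wInt μ (gibbsWeight p t R) (fun x => x j l) y) ^ 2
        / wInt μ (gibbsWeight p t R) (fun _ => 1) y ∂(noiseLaw p n K)
        = ∑ l, ∑ l', v l * v l' * meanProd μ (noiseLaw p n K) (gibbsWeight p t R)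
          (fun x => x j l) (fun x => x j l') := fun j => by
      have : ∀ y, (∑ l, v l * wInt μ (gibbsWeight p t R) (fun x => x j l) y) ^ 2
          / wInt μ (gibbsWeight p t R) (fun _ => 1) y
          = ∑ l, ∑ l', v l * v l' * (wInt μ (gibbsWeight p t R) (fun x => x j l) y
            * wInt μ (gibbsWeight p t R) (fun x => x j l') y
            / wInt μ (gibbsWeight p t R) (fun _ => 1) y) := fun y => by
        rw [pow_two, Finset.sum_mul_sum, Finset.sum_div]
        refine Finset.sum_congr rfl fun l _ => ?_
        rw [Finset.sum_div]
        exact Finset.sum_congr rfl fun l' _ => by ring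
      simp only [this]
      refine (integral_finsetSum _ fun l _ => integrable_finsetSum _ fun l' _ =>
        (hi j l l').const_mul _).trans (Finset.sum_congr rfl fun l _ => ?_)
      refine (integral_finsetSum _ fun l' _ => (hi j l l').const_mul _).trans
        (Finset.sum_congr rfl fun l' _ => integral_const_mul _ _)
    simp only [e1, dotProduct, Matrix.mulVec, posteriorOverlap, Matrix.of_apply, star_trivial,
      Finset.mul_sum, Finset.sum_mul]
    symm
    rw [Finset.sum_comm]
    refine Finset.sum_congr rfl fun l _ => ?_
    rw [Finset.sum_comm]
    exact Finset.sum_congr rfl fun l' _ => Finset.sum_congr rfl fun j _ => by ring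
  rw [e]
  refine mul_nonneg (by positivity) (Finset.sum_nonneg fun j _ => integral_nonneg fun y => ?_)
  exact div_nonneg (sq_nonneg _) (h.wInt_nonneg (fun _ => zero_le_one) y)

theorem abs_posteriorOverlap_le (hn : 1 ≤ n) (hq : Integrable (sqSum : Config n K → ℝ) μ) {t : ℝ}
    (ht : t ≤ 1) {R : Matrix (Fin K) (Fin K) ℝ} (hR : R.PosSemidef) (l l' : Fin K) :
    |posteriorOverlap p μ t R l l'| ≤ ∫ x, sqSum x ∂μ := by
  have h : IsWeight (noiseLaw p n K) (gibbsWeight p t R) noiseBound := isWeight_gibbsWeight ht hR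
  have hn0 : (0 : ℝ) < n := by exact_mod_cast hn
  have hb : ∀ j, |meanProd μ (noiseLaw p n K) (gibbsWeight p t R) (fun x => x j l)
      (fun x => x j l')| ≤ ∫ x, sqSum x ∂μ := fun j =>
    (norm_integral_le_of_norm_le (f := fun y => wInt μ (gibbsWeight p t R) (fun x => x j l) y
      * wInt μ (gibbsWeight p t R) (fun x => x j l') y
      / wInt μ (gibbsWeight p t R) (fun _ => 1) y) (h.integrable_wInt hq) (.of_forall fun y =>
      h.abs_wInt_mul_div_le (measurable_coord j l) (measurable_coord j l') hq
        (fun x => sq_le_sqSum x j l) (fun x => sq_le_sqSum x j l') y)).trans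
      (h.integral_wInt_le hq fun x => Finset.sum_nonneg fun _ _ => Finset.sum_nonneg fun _ _ =>
        sq_nonneg _)
  rw [posteriorOverlap, Matrix.of_apply, abs_mul, abs_of_pos (by positivity : 0 < 1 / (n : ℝ)),
    one_div, inv_mul_le_iff₀ hn0]
  refine (Finset.abs_sum_le_sum_abs _ _).trans ((Finset.sum_le_sum fun j _ => hb j).trans ?_)
  simp

end TensorInterp

end

noncomputable section

/-! ### Positivity of symmetrised Hadamard sums. -/

section GramPositivity

open scoped MatrixOrder in
theorem Matrix.PosSemidef.exists_transpose_mul_self {ι : Type*} [Fintype ι] [DecidableEq ι]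
    {C : Matrix ι ι ℝ} (hC : C.PosSemidef) : ∃ B : Matrix ι ι ℝ, C = Bᵀ * B := by
  have h := CFC.sqrt_mul_sqrt_self C (Matrix.nonneg_iff_posSemidef.2 hC)
  have hs := (Matrix.nonneg_iff_posSemidef.1 (CFC.sqrt_nonneg C)).isHermitian
  rw [Matrix.IsHermitian, Matrix.conjTranspose_eq_transpose_of_trivial] at hs
  exact ⟨CFC.sqrt C, by rw [hs, h]⟩

/-- The symmetrised Hadamard product of two families of vectors has nonnegative total mass. -/
theorem Matrix.PosSemidef.sum_mul_add_sum_mul_nonneg {ι κ : Type*} [Fintype ι] [Fintype κ]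
    {C : Matrix ι ι ℝ} (hC : C.PosSemidef) (a b : κ → ι) :
    0 ≤ ∑ j, ∑ i, (C (a j) (a i) * C (b j) (b i) + C (a j) (b i) * C (b j) (a i)) := by
  classical
  obtain ⟨B, rfl⟩ := hC.exists_transpose_mul_self
  -- With `C = Bᵀ B` the sum is half the squared norm of `∑ i (B_{a i} ⊗ B_{b i} + B_{b i} ⊗ B_{a
  -- i})`; expanding the square produces each of the two terms twice.
  have e : ∑ j, ∑ i, ((Bᵀ * B) (a j) (a i) * (Bᵀ * B) (b j) (b i)
        + (Bᵀ * B) (a j) (b i) * (Bᵀ * B) (b j) (a i))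
      = ∑ r, ∑ s, (∑ i, (B r (a i) * B s (b i) + B r (b i) * B s (a i))) ^ 2 / 2 := by
    have hr : ∀ r s, (∑ i, (B r (a i) * B s (b i) + B r (b i) * B s (a i))) ^ 2 / 2
        = ∑ j, ∑ i, (B r (a j) * B s (b j) + B r (b j) * B s (a j))
          * (B r (a i) * B s (b i) + B r (b i) * B s (a i)) / 2 := fun r s => by
      rw [pow_two, Finset.sum_mul_sum, Finset.sum_div]
      exact Finset.sum_congr rfl fun j _ => Finset.sum_div _ _ _
    simp only [hr]
    symm
    have hcomm : ∀ F : ι → ι → κ → κ → ℝ,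
        ∑ r, ∑ s, ∑ j, ∑ i, F r s j i = ∑ j, ∑ i, ∑ r, ∑ s, F r s j i := fun F => by
      calc ∑ r, ∑ s, ∑ j, ∑ i, F r s j i = ∑ r, ∑ j, ∑ s, ∑ i, F r s j i :=
            Finset.sum_congr rfl fun r _ => Finset.sum_comm
        _ = ∑ j, ∑ r, ∑ s, ∑ i, F r s j i := Finset.sum_comm
        _ = ∑ j, ∑ r, ∑ i, ∑ s, F r s j i :=
            Finset.sum_congr rfl fun j _ => Finset.sum_congr rfl fun r _ => Finset.sum_comm
        _ = ∑ j, ∑ i, ∑ r, ∑ s, F r s j i := Finset.sum_congr rfl fun j _ => Finset.sum_comm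
    rw [hcomm]
    refine Finset.sum_congr rfl fun j _ => Finset.sum_congr rfl fun i _ => ?_
    simp only [Matrix.mul_apply, Matrix.transpose_apply, Finset.sum_mul_sum,
      ← Finset.sum_add_distrib]
    have h : ∑ r, ∑ s, (B r (a j) * B s (b j) + B r (b j) * B s (a j))
          * (B r (a i) * B s (b i) + B r (b i) * B s (a i)) / 2
        = (∑ r, ∑ s, (B r (a j) * B r (a i) * (B s (b j) * B s (b i))
            + B r (a j) * B r (b i) * (B s (b j) * B s (a i)))) / 2
          + (∑ s, ∑ r, (B r (a j) * B r (a i) * (B s (b j) * B s (b i))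
            + B r (a j) * B r (b i) * (B s (b j) * B s (a i)))) / 2 := by
      simp only [Finset.sum_div, ← Finset.sum_add_distrib]
      exact Finset.sum_congr rfl fun r _ => Finset.sum_congr rfl fun s _ => by ring
    have hs : ∑ s, ∑ r, (B r (a j) * B r (a i) * (B s (b j) * B s (b i))
          + B r (a j) * B r (b i) * (B s (b j) * B s (a i)))
        = ∑ r, ∑ s, (B r (a j) * B r (a i) * (B s (b j) * B s (b i))
          + B r (a j) * B r (b i) * (B s (b j) * B s (a i))) := Finset.sum_comm
    rw [h, hs, add_halves]
  rw [e]
  exact Finset.sum_nonneg fun r _ => Finset.sum_nonneg fun s _ => by positivity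

end GramPositivity

/-! ### The derivative of the overlap and its sign. -/

namespace TensorInterp

open Filter Topology

variable {p n K : ℕ} {μ : Measure (Config n K)} [IsFiniteMeasure μ]

theorem wCov_comm {X Y : Type*} [MeasurableSpace X] (ν : Measure X) (w : X → Y → ℝ) (f g : X → ℝ)
    (y : Y) : wCov ν w f g y = wCov ν w g f y := by
  simp only [wCov, mul_comm]

/-- The posterior covariances of the entries form a positive semidefinite matrix. -/
theorem posSemidef_wCov (hq : Integrable (sqSum : Config n K → ℝ) μ)
    {w : Config n K → Noise p n K → ℝ} {B : Noise p n K → ℝ} (h : IsWeight (noiseLaw p n K) w B)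
    (y : Noise p n K) :
    (Matrix.of fun α β : Fin n × Fin K => wCov μ w (fun x => x α.1 α.2) (fun x => x β.1 β.2)
      y).PosSemidef := by
  have hi : ∀ (α : Fin n × Fin K), Integrable (fun x : Config n K => x α.1 α.2) μ := fun α =>
    integrable_of_sq_le (measurable_coord _ _) hq fun x => sq_le_sqSum x _ _
  have hii : ∀ (α β : Fin n × Fin K),
      Integrable (fun x : Config n K => x α.1 α.2 * x β.1 β.2) μ := fun α β =>
    hq.mono' ((measurable_coord _ _).mul (measurable_coord _ _)).aestronglyMeasurable
      (.of_forall fun x => abs_mul_le_of_sq_le (sq_le_sqSum x _ _) (sq_le_sqSum x _ _))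
  refine Matrix.PosSemidef.of_dotProduct_mulVec_nonneg ?_ fun v => ?_
  · ext α β
    simp only [Matrix.conjTranspose_apply, Matrix.of_apply, star_trivial]
    exact wCov_comm _ _ _ _ _
  -- The quadratic form at `v` is the unnormalised posterior variance of the linear form `F`.
  · set F : Config n K → ℝ := fun x => ∑ α : Fin n × Fin K, v α * x α.1 α.2
    have hF : Integrable F μ := integrable_finsetSum _ fun α _ => (hi α).const_mul _
    have hFα : ∀ β : Fin n × Fin K, Integrable (fun x => F x * x β.1 β.2) μ := fun β => by
      simp only [F, Finset.sum_mul, mul_assoc]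
      exact integrable_finsetSum _ fun α _ => (hii α β).const_mul _
    have hFF : Integrable (fun x => F x ^ 2) μ := by
      have : (fun x => F x ^ 2) = fun x => ∑ α : Fin n × Fin K, v α * (F x * x α.1 α.2) := by
        ext x
        rw [pow_two]
        conv_lhs => rw [show F x = ∑ α : Fin n × Fin K, v α * x α.1 α.2 from rfl]
        rw [Finset.sum_mul_sum]
        simp only [F, Finset.sum_mul, Finset.mul_sum]
        exact Finset.sum_congr rfl fun _ _ => Finset.sum_congr rfl fun _ _ => by ring
      rw [this]
      exact integrable_finsetSum _ fun α _ => (hFα α).const_mul _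
    have e : star v ⬝ᵥ (Matrix.of fun α β : Fin n × Fin K =>
        wCov μ w (fun x => x α.1 α.2) (fun x => x β.1 β.2) y) *ᵥ v = wCov μ w F F y := by
      have e1 : wCov μ w F F y
          = ∑ β : Fin n × Fin K, v β * wCov μ w F (fun x => x β.1 β.2) y :=
        h.wCov_sum_right Finset.univ v hi hFα y
      have e2 : ∀ β : Fin n × Fin K, wCov μ w F (fun x => x β.1 β.2) y
          = ∑ α : Fin n × Fin K, v α * wCov μ w (fun x => x β.1 β.2) (fun x => x α.1 α.2) y :=
        fun β => by
          rw [wCov_comm]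
          exact h.wCov_sum_right Finset.univ v hi (hii β) y
      simp only [e1, e2, dotProduct, Matrix.mulVec, Matrix.of_apply, star_trivial]
      exact Finset.sum_congr rfl fun _ _ => congrArg _ (Finset.sum_congr rfl fun _ _ => mul_comm _ _)
    rw [e, wCov]
    have := h.sq_wInt_div_le hF hFF y
    simp only [pow_two] at this
    linarith

/-- The derivative of the entry `(l, l')` of the overlap in the entry `(a, b)` of the side channel. -/
def overlapDeriv (p : ℕ) {n K : ℕ} (μ : Measure (Config n K)) (l l' : Fin K) (t : ℝ) (a b : Fin K)
    (R : Matrix (Fin K) (Fin K) ℝ) : ℝ :=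
  1 / (n : ℝ) * ∑ j, ∑ i, meanCov μ (noiseLaw p n K) (gibbsWeight p t R)
    (fun x => x j l) (fun x => x i a) (fun x => x j l') (fun x => x i b)

/-- Up to a factor this is the derivative of entry `(l, l')` along the symmetrised unit `(l, l')`.
For each observation the integrand is a symmetrised Hadamard sum of the posterior covariance matrix,
with column families `(j, l)` and `(j, l')`. -/
theorem overlapDeriv_add_nonneg (hq2 : Integrable (fun x : Config n K => sqSum x ^ 2) μ) {t : ℝ}
    (ht : t ≤ 1) {R : Matrix (Fin K) (Fin K) ℝ} (hR : R.PosSemidef) (l l' : Fin K) :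
    0 ≤ overlapDeriv p μ l l' t l l' R + overlapDeriv p μ l l' t l' l R := by
  have h : IsWeight (noiseLaw p n K) (gibbsWeight p t R) noiseBound := isWeight_gibbsWeight ht hR
  set w : Config n K → Noise p n K → ℝ := gibbsWeight p t R
  have hi : ∀ (j i : Fin n) (a b c d : Fin K), Integrable (fun y => wCov μ w (fun x => x j a)
      (fun x => x i b) y * wCov μ w (fun x => x j c) (fun x => x i d) y
      / wInt μ w (fun _ => 1) y) (noiseLaw p n K) := fun j i a b c d => by
    refine ((h.integrable_wInt hq2).const_mul 4).mono' ?_ (.of_forall fun y =>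
      h.abs_wCov_mul_div_le (measurable_coord j a) (measurable_coord j c) (measurable_coord i b)
        (measurable_coord i d) measurable_sqSum hq2 (fun x => sq_le_sqSum x j a)
        (fun x => sq_le_sqSum x j c) (fun x => sq_le_sqSum x i b) (fun x => sq_le_sqSum x i d) y)
    exact (((h.measurable_wCov (measurable_coord j a) (measurable_coord i b)).mul
      (h.measurable_wCov (measurable_coord j c) (measurable_coord i d))).div
      (h.measurable_wInt measurable_const)).aestronglyMeasurable
  rw [overlapDeriv, overlapDeriv, ← mul_add, ← Finset.sum_add_distrib]
  refine mul_nonneg (by positivity) ?_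
  simp only [← Finset.sum_add_distrib]
  have e : ∑ j, ∑ i, (meanCov μ (noiseLaw p n K) w (fun x => x j l) (fun x => x i l)
        (fun x => x j l') (fun x => x i l')
      + meanCov μ (noiseLaw p n K) w (fun x => x j l) (fun x => x i l')
        (fun x => x j l') (fun x => x i l))
      = ∫ y, (∑ j, ∑ i, (wCov μ w (fun x => x j l) (fun x => x i l) y
          * wCov μ w (fun x => x j l') (fun x => x i l') y
        + wCov μ w (fun x => x j l) (fun x => x i l') y
          * wCov μ w (fun x => x j l') (fun x => x i l) y)) / wInt μ w (fun _ => 1) y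
        ∂(noiseLaw p n K) := by
    simp only [Finset.sum_div, add_div]
    symm
    refine (integral_finsetSum _ fun j _ => integrable_finsetSum _ fun i _ =>
      (hi j i l l l' l').add (hi j i l l' l' l)).trans (Finset.sum_congr rfl fun j _ => ?_)
    refine (integral_finsetSum _ fun i _ => (hi j i l l l' l').add (hi j i l l' l' l)).trans
      (Finset.sum_congr rfl fun i _ => ?_)
    exact integral_add (hi j i l l l' l') (hi j i l l' l' l)
  rw [e]
  refine integral_nonneg fun y => div_nonneg ?_ (h.wInt_nonneg (fun _ => zero_le_one) y)
  exact (posSemidef_wCov (integrable_sqSum hq2) h y).sum_mul_add_sum_mul_nonneg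
    (fun j => (j, l)) (fun j => (j, l'))

theorem sum_mul_overlapDeriv (ν : Measure (Config n K)) (S : Matrix (Fin K) (Fin K) ℝ) (t : ℝ) (R : Matrix (Fin K) (Fin K) ℝ)
    (l l' : Fin K) :
    ∑ a, ∑ b, S a b * overlapDeriv p ν l l' t a b R
      = 1 / (n : ℝ) * ∑ j, covForm ν (gibbsWeight p t R) S (fun x => x j l) (fun x => x j l') := by
  simp only [overlapDeriv, covForm, Finset.mul_sum]
  rw [Finset.sum_congr rfl fun a _ => Finset.sum_comm, Finset.sum_comm]
  refine Finset.sum_congr rfl fun j _ => ?_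
  rw [Finset.sum_congr rfl fun a _ => Finset.sum_comm, Finset.sum_comm]
  exact Finset.sum_congr rfl fun i _ => Finset.sum_congr rfl fun a _ =>
    Finset.sum_congr rfl fun b _ => by ring

theorem continuousOn_posteriorOverlap (hq : Integrable (sqSum : Config n K → ℝ) μ) (hμ : μ ≠ 0)
    (l l' : Fin K) :
    ContinuousOn (fun a : ℝ × Matrix (Fin K) (Fin K) ℝ => posteriorOverlap p μ a.1 a.2 l l')
      (Icc 0 1 ×ˢ {R | R.PosSemidef}) := by
  simp only [posteriorOverlap, Matrix.of_apply, ← truncWeight_univ]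
  exact continuousOn_const.mul (continuousOn_finsetSum _ fun j _ =>
    continuousOn_meanProd MeasurableSet.univ (by simpa using hμ) (measurable_coord j l)
      (measurable_coord j l') hq (fun x => sq_le_sqSum x j l) (fun x => sq_le_sqSum x j l'))

theorem continuousOn_overlapDeriv (hq2 : Integrable (fun x : Config n K => sqSum x ^ 2) μ)
    (hμ : μ ≠ 0) (l l' a b : Fin K) :
    ContinuousOn (fun z : ℝ × Matrix (Fin K) (Fin K) ℝ => overlapDeriv p μ l l' z.1 a b z.2)
      (Icc 0 1 ×ˢ {R | R.PosSemidef}) := by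
  simp only [overlapDeriv, ← truncWeight_univ]
  exact continuousOn_const.mul (continuousOn_finsetSum _ fun j _ => continuousOn_finsetSum _
    fun i _ => continuousOn_meanCov MeasurableSet.univ (by simpa using hμ) (measurable_coord j l)
      (measurable_coord i a) (measurable_coord j l') (measurable_coord i b) measurable_sqSum hq2
      (fun x => sq_le_sqSum x j l) (fun x => sq_le_sqSum x i a) (fun x => sq_le_sqSum x j l')
      (fun x => sq_le_sqSum x i b))

theorem abs_overlapDeriv_le (hq2 : Integrable (fun x : Config n K => sqSum x ^ 2) μ) {t : ℝ}
    (ht : t ≤ 1) {R : Matrix (Fin K) (Fin K) ℝ} (hR : R.PosSemidef) (l l' a b : Fin K) :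
    |overlapDeriv p μ l l' t a b R| ≤ n * (4 * ∫ x, sqSum x ^ 2 ∂μ) := by
  have hb : ∀ j i : Fin n, |meanCov μ (noiseLaw p n K) (gibbsWeight p t R) (fun x => x j l)
      (fun x => x i a) (fun x => x j l') (fun x => x i b)| ≤ 4 * ∫ x, sqSum x ^ 2 ∂μ :=
    fun j i => by
      rw [← truncWeight_univ]
      exact abs_meanCov_le MeasurableSet.univ ht hR (measurable_coord j l)
        (measurable_coord i a) (measurable_coord j l') (measurable_coord i b) measurable_sqSum hq2
        (fun x => sq_le_sqSum x j l) (fun x => sq_le_sqSum x i a) (fun x => sq_le_sqSum x j l')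
        (fun x => sq_le_sqSum x i b)
  rcases Nat.eq_zero_or_pos n with rfl | hn
  · simp [overlapDeriv]
  have hn0 : (0 : ℝ) < n := by exact_mod_cast hn
  rw [overlapDeriv, abs_mul, abs_of_pos (by positivity : 0 < 1 / (n : ℝ)), one_div,
    inv_mul_le_iff₀ hn0]
  refine (Finset.abs_sum_le_sum_abs _ _).trans ((Finset.sum_le_sum fun j _ =>
    (Finset.abs_sum_le_sum_abs _ _).trans (Finset.sum_le_sum fun i _ => hb j i)).trans ?_)
  simp

/-- The overlap is the integral of its derivative along positive semidefinite increments. -/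
theorem posteriorOverlap_add_sub (hq2 : Integrable (fun x : Config n K => sqSum x ^ 2) μ)
    (hμ : μ ≠ 0) {t : ℝ} (ht : t ∈ Icc (0 : ℝ) 1) {R S : Matrix (Fin K) (Fin K) ℝ}
    (hR : R.PosSemidef) (hS : S.PosSemidef) (l l' : Fin K) :
    posteriorOverlap p μ t (R + S) l l' - posteriorOverlap p μ t R l l'
      = ∫ u in (0 : ℝ)..1, ∑ a, ∑ b, S a b * overlapDeriv p μ l l' t a b (R + u • S) := by
  simp only [sum_mul_overlapDeriv, intervalIntegral.integral_const_mul]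
  rw [intervalIntegral.integral_finsetSum]
  · simp only [integral_covForm hq2 hμ ht hR hS, posteriorOverlap, Matrix.of_apply]
    rw [Finset.sum_sub_distrib, mul_sub]
  · intro j _
    refine ContinuousOn.intervalIntegrable ?_
    rw [uIcc_of_le zero_le_one]
    have := continuousOn_covForm (p := p) hq2 MeasurableSet.univ (by simpa using hμ) S j l l'
    simp only [truncWeight_univ] at this
    exact continuousOn_add_smul ht hR hS this

end TensorInterp

end

noncomputable section

namespace TensorInterp

open Filter Topology

variable {K : ℕ}

/-! ### Entrywise estimates and openness of the positive definite cone. -/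

section EntrySum

/-- The sum of the absolute values of the entries. -/
def entrySum (A : Matrix (Fin K) (Fin K) ℝ) : ℝ := ∑ a, ∑ b, |A a b|

theorem entrySum_nonneg (A : Matrix (Fin K) (Fin K) ℝ) : 0 ≤ entrySum A :=
  Finset.sum_nonneg fun _ _ => Finset.sum_nonneg fun _ _ => abs_nonneg _

theorem abs_entry_le_norm (A : Matrix (Fin K) (Fin K) ℝ) (a b : Fin K) : |A a b| ≤ ‖A‖ := by
  rw [Matrix.frobenius_norm_def, ← Real.sqrt_eq_rpow]
  refine Real.le_sqrt_of_sq_le ?_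
  have h : ∀ i j, ‖A i j‖ ^ (2 : ℝ) = A i j ^ 2 := fun i j => by
    rw [Real.rpow_two, Real.norm_eq_abs, sq_abs]
  simp only [h, sq_abs]
  exact (Finset.single_le_sum (f := fun b => A a b ^ 2) (fun _ _ => sq_nonneg _)
    (Finset.mem_univ b)).trans (Finset.single_le_sum (f := fun a => ∑ b, A a b ^ 2)
      (fun _ _ => Finset.sum_nonneg fun _ _ => sq_nonneg _) (Finset.mem_univ a))

theorem entrySum_le (A : Matrix (Fin K) (Fin K) ℝ) : entrySum A ≤ K ^ 2 * ‖A‖ := by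
  refine (Finset.sum_le_sum fun a _ => Finset.sum_le_sum fun b _ => abs_entry_le_norm A a b).trans ?_
  simp only [Finset.sum_const, Finset.card_univ, Fintype.card_fin, nsmul_eq_mul]
  rw [pow_two, mul_assoc]

theorem entrySum_add_le (A B : Matrix (Fin K) (Fin K) ℝ) :
    entrySum (A + B) ≤ entrySum A + entrySum B := by
  simp only [entrySum, ← Finset.sum_add_distrib]
  exact Finset.sum_le_sum fun a _ => Finset.sum_le_sum fun b _ => abs_add_le _ _

theorem entrySum_smul_one {c : ℝ} (hc : 0 ≤ c) :
    entrySum (c • (1 : Matrix (Fin K) (Fin K) ℝ)) = K * c := by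
  have h : ∀ a b, |(c • (1 : Matrix (Fin K) (Fin K) ℝ)) a b| = if a = b then c else 0 := by
    intro a b
    by_cases hab : a = b <;> simp [Matrix.smul_apply, hab, abs_of_nonneg hc]
  simp only [entrySum, h]
  simp

theorem abs_sum_mul_le_entrySum {e : ℝ} (A c : Matrix (Fin K) (Fin K) ℝ) (hc : ∀ a b, |c a b| ≤ e) :
    |∑ a, ∑ b, A a b * c a b| ≤ e * entrySum A := by
  simp only [entrySum, Finset.mul_sum]
  refine (Finset.abs_sum_le_sum_abs _ _).trans (Finset.sum_le_sum fun a _ => ?_)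
  refine (Finset.abs_sum_le_sum_abs _ _).trans (Finset.sum_le_sum fun b _ => ?_)
  rw [abs_mul, mul_comm]
  exact mul_le_mul_of_nonneg_right (hc a b) (abs_nonneg _)

theorem abs_dotProduct_mulVec_le (A : Matrix (Fin K) (Fin K) ℝ) (v : Fin K → ℝ) :
    |v ⬝ᵥ A *ᵥ v| ≤ entrySum A * (v ⬝ᵥ v) := by
  have e : v ⬝ᵥ A *ᵥ v = ∑ a, ∑ b, A a b * Matrix.of (fun a b => v a * v b) a b := by
    simp only [dotProduct, Matrix.mulVec, Finset.mul_sum, Matrix.of_apply]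
    exact Finset.sum_congr rfl fun a _ => Finset.sum_congr rfl fun b _ => by ring
  rw [e, mul_comm]
  refine abs_sum_mul_le_entrySum A _ fun a b => ?_
  have h : ∀ a, v a ^ 2 ≤ v ⬝ᵥ v := fun a => by
    rw [pow_two]
    exact Finset.single_le_sum (f := fun a => v a * v a) (fun a _ => mul_self_nonneg _)
      (Finset.mem_univ a)
  exact abs_mul_le_of_sq_le (h a) (h b)

/-- The quadratic form of `A` is at least `-entrySum A` times `v · v`. This writes any symmetric
increment as a difference of two positive semidefinite ones. -/
theorem posSemidef_add_smul_one {A : Matrix (Fin K) (Fin K) ℝ} (hA : A.IsSymm) {c : ℝ}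
    (hc : entrySum A ≤ c) : (A + c • (1 : Matrix (Fin K) (Fin K) ℝ)).PosSemidef := by
  refine Matrix.PosSemidef.of_dotProduct_mulVec_nonneg ?_ fun v => ?_
  · rw [Matrix.IsHermitian, Matrix.conjTranspose_eq_transpose_of_trivial, Matrix.transpose_add,
      Matrix.transpose_smul, Matrix.transpose_one, hA.eq]
  · rw [star_trivial, Matrix.add_mulVec, dotProduct_add, Matrix.smul_mulVec, Matrix.one_mulVec,
      dotProduct_smul, smul_eq_mul]
    have h1 := neg_le_of_abs_le (abs_dotProduct_mulVec_le A v)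
    have h2 : 0 ≤ v ⬝ᵥ v := Finset.sum_nonneg fun _ _ => mul_self_nonneg _
    nlinarith

theorem posSemidef_smul_one {c : ℝ} (hc : 0 ≤ c) :
    (c • (1 : Matrix (Fin K) (Fin K) ℝ)).PosSemidef := Matrix.PosSemidef.one.smul hc

end EntrySum

/-- The quadratic form has a positive minimum `m` on the compact unit sphere, and survives any
perturbation with `entrySum` below `m`. -/
theorem isOpen_pdCone : IsOpen (pdCone K) := by
  refine Metric.isOpen_iff.2 ?_
  intro R hR
  obtain ⟨m, hm, hmR⟩ : ∃ m : ℝ, 0 < m ∧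
      ∀ v : Fin K → ℝ, m * (v ⬝ᵥ v) ≤ v ⬝ᵥ (R : Matrix (Fin K) (Fin K) ℝ) *ᵥ v := by
    set s : Set (Fin K → ℝ) := {v | v ⬝ᵥ v = 1} with hs
    have hsc : IsCompact s := by
      refine Metric.isCompact_of_isClosed_isBounded ?_ ?_
      · exact isClosed_eq (by simp only [dotProduct]; fun_prop) continuous_const
      · refine (Metric.isBounded_closedBall (x := (0 : Fin K → ℝ)) (r := 1)).subset fun v hv => ?_
        rw [mem_closedBall_zero_iff, pi_norm_le_iff_of_nonneg zero_le_one]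
        intro i
        have : v i * v i ≤ 1 := by
          rw [← show v ⬝ᵥ v = 1 from hv]
          exact Finset.single_le_sum (f := fun a => v a * v a) (fun a _ => mul_self_nonneg _)
            (Finset.mem_univ i)
        rw [Real.norm_eq_abs]
        exact abs_le_one_iff_mul_self_le_one.2 this
    have hcont : Continuous fun v : Fin K → ℝ => v ⬝ᵥ (R : Matrix (Fin K) (Fin K) ℝ) *ᵥ v := by
      simp only [dotProduct, Matrix.mulVec]; fun_prop
    have hscale : ∀ v : Fin K → ℝ, v ≠ 0 → ∃ c : ℝ, ∃ u ∈ s, v = c • u ∧ v ⬝ᵥ v = c ^ 2 :=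
      fun v hv => by
        have hpos : 0 < v ⬝ᵥ v := lt_of_le_of_ne
          (Finset.sum_nonneg fun _ _ => mul_self_nonneg _)
          fun h => hv (dotProduct_self_eq_zero.1 h.symm)
        have hsq := Real.sq_sqrt hpos.le
        have hne : √(v ⬝ᵥ v) ≠ 0 := (Real.sqrt_pos.2 hpos).ne'
        refine ⟨√(v ⬝ᵥ v), (√(v ⬝ᵥ v))⁻¹ • v, ?_, ?_, hsq.symm⟩
        · rw [hs, mem_ofPred_eq, smul_dotProduct, dotProduct_smul, smul_eq_mul, smul_eq_mul]
          field_simp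
          exact hsq.symm
        · rw [smul_smul, mul_inv_cancel₀ hne, one_smul]
    -- The sphere is empty exactly when `K = 0`; then every vector is zero and any `m` works.
    rcases s.eq_empty_or_nonempty with he | hne
    · refine ⟨1, one_pos, fun v => ?_⟩
      by_cases hv : v = 0
      · simp [hv]
      · obtain ⟨c, u, hu, -⟩ := hscale v hv
        rw [he] at hu
        exact hu.elim
    · obtain ⟨v₀, hv₀, hmin⟩ := hsc.exists_isMinOn hne hcont.continuousOn
      have hv₀0 : v₀ ≠ 0 := fun h => by
        have : v₀ ⬝ᵥ v₀ = 1 := hv₀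
        simp [h] at this
      refine ⟨_, by simpa using Matrix.PosDef.dotProduct_mulVec_pos hR hv₀0, fun v => ?_⟩
      by_cases hv : v = 0
      · simp [hv]
      · obtain ⟨c, u, hu, rfl, hc⟩ := hscale v hv
        have := isMinOn_iff.1 hmin u hu
        rw [hc, Matrix.mulVec_smul, dotProduct_smul, smul_dotProduct, smul_eq_mul, smul_eq_mul,
          ← mul_assoc, ← pow_two, mul_comm]
        exact mul_le_mul_of_nonneg_left this (sq_nonneg c)
  -- From `entrySum ≤ K² ‖·‖`; the added 1 covers `K = 0`.
  refine ⟨m / (K ^ 2 + 1), by positivity, fun R' hR' => ?_⟩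
  have hD : entrySum (R' - R : SymMat K).1 < m := by
    have h1 := entrySum_le (R' - R : SymMat K).1
    have h2 : ‖(R' - R : SymMat K).1‖ < m / (K ^ 2 + 1) := by
      rw [← Submodule.coe_norm, ← dist_eq_norm]; exact hR'
    rw [lt_div_iff₀ (by positivity)] at h2
    have := norm_nonneg (R' - R : SymMat K).1
    nlinarith
  refine Matrix.PosDef.of_dotProduct_mulVec_pos ?_ fun v hv => ?_
  · rw [Matrix.IsHermitian, Matrix.conjTranspose_eq_transpose_of_trivial]
    exact R'.2
  · have hpos : 0 < v ⬝ᵥ v := lt_of_le_of_ne (Finset.sum_nonneg fun _ _ => mul_self_nonneg _)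
      fun h => hv (dotProduct_self_eq_zero.1 h.symm)
    have e : (R' : Matrix (Fin K) (Fin K) ℝ) = R.1 + (R' - R : SymMat K).1 := by simp
    rw [star_trivial, e, Matrix.add_mulVec, dotProduct_add]
    have h1 := neg_le_of_abs_le (abs_dotProduct_mulVec_le (R' - R : SymMat K).1 v)
    nlinarith [hmR v]

theorem sum_sum_smul_apply {E ι κ : Type*} [NormedAddCommGroup E] [NormedSpace ℝ E] [Fintype ι]
    [Fintype κ] (c : ι → κ → ℝ) (L : ι → κ → E →L[ℝ] ℝ) (v : E) :
    (∑ a, ∑ b, c a b • L a b) v = ∑ a, ∑ b, c a b * L a b v := by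
  simp only [sum_apply, smul_apply, smul_eq_mul]

/-- The entries as continuous linear forms on symmetric matrices. -/
def entryCLM (a b : Fin K) : SymMat K →L[ℝ] ℝ :=
  LinearMap.mkContinuous
    { toFun := fun S => (S : Matrix (Fin K) (Fin K) ℝ) a b
      map_add' := fun _ _ => rfl
      map_smul' := fun _ _ => rfl } 1 fun S => by
    rw [one_mul]; exact abs_entry_le_norm S.1 a b

/-! ### Differentiability from integral formulas along cone directions. -/

section ConeCalculus

variable {f : Matrix (Fin K) (Fin K) ℝ → ℝ} {T : Fin K → Fin K → Matrix (Fin K) (Fin K) ℝ → ℝ}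

theorem abs_sub_sum_mul_le
    (hf : ∀ R S : Matrix (Fin K) (Fin K) ℝ, R.PosSemidef → S.PosSemidef →
      f (R + S) - f R = ∫ u in (0 : ℝ)..1, ∑ a, ∑ b, S a b * T a b (R + u • S))
    (hT : ∀ a b, ContinuousOn (T a b) {R | R.PosSemidef}) {R S c : Matrix (Fin K) (Fin K) ℝ}
    (hR : R.PosSemidef) (hS : S.PosSemidef) {e : ℝ}
    (hc : ∀ u ∈ Icc (0 : ℝ) 1, ∀ a b, |T a b (R + u • S) - c a b| ≤ e) :
    |f (R + S) - f R - ∑ a, ∑ b, S a b * c a b| ≤ e * entrySum S := by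
  have hi : IntervalIntegrable (fun u : ℝ => ∑ a, ∑ b, S a b * T a b (R + u • S)) volume 0 1 := by
    refine ContinuousOn.intervalIntegrable ?_
    rw [uIcc_of_le zero_le_one]
    refine continuousOn_finsetSum _ fun a _ => continuousOn_finsetSum _ fun b _ =>
      continuousOn_const.mul ((hT a b).comp (f := fun u : ℝ => R + u • S)
        (Continuous.continuousOn ?_) fun u hu => hR.add (hS.smul hu.1))
    exact continuous_const.add (continuous_id.smul continuous_const)
  have hconst : ∑ a, ∑ b, S a b * c a b = ∫ _u in (0 : ℝ)..1, ∑ a, ∑ b, S a b * c a b := by simp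
  rw [hf R S hR hS, hconst, ← intervalIntegral.integral_sub hi (by simp)]
  have := intervalIntegral.norm_integral_le_of_norm_le_const (a := (0 : ℝ)) (b := 1)
    (C := e * entrySum S) (f := fun u : ℝ => (∑ a, ∑ b, S a b * T a b (R + u • S))
      - ∑ a, ∑ b, S a b * c a b) fun u hu => by
    rw [uIoc_of_le zero_le_one] at hu
    simp only [← Finset.sum_sub_distrib, ← mul_sub]
    exact abs_sum_mul_le_entrySum S (Matrix.of fun a b => T a b (R + u • S) - c a b)
      fun a b => hc u ⟨hu.1.le, hu.2⟩ a b
  simpa using this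

/-- The integral formula covers only positive semidefinite increments. For `D = R' - R` and `δ =
entrySum D`, both `D + δ I` and `δ I` are such, and the point `R' + δ I` is reached from `R` and
from `R'`. The two steps have total `entrySum` at most `(1 + 2K) δ`. -/
theorem abs_sub_sub_sum_mul_le
    (hf : ∀ R S : Matrix (Fin K) (Fin K) ℝ, R.PosSemidef → S.PosSemidef →
      f (R + S) - f R = ∫ u in (0 : ℝ)..1, ∑ a, ∑ b, S a b * T a b (R + u • S))
    (hT : ∀ a b, ContinuousOn (T a b) {R | R.PosSemidef}) {R R' c : Matrix (Fin K) (Fin K) ℝ}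
    (hR : R.PosSemidef) (hR' : R'.PosSemidef) {e : ℝ} (he : 0 ≤ e)
    (hc : ∀ P : Matrix (Fin K) (Fin K) ℝ, P.PosSemidef →
      ‖P - R‖ ≤ ‖R' - R‖ + entrySum (R' - R) * ‖(1 : Matrix (Fin K) (Fin K) ℝ)‖ →
      ∀ a b, |T a b P - c a b| ≤ e) :
    |f R' - f R - ∑ a, ∑ b, (R' - R) a b * c a b| ≤ e * ((1 + 2 * K) * entrySum (R' - R)) := by
  set D := R' - R with hD
  set δ := entrySum D
  have hδ : 0 ≤ δ := entrySum_nonneg D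
  set I : Matrix (Fin K) (Fin K) ℝ := 1 with hI
  have hRs : ∀ {R : Matrix (Fin K) (Fin K) ℝ}, R.PosSemidef → R.IsSymm := fun h => by
    have := h.isHermitian
    rwa [Matrix.IsHermitian, Matrix.conjTranspose_eq_transpose_of_trivial] at this
  have hP : (D + δ • I).PosSemidef := posSemidef_add_smul_one ((hRs hR').sub (hRs hR)) le_rfl
  have hQ : (δ • I).PosSemidef := posSemidef_smul_one hδ
  have e1 : R + (D + δ • I) = R' + δ • I := by rw [hD]; abel
  have h1 := abs_sub_sum_mul_le hf hT (c := c) hR hP (e := e) fun u hu a b => by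
    refine hc _ (hR.add (hP.smul hu.1)) ?_ a b
    rw [add_sub_cancel_left, norm_smul, Real.norm_of_nonneg hu.1]
    calc u * ‖D + δ • I‖ ≤ 1 * ‖D + δ • I‖ := mul_le_mul_of_nonneg_right hu.2 (norm_nonneg _)
      _ ≤ ‖D‖ + δ * ‖I‖ := by
          rw [one_mul]
          refine (norm_add_le _ _).trans ?_
          rw [norm_smul, Real.norm_of_nonneg hδ]
  have h2 := abs_sub_sum_mul_le hf hT (c := c) hR' hQ (e := e) fun u hu a b => by
    refine hc _ (hR'.add (hQ.smul hu.1)) ?_ a b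
    have : R' + u • δ • I - R = D + u • δ • I := by rw [hD]; abel
    rw [this]
    refine (norm_add_le _ _).trans (add_le_add_right ?_ _)
    rw [norm_smul, norm_smul, Real.norm_of_nonneg hδ, Real.norm_of_nonneg hu.1]
    exact mul_le_of_le_one_left (by positivity) hu.2
  rw [e1] at h1
  have hb := (entrySum_add_le D (δ • I)).trans_eq
    (congrArg (entrySum D + ·) (entrySum_smul_one (K := K) hδ))
  rw [entrySum_smul_one hδ] at h2
  have e2 : ∑ a, ∑ b, (D + δ • I) a b * c a b
      = ∑ a, ∑ b, D a b * c a b + ∑ a, ∑ b, (δ • I) a b * c a b := by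
    simp only [Matrix.add_apply, add_mul, Finset.sum_add_distrib]
  rw [e2] at h1
  have h3 := mul_le_mul_of_nonneg_left hb he
  rw [abs_le] at h1 h2 ⊢
  change _ ∧ _ at h1
  have : e * (entrySum D + K * δ) + e * (K * δ) = e * ((1 + 2 * K) * δ) := by
    simp only [δ]; ring
  constructor <;> linarith [h1.1, h1.2, h2.1, h2.2]

theorem abs_sub_le_mul_norm
    (hf : ∀ R S : Matrix (Fin K) (Fin K) ℝ, R.PosSemidef → S.PosSemidef →
      f (R + S) - f R = ∫ u in (0 : ℝ)..1, ∑ a, ∑ b, S a b * T a b (R + u • S))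
    (hT : ∀ a b, ContinuousOn (T a b) {R | R.PosSemidef}) {C : ℝ} (hC : 0 ≤ C)
    (hTC : ∀ R : Matrix (Fin K) (Fin K) ℝ, R.PosSemidef → ∀ a b, |T a b R| ≤ C)
    {R R' : Matrix (Fin K) (Fin K) ℝ} (hR : R.PosSemidef) (hR' : R'.PosSemidef) :
    |f R' - f R| ≤ C * ((1 + 2 * K) * K ^ 2) * ‖R' - R‖ := by
  have h := abs_sub_sub_sum_mul_le hf hT (c := 0) hR hR' hC fun P hP _ a b => by
    simpa using hTC P hP a b
  simp only [Matrix.zero_apply, mul_zero, Finset.sum_const_zero, sub_zero] at h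
  refine h.trans ?_
  rw [mul_assoc, mul_assoc]
  exact mul_le_mul_of_nonneg_left
    (mul_le_mul_of_nonneg_left (entrySum_le _) (by positivity)) hC

/-- Near `R` the coefficients `T` differ little from their values at `R`, including along the detour
through `R' + δ I`, whose size is also `O(‖R' - R‖)`. Openness of the cone makes all nearby `R'`
admissible. -/
theorem hasFDerivAt_of_integral
    (hf : ∀ R S : Matrix (Fin K) (Fin K) ℝ, R.PosSemidef → S.PosSemidef →
      f (R + S) - f R = ∫ u in (0 : ℝ)..1, ∑ a, ∑ b, S a b * T a b (R + u • S))
    (hT : ∀ a b, ContinuousOn (T a b) {R | R.PosSemidef}) {R : SymMat K} (hR : R ∈ pdCone K) :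
    HasFDerivAt (fun R : SymMat K => f R.1) (∑ a, ∑ b, T a b R.1 • entryCLM a b) R := by
  refine hasFDerivAt_iff_isLittleO.2 (Asymptotics.isLittleO_iff.2 ?_)
  intro ε hε
  have hRp : (R : Matrix (Fin K) (Fin K) ℝ).PosSemidef := Matrix.PosDef.posSemidef hR
  set e := ε / ((1 + 2 * K) * K ^ 2 + 1) with he
  have he0 : 0 < e := by positivity
  have hev : ∀ᶠ P in 𝓝[{R | R.PosSemidef}] R.1, ∀ a b, |T a b P - T a b R.1| ≤ e := by
    simp only [eventually_all]
    intro a b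
    have := (hT a b R.1 hRp).eventually (Metric.closedBall_mem_nhds _ he0)
    filter_upwards [this] with P hP using hP
  obtain ⟨ρ, hρ, hball⟩ := Metric.mem_nhdsWithin_iff.1 hev
  have hlim : Tendsto (fun R' : SymMat K => ‖R'.1 - R.1‖
      + entrySum (R'.1 - R.1) * ‖(1 : Matrix (Fin K) (Fin K) ℝ)‖) (𝓝 R) (𝓝 0) := by
    refine squeeze_zero (g := fun R' : SymMat K => ‖R' - R‖
      + K ^ 2 * ‖R' - R‖ * ‖(1 : Matrix (Fin K) (Fin K) ℝ)‖) (fun R' => ?_) (fun R' => ?_) ?_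
    · have := entrySum_nonneg (R'.1 - R.1); positivity
    · exact add_le_add le_rfl (mul_le_mul_of_nonneg_right (entrySum_le _) (norm_nonneg _))
    · have h := tendsto_norm_sub_self R
      have h2 := h.add ((h.const_mul ((K : ℝ) ^ 2)).mul_const ‖(1 : Matrix (Fin K) (Fin K) ℝ)‖)
      rwa [mul_zero, zero_mul, add_zero] at h2
  filter_upwards [isOpen_pdCone.mem_nhds hR, hlim.eventually (gt_mem_nhds hρ)] with R' hR' hlt
  have h := abs_sub_sub_sum_mul_le hf hT (c := Matrix.of fun a b => T a b R.1) hRp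
    (Matrix.PosDef.posSemidef hR') he0.le fun P hP hPd a b =>
      hball ⟨by rw [Metric.mem_ball, dist_eq_norm]; exact hPd.trans_lt hlt, hP⟩ a b
  have e1 : (∑ a, ∑ b, T a b R.1 • entryCLM a b) (R' - R)
      = ∑ a, ∑ b, (R'.1 - R.1) a b * Matrix.of (fun a b => T a b R.1) a b := by
    refine (sum_sum_smul_apply (fun a b => T a b R.1) entryCLM (R' - R)).trans ?_
    exact Finset.sum_congr rfl fun a _ => Finset.sum_congr rfl fun b _ => mul_comm _ _
  refine (congrArg (fun z => ‖f R'.1 - f R.1 - z‖) e1).trans_le (h.trans ?_)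
  calc e * ((1 + 2 * K) * entrySum (R'.1 - R.1))
      ≤ e * ((1 + 2 * K) * (K ^ 2 * ‖R' - R‖)) := by
        refine mul_le_mul_of_nonneg_left (mul_le_mul_of_nonneg_left (entrySum_le _) ?_) he0.le
        positivity
    _ = e * ((1 + 2 * K) * K ^ 2) * ‖R' - R‖ := by ring
    _ ≤ ε * ‖R' - R‖ := by
        refine mul_le_mul_of_nonneg_right ?_ (norm_nonneg _)
        rw [he, div_mul_eq_mul_div, div_le_iff₀ (by positivity)]
        nlinarith

end ConeCalculus

end TensorInterp

end

noncomputable section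

/-! ### Vector fields with power coefficients. -/

section PowerField

open Filter Topology
open scoped NNReal

variable {E ι : Type*} [NormedAddCommGroup E] [NormedSpace ℝ E] [Fintype ι]

/-- The combination of the vectors `v i` with coefficients `m i ^ k`. -/
def powerField (v : ι → E) (k : ℕ) (m : ι → E → ℝ) (x : E) : E := ∑ i, m i x ^ k • v i

/-- The derivative of `powerField` when `m i` has derivative `G i`. -/
def powerFieldDeriv (v : ι → E) (k : ℕ) (m : ι → E → ℝ) (G : ι → E → E →L[ℝ] ℝ) (x : E) :
    E →L[ℝ] E :=
  ∑ i, ((k * m i x ^ (k - 1)) • G i x).smulRight (v i)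

variable {v : ι → E} {k : ℕ} {C : Set E} {ρ : E → E}

theorem norm_powerField_le {m : ι → E → ℝ} {B : ℝ} {x : E} (hB : ∀ i, |m i x| ≤ B) :
    ‖powerField v k m x‖ ≤ B ^ k * ∑ i, ‖v i‖ := by
  rw [powerField, Finset.mul_sum]
  refine (norm_sum_le _ _).trans (Finset.sum_le_sum fun i _ => ?_)
  rw [norm_smul, norm_pow]
  exact mul_le_mul_of_nonneg_right (pow_le_pow_left₀ (norm_nonneg _) (hB i) k) (norm_nonneg _)

theorem norm_powerField_sub_le {m : ι → E → ℝ} {B L : ℝ} {x y : E}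
    (hx : ∀ i, |m i x| ≤ B) (hy : ∀ i, |m i y| ≤ B) (hL : ∀ i, |m i x - m i y| ≤ L * ‖x - y‖) :
    ‖powerField v k m x - powerField v k m y‖
      ≤ L * k * B ^ (k - 1) * (∑ i, ‖v i‖) * ‖x - y‖ := by
  rw [powerField, powerField, ← Finset.sum_sub_distrib, Finset.mul_sum, Finset.sum_mul]
  refine (norm_sum_le _ _).trans (Finset.sum_le_sum fun i _ => ?_)
  rw [← sub_smul, norm_smul, Real.norm_eq_abs]
  have h := abs_pow_sub_pow_le (m i x) (m i y) k
  have h2 : |m i x - m i y| * k * max |m i x| |m i y| ^ (k - 1)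
      ≤ L * ‖x - y‖ * k * B ^ (k - 1) := by
    have h0 : 0 ≤ L * ‖x - y‖ := (abs_nonneg _).trans (hL i)
    refine mul_le_mul (mul_le_mul_of_nonneg_right (hL i) (Nat.cast_nonneg k))
      (pow_le_pow_left₀ (le_max_of_le_left (abs_nonneg _)) (max_le (hx i) (hy i)) _)
      (by positivity) (mul_nonneg h0 (Nat.cast_nonneg k))
  calc |m i x ^ k - m i y ^ k| * ‖v i‖ ≤ L * ‖x - y‖ * k * B ^ (k - 1) * ‖v i‖ :=
        mul_le_mul_of_nonneg_right (h.trans h2) (norm_nonneg _)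
    _ = L * k * B ^ (k - 1) * ‖v i‖ * ‖x - y‖ := by ring

theorem exists_lipschitzWith_powerField {m : ℝ → ι → E → ℝ} {B L : ℝ} (hB0 : 0 ≤ B) (hL0 : 0 ≤ L)
    {r : ℝ≥0} (hρ : LipschitzWith r ρ) (hρC : ∀ x, ρ x ∈ C)
    (hB : ∀ t ∈ Icc (0 : ℝ) 1, ∀ x ∈ C, ∀ i, |m t i x| ≤ B)
    (hL : ∀ t ∈ Icc (0 : ℝ) 1, ∀ x ∈ C, ∀ y ∈ C, ∀ i, |m t i x - m t i y| ≤ L * ‖x - y‖) :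
    ∃ M : ℝ≥0, ∀ t ∈ Icc (0 : ℝ) 1, LipschitzWith M fun x => powerField v k (m t) (ρ x) := by
  set c : ℝ := L * k * B ^ (k - 1) * ∑ i, ‖v i‖
  have hc : 0 ≤ c := by positivity
  refine ⟨c.toNNReal * r, fun t ht => LipschitzWith.of_dist_le_mul fun x y => ?_⟩
  rw [dist_eq_norm]
  refine (norm_powerField_sub_le (hB t ht _ (hρC x)) (hB t ht _ (hρC y))
    (hL t ht _ (hρC x) _ (hρC y))).trans ?_
  rw [NNReal.coe_mul, Real.coe_toNNReal c hc, ← dist_eq_norm]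
  exact (mul_le_mul_of_nonneg_left (hρ.dist_le_mul x y) hc).trans_eq (mul_assoc _ _ _).symm

theorem continuousOn_powerField {m : ℝ → ι → E → ℝ}
    (hm : ∀ i, ContinuousOn (fun z : ℝ × E => m z.1 i z.2) (Icc 0 1 ×ˢ C)) (hρ : Continuous ρ)
    (hρC : ∀ x, ρ x ∈ C) :
    ContinuousOn (fun z : ℝ × E => powerField v k (m z.1) (ρ z.2)) (Icc 0 1 ×ˢ univ) := by
  refine continuousOn_finsetSum _ fun i _ => ContinuousOn.smul (ContinuousOn.pow ?_ k)
    continuousOn_const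
  exact (hm i).comp (f := fun z : ℝ × E => (z.1, ρ z.2))
    (continuous_fst.prodMk (hρ.comp continuous_snd)).continuousOn fun z hz => ⟨hz.1, hρC z.2⟩

theorem hasFDerivAt_powerField {m : ι → E → ℝ} {G : ι → E → E →L[ℝ] ℝ} {x : E}
    (hG : ∀ i, HasFDerivAt (m i) (G i x) x) :
    HasFDerivAt (powerField v k m) (powerFieldDeriv v k m G x) x := by
  refine HasFDerivAt.fun_sum fun i _ => ?_
  have := ((hG i).pow k).smul_const (v i)
  simpa using this

theorem continuousOn_powerFieldDeriv {m : ℝ → ι → E → ℝ} {G : ℝ → ι → E → E →L[ℝ] ℝ}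
    {s : Set (ℝ × E)} (hm : ∀ i, ContinuousOn (fun z : ℝ × E => m z.1 i z.2) s)
    (hG : ∀ i, ContinuousOn (fun z : ℝ × E => G z.1 i z.2) s) :
    ContinuousOn (fun z : ℝ × E => powerFieldDeriv v k (m z.1) (G z.1) z.2) s := by
  refine continuousOn_finsetSum _ fun i _ => ?_
  have h : ContinuousOn (fun z : ℝ × E => (k * m z.1 i z.2 ^ (k - 1)) • G z.1 i z.2) s :=
    (continuousOn_const.mul ((hm i).pow _)).smul (hG i)
  exact (ContinuousLinearMap.smulRightL ℝ E E).flip (v i) |>.continuous.comp_continuousOn h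

/-- The derivative is a sum of rank-one maps, and the trace of `y ↦ G y • v` is `G v`. The family
`v` need not be a basis. -/
theorem trace_powerFieldDeriv [FiniteDimensional ℝ E] (m : ι → E → ℝ) (G : ι → E → E →L[ℝ] ℝ)
    (x : E) : LinearMap.trace ℝ E (powerFieldDeriv v k m G x).toLinearMap
      = ∑ i, k * m i x ^ (k - 1) * G i x (v i) := by
  have e : (powerFieldDeriv v k m G x).toLinearMap
      = ∑ i, ((k * m i x ^ (k - 1)) • G i x).toLinearMap.smulRight (v i) := by
    ext y
    simp [powerFieldDeriv]
  rw [e, map_sum]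
  simp [LinearMap.trace_smulRight]

end PowerField

/-! ### Flows of bounded Lipschitz fields. -/

section Flow

open Filter Topology
open scoped NNReal

variable {E : Type*} [NormedAddCommGroup E] [NormedSpace ℝ E] {F : ℝ → E → E} {M L : ℝ≥0}

theorem exists_flow [CompleteSpace E] (hM : ∀ t ∈ Icc (0 : ℝ) 1, LipschitzWith M (F t))
    (hF : ContinuousOn (fun z : ℝ × E => F z.1 z.2) (Icc 0 1 ×ˢ univ))
    (hL : ∀ t ∈ Icc (0 : ℝ) 1, ∀ x, ‖F t x‖ ≤ L) :
    ∃ φ : ℝ → E → E, ∀ x, φ 0 x = x ∧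
      ∀ t ∈ Icc (0 : ℝ) 1, HasDerivWithinAt (fun s => φ s x) (F t (φ t x)) (Icc 0 1) t := by
  have hcont : ∀ x, ContinuousOn (fun t => F t x) (Icc 0 1) := fun x =>
    hF.comp (f := fun t : ℝ => (t, x)) (by fun_prop) fun t ht => ⟨ht, mem_univ _⟩
  choose α hα0 hα using fun x => exists_solution_of_lipschitz_of_bounded hM hcont hL x
  exact ⟨fun t x => α x t, fun x => ⟨hα0 x, hα x⟩⟩

theorem eqOn_of_hasDerivWithinAt (hM : ∀ t ∈ Icc (0 : ℝ) 1, LipschitzWith M (F t)) {α β : ℝ → E}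
    (hα : ∀ t ∈ Icc (0 : ℝ) 1, HasDerivWithinAt α (F t (α t)) (Icc 0 1) t)
    (hβ : ∀ t ∈ Icc (0 : ℝ) 1, HasDerivWithinAt β (F t (β t)) (Icc 0 1) t) (h0 : α 0 = β 0) :
    EqOn α β (Icc 0 1) :=
  ODE_solution_unique_of_mem_Icc_right (s := fun _ => univ)
    (fun t ht => (hM t (Ico_subset_Icc_self ht)).lipschitzOnWith)
    (continuousOn_of_hasDerivWithinAt_Icc hα)
    (fun t ht => hasDerivWithinAt_Ici_of_Icc ht (hα t (Ico_subset_Icc_self ht)))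
    (fun _ _ => mem_univ _) (continuousOn_of_hasDerivWithinAt_Icc hβ)
    (fun t ht => hasDerivWithinAt_Ici_of_Icc ht (hβ t (Ico_subset_Icc_self ht)))
    (fun _ _ => mem_univ _) h0

/-- Uniqueness backwards in time; it gives injectivity of the flow maps. -/
theorem eq_zero_of_hasDerivWithinAt (hM : ∀ t ∈ Icc (0 : ℝ) 1, LipschitzWith M (F t))
    {α β : ℝ → E} (hα : ∀ t ∈ Icc (0 : ℝ) 1, HasDerivWithinAt α (F t (α t)) (Icc 0 1) t)
    (hβ : ∀ t ∈ Icc (0 : ℝ) 1, HasDerivWithinAt β (F t (β t)) (Icc 0 1) t) {t : ℝ}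
    (ht : t ∈ Icc (0 : ℝ) 1) (h : α t = β t) : α 0 = β 0 := by
  have hleft : ∀ {α : ℝ → E}, (∀ t ∈ Icc (0 : ℝ) 1, HasDerivWithinAt α (F t (α t)) (Icc 0 1) t) →
      ∀ s ∈ Ioc 0 t, HasDerivWithinAt α (F s (α s)) (Iic s) s := fun hα s hs => by
    refine (hα s ⟨hs.1.le, hs.2.trans ht.2⟩).mono_of_mem_nhdsWithin ?_
    filter_upwards [Icc_mem_nhdsLE hs.1] with u hu
    exact ⟨hu.1, hu.2.trans (hs.2.trans ht.2)⟩
  have hsub : Icc 0 t ⊆ Icc (0 : ℝ) 1 := Icc_subset_Icc_right ht.2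
  exact ODE_solution_unique_of_mem_Icc_left (s := fun _ => univ)
    (fun s hs => (hM s (hsub (Ioc_subset_Icc_self hs))).lipschitzOnWith)
    ((continuousOn_of_hasDerivWithinAt_Icc hα).mono hsub) (hleft hα) (fun _ _ => mem_univ _)
    ((continuousOn_of_hasDerivWithinAt_Icc hβ).mono hsub) (hleft hβ) (fun _ _ => mem_univ _) h
    ⟨le_rfl, ht.1⟩

theorem contDiffOn_one_of_hasDerivWithinAt
    (hF : ContinuousOn (fun z : ℝ × E => F z.1 z.2) (Icc 0 1 ×ˢ univ)) {α : ℝ → E}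
    (hα : ∀ t ∈ Icc (0 : ℝ) 1, HasDerivWithinAt α (F t (α t)) (Icc 0 1) t) :
    ContDiffOn ℝ 1 α (Icc 0 1) := by
  have hu : UniqueDiffOn ℝ (Icc (0 : ℝ) 1) := uniqueDiffOn_Icc one_pos
  refine (contDiffOn_one_iff_derivWithin hu).2
    ⟨fun t ht => (hα t ht).differentiableWithinAt, ?_⟩
  have h : ContinuousOn (fun t => F t (α t)) (Icc 0 1) :=
    hF.comp (f := fun t : ℝ => (t, α t))
      (continuousOn_id.prodMk (continuousOn_of_hasDerivWithinAt_Icc hα))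
      fun t ht => ⟨ht, mem_univ _⟩
  exact h.congr fun t ht => (hα t ht).derivWithin (hu t ht)

/-- A flow of nonnegative divergence is a volume expanding diffeomorphism onto its image. -/
theorem isC1DiffeoOnImage_flow [FiniteDimensional ℝ E]
    (hM : ∀ t ∈ Icc (0 : ℝ) 1, LipschitzWith M (F t)) {F' : ℝ → E → E →L[ℝ] E} {Ω : Set E}
    (hΩ : IsOpen Ω) (hd : ∀ t ∈ Icc (0 : ℝ) 1, ∀ x ∈ Ω, HasFDerivAt (F t) (F' t x) x)
    (hF' : ContinuousOn (fun z : ℝ × E => F' z.1 z.2) (Icc (0 : ℝ) 1 ×ˢ Ω))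
    (htr : ∀ t ∈ Icc (0 : ℝ) 1, ∀ x ∈ Ω, 0 ≤ LinearMap.trace ℝ E (F' t x).toLinearMap)
    {φ : ℝ → E → E} (h0 : ∀ x ∈ Ω, φ 0 x = x)
    (hφ : ∀ x ∈ Ω, ∀ t ∈ Icc (0 : ℝ) 1,
      HasDerivWithinAt (fun s => φ s x) (F t (φ t x)) (Icc 0 1) t)
    (hmem : ∀ x ∈ Ω, ∀ t ∈ Icc (0 : ℝ) 1, φ t x ∈ Ω) {t : ℝ} (ht : t ∈ Icc (0 : ℝ) 1) :
    TensorInterp.IsC1DiffeoOnImage (φ t) Ω ∧ ∀ x ∈ Ω, 1 ≤ (fderiv ℝ (φ t) x).det := by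
  have := FiniteDimensional.complete ℝ E
  have h : ∀ x ∈ Ω, HasStrictFDerivAt (φ t) (fderiv ℝ (φ t) x) x ∧
      1 ≤ (fderiv ℝ (φ t) x).det := fun x hx => by
    obtain ⟨V, hV0, hV, hs⟩ := exists_hasStrictFDerivAt_flow hM hΩ hd hF' h0 hφ hmem hx
    rw [(hs t ht).hasFDerivAt.fderiv]
    exact ⟨hs t ht, one_le_det_of_trace_nonneg hV0 hV
      (fun s hs => htr s hs _ (hmem x hx s hs)) ht⟩
  refine ⟨isC1DiffeoOnImage_of_hasStrictFDerivAt hΩ (fun x hx => (h x hx).1)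
    (fun x hx => (zero_lt_one.trans_le (h x hx).2).ne') fun x hx y hy hxy => ?_,
    fun x hx => (h x hx).2⟩
  have := eq_zero_of_hasDerivWithinAt hM (hφ x hx) (hφ y hy) ht hxy
  rwa [h0 x hx, h0 y hy] at this

end Flow

end

noncomputable section

theorem Submodule.hasDerivWithinAt_coe_iff {E : Type*} [NormedAddCommGroup E] [NormedSpace ℝ E]
    {P : Submodule ℝ E} {α : ℝ → P} {d : P} {s : Set ℝ} {t : ℝ} :
    HasDerivWithinAt (fun u => (α u : E)) (d : E) s t ↔ HasDerivWithinAt α d s t := by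
  rw [hasDerivWithinAt_iff_isLittleO, hasDerivWithinAt_iff_isLittleO, Asymptotics.isLittleO_iff,
    Asymptotics.isLittleO_iff]
  rfl

namespace TensorInterp

open Filter Topology
open scoped NNReal

variable {K : ℕ}

/-- Schur's product theorem, by induction from the all-ones matrix, which has rank one. -/
theorem posSemidef_hadamardPow {A : Matrix (Fin K) (Fin K) ℝ} (hA : A.PosSemidef) (m : ℕ) :
    (hadamardPow A m).PosSemidef := by
  induction m with
  | zero =>
    have e : hadamardPow A 0 = Matrix.vecMulVec (fun _ => 1) (star fun _ => 1) := by
      ext a b; simp [hadamardPow, Matrix.vecMulVec_apply]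
    rw [e]
    exact Matrix.posSemidef_vecMulVec_self_star _
  | succ m ih =>
    have e : hadamardPow A (m + 1) = (hadamardPow A m).hadamard A := by
      ext a b; simp [hadamardPow, pow_succ]
    rw [e]
    exact ih.hadamard hA

/-! ### Symmetrised matrix units. -/

section SymmetricBasis

/-- The symmetrised matrix units. -/
def symSingle (i : Fin K × Fin K) : SymMat K :=
  ⟨(1 / 2 : ℝ) • (Matrix.single i.1 i.2 1 + Matrix.single i.2 i.1 1), by
    change Matrix.IsSymm _
    rw [Matrix.IsSymm, Matrix.transpose_smul, Matrix.transpose_add, Matrix.transpose_single,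
      Matrix.transpose_single, add_comm]⟩

theorem symSingle_apply (i : Fin K × Fin K) (a b : Fin K) :
    (symSingle i).1 a b = 1 / 2 * ((if i.1 = a ∧ i.2 = b then 1 else 0)
      + if i.2 = a ∧ i.1 = b then 1 else 0) := by
  have h : (symSingle i).1 a b
      = 1 / 2 * (Matrix.single i.1 i.2 (1 : ℝ) a b + Matrix.single i.2 i.1 (1 : ℝ) a b) := rfl
  rw [h, Matrix.single_apply, Matrix.single_apply]

/-- The sum runs over ordered pairs, so off-diagonal units occur twice, each with weight one half.
The family spans redundantly, which is enough for the trace formula. -/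
theorem sum_smul_symSingle {A : Matrix (Fin K) (Fin K) ℝ} (hA : A.IsSymm) :
    ((∑ i : Fin K × Fin K, A i.1 i.2 • symSingle i : SymMat K) : Matrix (Fin K) (Fin K) ℝ) = A := by
  ext a b
  rw [Submodule.coe_sum, Matrix.sum_apply]
  have h : ∀ i : Fin K × Fin K, (A i.1 i.2 • symSingle i : SymMat K).1 a b
      = 1 / 2 * (if i = (a, b) then A i.1 i.2 else 0)
        + 1 / 2 * (if i = (b, a) then A i.1 i.2 else 0) := fun i => by
    have h1 : (A i.1 i.2 • symSingle i : SymMat K).1 a b = A i.1 i.2 * (symSingle i).1 a b := rfl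
    have h2 : (i.1 = a ∧ i.2 = b) ↔ i = (a, b) := by rw [Prod.ext_iff]
    have h3 : (i.2 = a ∧ i.1 = b) ↔ i = (b, a) := by rw [Prod.ext_iff, and_comm]
    rw [h1, symSingle_apply]
    simp only [h2, h3]
    split_ifs <;> ring
  simp only [h, Finset.sum_add_distrib, ← Finset.mul_sum, Finset.sum_ite_eq', Finset.mem_univ,
    if_true]
  have := hA.apply a b
  linarith

theorem coe_powerField {A : SymMat K → Matrix (Fin K) (Fin K) ℝ} {R : SymMat K}
    (hA : (A R).IsSymm) (k : ℕ) :
    (powerField symSingle k (fun (i : Fin K × Fin K) R => A R i.1 i.2) R : SymMat K).1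
      = hadamardPow (A R) k := by
  refine sum_smul_symSingle (A := hadamardPow (A R) k) ?_
  ext a b
  simp only [hadamardPow, Matrix.transpose_apply, Matrix.map_apply]
  rw [hA.apply]

end SymmetricBasis

/-! ### A Lipschitz retraction onto the positive semidefinite cone. -/

section Retraction

theorem zero_mem_psdCone : (0 : SymMat K) ∈ psdCone K := Matrix.PosSemidef.zero

/-- The identity matrix as a symmetric matrix. -/
def symOne (K : ℕ) : SymMat K := ⟨1, Matrix.isSymm_one⟩

/-- A Lipschitz retraction of the symmetric matrices onto the positive semidefinite cone. -/
def psdRetract (R : SymMat K) : SymMat K :=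
  R + (K ^ 2 * Metric.infDist R (psdCone K)) • symOne K

theorem psdRetract_of_mem {R : SymMat K} (hR : R ∈ psdCone K) : psdRetract R = R := by
  rw [psdRetract, Metric.infDist_zero_of_mem hR, mul_zero, zero_smul, add_zero]

/-- If `P` in the cone is near `R`, then `entrySum (R - P) ≤ K² ‖R - P‖`, so adding that multiple of
the identity to `R - P` makes it positive semidefinite. -/
theorem psdRetract_mem (R : SymMat K) : psdRetract R ∈ psdCone K := by
  set d := Metric.infDist R (psdCone K)
  -- The slack `ε` avoids asking that the distance be attained; it is sent to zero inside each
  -- quadratic form.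
  have hps : ∀ ε : ℝ, 0 < ε →
      (R.1 + (K ^ 2 * (d + ε)) • (1 : Matrix (Fin K) (Fin K) ℝ)).PosSemidef := fun ε hε => by
    obtain ⟨P, hP, hd⟩ := (Metric.infDist_lt_iff (x := R) (r := d + ε) ⟨0, zero_mem_psdCone⟩).1
      (lt_add_of_pos_right d hε)
    have hE : entrySum (R - P : SymMat K).1 ≤ K ^ 2 * (d + ε) := by
      refine (entrySum_le _).trans (mul_le_mul_of_nonneg_left ?_ (by positivity))
      exact (dist_eq_norm R P).symm.trans_le hd.le
    have h := Matrix.PosSemidef.add hP (posSemidef_add_smul_one (R - P : SymMat K).2 hE)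
    rwa [← add_assoc, ← Submodule.coe_add, add_sub_cancel] at h
  refine Matrix.PosSemidef.of_dotProduct_mulVec_nonneg ?_ fun v => ?_
  · rw [Matrix.IsHermitian, Matrix.conjTranspose_eq_transpose_of_trivial]
    exact (psdRetract R).2
  have hlim : Tendsto (fun ε : ℝ => v ⬝ᵥ R.1 *ᵥ v + K ^ 2 * (d + ε) * (v ⬝ᵥ v)) (𝓝[>] 0)
      (𝓝 (v ⬝ᵥ R.1 *ᵥ v + K ^ 2 * (d + 0) * (v ⬝ᵥ v))) := by
    have : Continuous fun ε : ℝ => v ⬝ᵥ R.1 *ᵥ v + K ^ 2 * (d + ε) * (v ⬝ᵥ v) := by fun_prop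
    exact (this.tendsto 0).mono_left nhdsWithin_le_nhds
  have h : 0 ≤ v ⬝ᵥ R.1 *ᵥ v + K ^ 2 * (d + 0) * (v ⬝ᵥ v) := by
    refine ge_of_tendsto hlim ?_
    filter_upwards [self_mem_nhdsWithin] with ε hε
    have := (hps ε hε).dotProduct_mulVec_nonneg v
    rwa [star_trivial, Matrix.add_mulVec, dotProduct_add, Matrix.smul_mulVec, Matrix.one_mulVec,
      dotProduct_smul, smul_eq_mul] at this
  have e : (psdRetract R).1 = R.1 + (K ^ 2 * d) • (1 : Matrix (Fin K) (Fin K) ℝ) := rfl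
  rwa [e, star_trivial, Matrix.add_mulVec, dotProduct_add, Matrix.smul_mulVec, Matrix.one_mulVec,
    dotProduct_smul, smul_eq_mul, ← add_zero d]

theorem dist_psdRetract_le (R R' : SymMat K) :
    dist (psdRetract R) (psdRetract R') ≤ (1 + K ^ 2 * ‖symOne K‖) * dist R R' := by
  have h := (Metric.lipschitz_infDist_pt (psdCone K)).dist_le_mul R R'
  rw [NNReal.coe_one, one_mul, Real.dist_eq] at h
  have e : psdRetract R - psdRetract R' = (R - R')
      + (K ^ 2 * (Metric.infDist R (psdCone K) - Metric.infDist R' (psdCone K))) • symOne K := by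
    simp only [psdRetract]
    module
  rw [dist_eq_norm, e]
  refine (norm_add_le _ _).trans ?_
  rw [norm_smul, norm_mul, Real.norm_eq_abs (_ - _), Real.norm_of_nonneg (by positivity), add_mul,
    one_mul, ← dist_eq_norm, mul_right_comm]
  gcongr

theorem lipschitzWith_psdRetract :
    LipschitzWith (1 + K ^ 2 * ‖symOne K‖₊) (psdRetract (K := K)) :=
  LipschitzWith.of_dist_le_mul fun R R' => by
    push_cast
    exact dist_psdRetract_le R R'

end Retraction

end TensorInterp

end

noncomputable section

/-! ### The interpolation field: regularity, invariance of the cones, divergence. -/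

namespace TensorInterp

open Filter Topology
open scoped NNReal

variable {p n K : ℕ}

/-- By Cauchy–Schwarz over the rows, `sqSum x ^ 2 ≤ n K² ∑ ‖x_j‖⁴`. -/
theorem integrable_sqSum_sq {PX : Measure (Fin K → ℝ)} [IsProbabilityMeasure PX]
    (hPX : Integrable (fun x : Fin K → ℝ => ‖x‖ ^ 4) PX) :
    Integrable (fun x : Config n K => sqSum x ^ 2) (Measure.pi fun _ => PX) := by
  have hi : ∀ j : Fin n, Integrable (fun x : Config n K => ‖x j‖ ^ 4)
      (Measure.pi fun _ => PX) := fun j =>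
    (measurePreserving_eval (fun _ : Fin n => PX) j).integrable_comp_of_integrable hPX
  refine (((integrable_finsetSum Finset.univ fun j _ => hi j).const_mul (K ^ 2)).const_mul n).mono'
    (measurable_sqSum.pow_const 2).aestronglyMeasurable (.of_forall fun x => ?_)
  have h1 : sqSum x ≤ ∑ j, K * ‖x j‖ ^ 2 := Finset.sum_le_sum fun j _ => by
    refine (Finset.sum_le_sum (g := fun _ => ‖x j‖ ^ 2) fun l _ => ?_).trans (by simp)
    rw [← sq_abs]
    exact pow_le_pow_left₀ (abs_nonneg _) (norm_le_pi_norm (x j) l) 2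
  have h0 : 0 ≤ sqSum x := Finset.sum_nonneg fun _ _ => Finset.sum_nonneg fun _ _ => sq_nonneg _
  rw [Real.norm_of_nonneg (sq_nonneg _)]
  refine (pow_le_pow_left₀ h0 h1 2).trans ((sq_sum_le_card_mul_sum_sq).trans_eq ?_)
  rw [Finset.card_univ, Fintype.card_fin]
  simp only [Finset.mul_sum]
  exact Finset.sum_congr rfl fun j _ => by ring

/-- The entries of the overlap as functions on symmetric matrices. -/
def overlapEntry (p : ℕ) {n K : ℕ} (μ : Measure (Config n K)) (t : ℝ) (i : Fin K × Fin K)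
    (R : SymMat K) : ℝ := posteriorOverlap p μ t R.1 i.1 i.2

/-- The gradients of the entries of the overlap. -/
def overlapGrad (p : ℕ) {n K : ℕ} (μ : Measure (Config n K)) (t : ℝ) (i : Fin K × Fin K)
    (R : SymMat K) : SymMat K →L[ℝ] ℝ :=
  ∑ a, ∑ b, overlapDeriv p μ i.1 i.2 t a b R.1 • entryCLM a b

/-- The vector field of the interpolation path, extended to all symmetric matrices. -/
def interpField (p : ℕ) {n K : ℕ} (μ : Measure (Config n K)) (t : ℝ) (R : SymMat K) : SymMat K :=
  powerField symSingle (p - 1) (overlapEntry p μ t) (psdRetract R)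

variable {μ : Measure (Config n K)} [IsFiniteMeasure μ]

theorem continuousOn_coe_prod {F : ℝ × Matrix (Fin K) (Fin K) ℝ → ℝ}
    (hF : ContinuousOn F (Icc 0 1 ×ˢ {R | R.PosSemidef})) :
    ContinuousOn (fun z : ℝ × SymMat K => F (z.1, z.2.1)) (Icc 0 1 ×ˢ psdCone K) :=
  hF.comp (f := fun z : ℝ × SymMat K => (z.1, z.2.1))
    (continuous_fst.prodMk (continuous_subtype_val.comp continuous_snd)).continuousOn
    fun _ hz => hz

theorem continuousOn_overlapEntry (hq : Integrable (sqSum : Config n K → ℝ) μ) (hμ : μ ≠ 0)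
    (i : Fin K × Fin K) :
    ContinuousOn (fun z : ℝ × SymMat K => overlapEntry p μ z.1 i z.2) (Icc 0 1 ×ˢ psdCone K) :=
  continuousOn_coe_prod (continuousOn_posteriorOverlap hq hμ i.1 i.2)

theorem abs_overlapEntry_sub_le (hq2 : Integrable (fun x : Config n K => sqSum x ^ 2) μ)
    (hμ : μ ≠ 0) {t : ℝ} (ht : t ∈ Icc (0 : ℝ) 1) {R R' : SymMat K} (hR : R ∈ psdCone K)
    (hR' : R' ∈ psdCone K) (i : Fin K × Fin K) :
    |overlapEntry p μ t i R - overlapEntry p μ t i R'|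
      ≤ n * (4 * ∫ x, sqSum x ^ 2 ∂μ) * ((1 + 2 * K) * K ^ 2) * ‖R - R'‖ := by
  refine abs_sub_le_mul_norm (f := fun R => posteriorOverlap p μ t R i.1 i.2)
    (T := fun a b R => overlapDeriv p μ i.1 i.2 t a b R)
    (fun _ _ hR hS => posteriorOverlap_add_sub hq2 hμ ht hR hS i.1 i.2) (fun a b => ?_) ?_
    (fun R hR a b => abs_overlapDeriv_le hq2 ht.2 hR i.1 i.2 a b) hR' hR
  · exact (continuousOn_overlapDeriv hq2 hμ i.1 i.2 a b).comp
      (f := fun R : Matrix (Fin K) (Fin K) ℝ => (t, R))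
      (continuous_const.prodMk continuous_id).continuousOn fun _ hR => ⟨ht, hR⟩
  · exact mul_nonneg (Nat.cast_nonneg n)
      (mul_nonneg (by norm_num) (integral_nonneg fun x => sq_nonneg _))

theorem hasFDerivAt_overlapEntry (hq2 : Integrable (fun x : Config n K => sqSum x ^ 2) μ)
    (hμ : μ ≠ 0) {t : ℝ} (ht : t ∈ Icc (0 : ℝ) 1) {R : SymMat K} (hR : R ∈ pdCone K)
    (i : Fin K × Fin K) :
    HasFDerivAt (overlapEntry p μ t i) (overlapGrad p μ t i R) R :=
  hasFDerivAt_of_integral (f := fun R => posteriorOverlap p μ t R i.1 i.2)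
    (T := fun a b R => overlapDeriv p μ i.1 i.2 t a b R)
    (fun _ _ hR hS => posteriorOverlap_add_sub hq2 hμ ht hR hS i.1 i.2)
    (fun a b => (continuousOn_overlapDeriv hq2 hμ i.1 i.2 a b).comp
      (f := fun R : Matrix (Fin K) (Fin K) ℝ => (t, R))
      (continuous_const.prodMk continuous_id).continuousOn fun _ hR => ⟨ht, hR⟩) hR

theorem continuousOn_sum_sum_smul {X E α β : Type*} [TopologicalSpace X] [NormedAddCommGroup E]
    [NormedSpace ℝ E] [Fintype α] [Fintype β] {c : α → β → X → ℝ} {s : Set X}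
    (hc : ∀ a b, ContinuousOn (c a b) s) (L : α → β → E →L[ℝ] ℝ) :
    ContinuousOn (fun x => ∑ a, ∑ b, c a b x • L a b) s :=
  continuousOn_finsetSum _ fun a _ => continuousOn_finsetSum _ fun b _ =>
    (hc a b).smul continuousOn_const

theorem continuousOn_overlapGrad (hq2 : Integrable (fun x : Config n K => sqSum x ^ 2) μ)
    (hμ : μ ≠ 0) (i : Fin K × Fin K) :
    ContinuousOn (fun z : ℝ × SymMat K => overlapGrad p μ z.1 i z.2) (Icc 0 1 ×ˢ psdCone K) :=
  continuousOn_sum_sum_smul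
    (c := fun a b (z : ℝ × SymMat K) => overlapDeriv p μ i.1 i.2 z.1 a b z.2.1)
    (fun a b => continuousOn_coe_prod (continuousOn_overlapDeriv hq2 hμ i.1 i.2 a b)) entryCLM

/-- Pairing the gradient with the symmetrised unit gives half of the two mixed derivatives, which
`overlapDeriv_add_nonneg` controls. -/
theorem overlapGrad_symSingle_nonneg (hq2 : Integrable (fun x : Config n K => sqSum x ^ 2) μ)
    {t : ℝ} (ht : t ≤ 1) {R : SymMat K} (hR : R ∈ psdCone K) (i : Fin K × Fin K) :
    0 ≤ overlapGrad p μ t i R (symSingle i) := by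
  have h := overlapDeriv_add_nonneg (p := p) hq2 ht hR i.1 i.2
  have e : overlapGrad p μ t i R (symSingle i) = 1 / 2 * (overlapDeriv p μ i.1 i.2 t i.1 i.2 R.1
      + overlapDeriv p μ i.1 i.2 t i.2 i.1 R.1) := by
    refine (sum_sum_smul_apply (fun a b => overlapDeriv p μ i.1 i.2 t a b R.1) entryCLM
      (symSingle i)).trans ?_
    change ∑ a, ∑ b, overlapDeriv p μ i.1 i.2 t a b R.1 * (symSingle i).1 a b = _
    simp only [symSingle_apply, ite_and, mul_add, mul_ite, mul_one, mul_zero,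
      Finset.sum_add_distrib]
    congr 1
    · rw [Finset.sum_eq_single_of_mem i.1 (Finset.mem_univ _) fun a _ ha => by simp [ha.symm]]
      simp [mul_comm]
    · rw [Finset.sum_eq_single_of_mem i.2 (Finset.mem_univ _) fun a _ ha => by simp [ha.symm]]
      simp [mul_comm]
  rw [e]
  exact mul_nonneg (by norm_num) h

theorem coe_interpField (ν : Measure (Config n K)) (t : ℝ) (R : SymMat K) :
    (interpField p ν t R).1 = hadamardPow (posteriorOverlap p ν t (psdRetract R).1) (p - 1) :=
  coe_powerField (A := fun R : SymMat K => posteriorOverlap p ν t R.1)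
    (isSymm_posteriorOverlap ν t _) (p - 1)

theorem interpField_mem_psdCone (hq : Integrable (sqSum : Config n K → ℝ) μ) {t : ℝ} (ht : t ≤ 1)
    (R : SymMat K) : interpField p μ t R ∈ psdCone K := by
  change (interpField p μ t R).1.PosSemidef
  rw [coe_interpField]
  exact posSemidef_hadamardPow (posSemidef_posteriorOverlap hq ht (psdRetract_mem R)) _

theorem continuousOn_interpField (hq : Integrable (sqSum : Config n K → ℝ) μ) (hμ : μ ≠ 0) :
    ContinuousOn (fun z : ℝ × SymMat K => interpField p μ z.1 z.2) (Icc 0 1 ×ˢ univ) :=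
  continuousOn_powerField (fun i => continuousOn_overlapEntry hq hμ i)
    lipschitzWith_psdRetract.continuous psdRetract_mem

/-- Boundedness and the Lipschitz estimate for the overlap hold on the cone only; the retraction
carries them to all symmetric matrices. -/
theorem exists_lipschitzWith_interpField (hn : 1 ≤ n)
    (hq2 : Integrable (fun x : Config n K => sqSum x ^ 2) μ) (hμ : μ ≠ 0) :
    ∃ M : ℝ≥0, ∀ t ∈ Icc (0 : ℝ) 1, LipschitzWith M (interpField p μ t) := by
  refine exists_lipschitzWith_powerField (m := overlapEntry p μ) (B := ∫ x, sqSum x ∂μ)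
    (L := n * (4 * ∫ x, sqSum x ^ 2 ∂μ) * ((1 + 2 * K) * K ^ 2)) ?_ ?_ lipschitzWith_psdRetract
    psdRetract_mem
    (fun t ht R hR i => abs_posteriorOverlap_le hn (integrable_sqSum hq2) ht.2 hR i.1 i.2)
    (fun t ht R hR R' hR' i => abs_overlapEntry_sub_le hq2 hμ ht hR hR' i)
  · exact integral_nonneg fun x => Finset.sum_nonneg fun _ _ => Finset.sum_nonneg fun _ _ =>
      sq_nonneg _
  · have : 0 ≤ ∫ x, sqSum x ^ 2 ∂μ := integral_nonneg fun x => sq_nonneg _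
    positivity

theorem exists_norm_interpField_le (hn : 1 ≤ n) (hq : Integrable (sqSum : Config n K → ℝ) μ) :
    ∃ L : ℝ≥0, ∀ t ∈ Icc (0 : ℝ) 1, ∀ R, ‖interpField p μ t R‖ ≤ L := by
  refine ⟨((∫ x, sqSum x ∂μ) ^ (p - 1) * ∑ i : Fin K × Fin K, ‖symSingle i‖).toNNReal,
    fun t ht R => ?_⟩
  exact (norm_powerField_le fun i =>
    abs_posteriorOverlap_le hn hq ht.2 (psdRetract_mem R) i.1 i.2).trans (Real.le_coe_toNNReal _)

/-- Along solutions, the quadratic forms are nondecreasing. -/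
theorem dotProduct_mulVec_le_of_hasDerivWithinAt (hq : Integrable (sqSum : Config n K → ℝ) μ)
    {α : ℝ → SymMat K}
    (hα : ∀ t ∈ Icc (0 : ℝ) 1, HasDerivWithinAt α (interpField p μ t (α t)) (Icc 0 1) t)
    (v : Fin K → ℝ) {t : ℝ} (ht : t ∈ Icc (0 : ℝ) 1) :
    v ⬝ᵥ (α 0).1 *ᵥ v ≤ v ⬝ᵥ (α t).1 *ᵥ v := by
  have hd : ∀ t ∈ Icc (0 : ℝ) 1, HasDerivWithinAt (fun s => v ⬝ᵥ (α s).1 *ᵥ v)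
      (v ⬝ᵥ (interpField p μ t (α t)).1 *ᵥ v) (Icc 0 1) t := fun t ht => by
    have hab : ∀ a b, HasDerivWithinAt (fun s => (α s).1 a b) ((interpField p μ t (α t)).1 a b)
        (Icc 0 1) t := fun a b =>
      (entryCLM a b).hasFDerivAt.comp_hasDerivWithinAt t (hα t ht)
    simp only [dotProduct, Matrix.mulVec]
    exact HasDerivWithinAt.fun_sum fun a _ => (HasDerivWithinAt.fun_sum fun b _ =>
      (hab a b).mul_const (v b)).const_mul (v a)
  have hmono := monotoneOn_of_hasDerivWithinAt_nonneg (convex_Icc (0 : ℝ) 1)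
    (continuousOn_of_hasDerivWithinAt_Icc hd)
    (fun t ht => (hd t (interior_subset ht)).mono interior_subset) fun t ht => by
      have := Matrix.PosSemidef.dotProduct_mulVec_nonneg
        (interpField_mem_psdCone (p := p) hq (interior_subset ht).2 (α t)) v
      rwa [star_trivial] at this
  exact hmono ⟨le_rfl, zero_le_one⟩ ht ht.1

theorem mem_psdCone_of_hasDerivWithinAt (hq : Integrable (sqSum : Config n K → ℝ) μ)
    {α : ℝ → SymMat K}
    (hα : ∀ t ∈ Icc (0 : ℝ) 1, HasDerivWithinAt α (interpField p μ t (α t)) (Icc 0 1) t)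
    (h0 : α 0 ∈ psdCone K) {t : ℝ} (ht : t ∈ Icc (0 : ℝ) 1) : α t ∈ psdCone K := by
  refine Matrix.PosSemidef.of_dotProduct_mulVec_nonneg ?_ fun v => ?_
  · rw [Matrix.IsHermitian, Matrix.conjTranspose_eq_transpose_of_trivial]
    exact (α t).2
  · have := Matrix.PosSemidef.dotProduct_mulVec_nonneg h0 v
    rw [star_trivial] at this ⊢
    exact this.trans (dotProduct_mulVec_le_of_hasDerivWithinAt hq hα v ht)

theorem mem_pdCone_of_hasDerivWithinAt (hq : Integrable (sqSum : Config n K → ℝ) μ)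
    {α : ℝ → SymMat K}
    (hα : ∀ t ∈ Icc (0 : ℝ) 1, HasDerivWithinAt α (interpField p μ t (α t)) (Icc 0 1) t)
    (h0 : α 0 ∈ pdCone K) {t : ℝ} (ht : t ∈ Icc (0 : ℝ) 1) : α t ∈ pdCone K := by
  refine Matrix.PosDef.of_dotProduct_mulVec_pos ?_ fun v hv => ?_
  · rw [Matrix.IsHermitian, Matrix.conjTranspose_eq_transpose_of_trivial]
    exact (α t).2
  · have := Matrix.PosDef.dotProduct_mulVec_pos h0 hv
    rw [star_trivial] at this ⊢
    exact this.trans_le (dotProduct_mulVec_le_of_hasDerivWithinAt hq hα v ht)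

theorem pdCone_subset_psdCone : pdCone K ⊆ psdCone K := fun _ h => Matrix.PosDef.posSemidef h

/-- The derivative of the vector field of the interpolation path. -/
def interpFieldDeriv (p : ℕ) {n K : ℕ} (μ : Measure (Config n K)) (t : ℝ) (R : SymMat K) :
    SymMat K →L[ℝ] SymMat K :=
  powerFieldDeriv symSingle (p - 1) (overlapEntry p μ t) (overlapGrad p μ t) R

/-- On the open positive definite cone the retraction is locally the identity, so its lack of
smoothness does not matter. -/
theorem hasFDerivAt_interpField (hq2 : Integrable (fun x : Config n K => sqSum x ^ 2) μ)
    (hμ : μ ≠ 0) {t : ℝ} (ht : t ∈ Icc (0 : ℝ) 1) {R : SymMat K} (hR : R ∈ pdCone K) :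
    HasFDerivAt (interpField p μ t) (interpFieldDeriv p μ t R) R := by
  have h : HasFDerivAt (powerField symSingle (p - 1) (overlapEntry p μ t))
      (interpFieldDeriv p μ t R) R :=
    hasFDerivAt_powerField fun i => hasFDerivAt_overlapEntry hq2 hμ ht hR i
  refine h.congr_of_eventuallyEq ?_
  filter_upwards [isOpen_pdCone.mem_nhds hR] with R' hR'
  rw [interpField, psdRetract_of_mem (pdCone_subset_psdCone hR')]

theorem continuousOn_interpFieldDeriv (hq2 : Integrable (fun x : Config n K => sqSum x ^ 2) μ)
    (hμ : μ ≠ 0) :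
    ContinuousOn (fun z : ℝ × SymMat K => interpFieldDeriv p μ z.1 z.2) (Icc 0 1 ×ˢ pdCone K) :=
  (continuousOn_powerFieldDeriv
    (fun i => continuousOn_overlapEntry (integrable_sqSum hq2) hμ i)
    (fun i => continuousOn_overlapGrad hq2 hμ i)).mono (prod_mono_right pdCone_subset_psdCone)

/-- Each term of the trace is `p - 1` times an entry to the power `p - 2` times a nonnegative
derivative. Evenness of `p` is needed because the entries may be negative. -/
theorem trace_interpFieldDeriv_nonneg (hq2 : Integrable (fun x : Config n K => sqSum x ^ 2) μ)
    (hp : 1 ≤ p) (hpe : Even p) {t : ℝ} (ht : t ≤ 1) {R : SymMat K} (hR : R ∈ psdCone K) :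
    0 ≤ LinearMap.trace ℝ (SymMat K) (interpFieldDeriv p μ t R).toLinearMap := by
  have h := trace_powerFieldDeriv (v := symSingle) (k := p - 1) (overlapEntry p μ t)
    (overlapGrad p μ t) R
  have hev : Even (p - 1 - 1) := by
    obtain ⟨q, hq⟩ := hpe
    exact ⟨q - 1, by omega⟩
  refine le_of_le_of_eq (Finset.sum_nonneg fun i _ => ?_) h.symm
  exact mul_nonneg (mul_nonneg (Nat.cast_nonneg _) (hev.pow_nonneg _))
    (overlapGrad_symSingle_nonneg hq2 ht hR i)

/-- On the cone the extended field is the original one. An interpolation path lies there by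
definition, a solution of the extended equation because its quadratic forms are nondecreasing. -/
theorem hasDerivWithinAt_iff_isInterpPath {PX : Measure (Fin K → ℝ)} [IsProbabilityMeasure PX]
    (hq : Integrable (sqSum : Config n K → ℝ) (Measure.pi fun _ => PX)) {ε : SymMat K}
    (hε : ε ∈ psdCone K) {α : ℝ → SymMat K} :
    IsInterpPath p n PX ε α ↔ α 0 = ε ∧ ∀ t ∈ Icc (0 : ℝ) 1,
      HasDerivWithinAt α (interpField p (Measure.pi fun _ : Fin n => PX) t (α t)) (Icc 0 1) t := by
  have key : ∀ t ∈ Icc (0 : ℝ) 1, α t ∈ psdCone K →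
      hadamardPow (meanOverlap p n PX t (α t).1) (p - 1)
        = (interpField p (Measure.pi fun _ : Fin n => PX) t (α t)).1 := fun t ht h => by
    rw [coe_interpField, psdRetract_of_mem h, meanOverlap_eq_posteriorOverlap PX hq ht.2 h]
  constructor
  · intro h
    refine ⟨h.init, fun t ht => Submodule.hasDerivWithinAt_coe_iff.1 ?_⟩
    rw [← key t ht (h.mem_psdCone t ht)]
    exact h.ode t ht
  · rintro ⟨h0, h⟩
    have hmem : ∀ t ∈ Icc (0 : ℝ) 1, α t ∈ psdCone K := fun t ht =>
      mem_psdCone_of_hasDerivWithinAt hq h (h0 ▸ hε) ht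
    refine ⟨hmem, h0, fun t ht => ?_⟩
    rw [key t ht (hmem t ht)]
    exact Submodule.hasDerivWithinAt_coe_iff.2 (h t ht)

end TensorInterp

end

theorem mainTheorem4 (p n K : ℕ) (hp : 1 ≤ p) (hn : 1 ≤ n)
    (PX : Measure (Fin K → ℝ)) [IsProbabilityMeasure PX]
    (hPX : Integrable (fun x : Fin K → ℝ => ‖x‖ ^ 4) PX) :
    ∃ R : ℝ → TensorInterp.SymMat K → TensorInterp.SymMat K,
      (∀ ε ∈ TensorInterp.psdCone K,
        TensorInterp.IsInterpPath p n PX ε (fun t => R t ε) ∧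
        (∀ R' : ℝ → TensorInterp.SymMat K, TensorInterp.IsInterpPath p n PX ε R' →
          EqOn R' (fun t => R t ε) (Icc 0 1)) ∧
        ContDiffOn ℝ 1 (fun t => R t ε) (Icc 0 1) ∧
        ∃ C : ℝ, ∀ t ∈ Icc (0 : ℝ) 1, ‖R t ε‖ ≤ C) ∧
      (Even p → ∀ t ∈ Icc (0 : ℝ) 1,
        TensorInterp.IsC1DiffeoOnImage (R t) (TensorInterp.pdCone K) ∧
        ∀ ε ∈ TensorInterp.pdCone K, 1 ≤ (fderiv ℝ (R t) ε).det) := by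
  open TensorInterp in
  set μ : Measure (Config n K) := Measure.pi fun _ : Fin n => PX
  have hμ : μ ≠ 0 := IsProbabilityMeasure.ne_zero μ
  have hq2 : Integrable (fun x : Config n K => sqSum x ^ 2) μ := integrable_sqSum_sq hPX
  have hq := integrable_sqSum hq2
  obtain ⟨M, hM⟩ := exists_lipschitzWith_interpField (p := p) hn hq2 hμ
  obtain ⟨L, hL⟩ := exists_norm_interpField_le (p := p) hn hq
  have hF := continuousOn_interpField (p := p) hq hμ
  -- The flow starts from every symmetric matrix, so `fderiv` at positive definite points is an
  -- ordinary derivative.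
  obtain ⟨φ, hφ⟩ := exists_flow hM hF hL
  refine ⟨φ, fun ε hε => ⟨(hasDerivWithinAt_iff_isInterpPath hq hε).2 (hφ ε), fun R' hR' => ?_,
    contDiffOn_one_of_hasDerivWithinAt hF (hφ ε).2, ?_⟩, fun hpe t ht => ?_⟩
  · obtain ⟨h0, h⟩ := (hasDerivWithinAt_iff_isInterpPath hq hε).1 hR'
    exact eqOn_of_hasDerivWithinAt hM h (hφ ε).2 (h0.trans (hφ ε).1.symm)
  · exact isCompact_Icc.exists_bound_of_continuousOn
      (continuousOn_of_hasDerivWithinAt_Icc (hφ ε).2)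
  · exact isC1DiffeoOnImage_flow hM isOpen_pdCone
      (fun t ht R hR => hasFDerivAt_interpField hq2 hμ ht hR)
      (continuousOn_interpFieldDeriv hq2 hμ)
      (fun t ht R hR => trace_interpFieldDeriv_nonneg hq2 hp hpe ht.2 (pdCone_subset_psdCone hR))
      (fun ε _ => (hφ ε).1) (fun ε _ => (hφ ε).2)
      (fun ε hε t ht => mem_pdCone_of_hasDerivWithinAt hq (hφ ε).2
        (show φ 0 ε ∈ pdCone K by rw [(hφ ε).1]; exact hε) ht) ht
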